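/- **Setting.** Let $\mathsf a>-1$, $\mathsf b>1$, let $d\in C^1([-1,1])$ be positive, and let $\mu$ be the probability measure on $[-1,1]$ with density $Z^{-1}(1+v)^{\mathsf a}(1-v)^{\mathsf b}d(v)$, assumed centered. Fix $\lambda>\lambda_+:=\big(\int(1-v)^{-2}\,d\mu(v)\big)^{1/2}$, an integer $n_0>10$, and put $\mathfrak b:=\frac12-\frac1{\mathsf b+1}$, $\kappa_0:=N^{-1/(\mathsf b+1)}$. Fix $0<\epsilon<\big(10+\frac{\mathsf b+1}{\mathsf b-1}\big)\mathfrak b$. Let $\xi:=10\log\log N$ and $\varphi_N:=(\log N)^{K}$ with a fixed $K\ge1$. For a probability measure $\rho$ on $\mathbb R$ and $\mathrm{Im}\,z>0$ let $m_\rho(z)$ be the unique solution of $m=\int\frac{d\rho(v)}{\lambda v-z-m}$, $\mathrm{Im}\,m\ge0$; set $m_{fc}:=m_\mu$ and, for $v=(v_1,\dots,v_N)$, $\widehat m_{fc}:=m_{\widehat\mu}$ with $\widehat\mu=\frac1N\sum_i\delta_{v_i}$. Let $$\mathcal D_\epsilon=\{z=E+\mathrm i\eta:\ |E|\le 3+\lambda,\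 N^{-1/2-\epsilon}\le\eta\le N^{-1/(\mathsf b+1)+\epsilon}\},\qquad A=\{n_0,\dots,N\},$$ $$\mathcal D'_\epsilon=\{z\in\mathcal D_\epsilon:\ |\lambda v_a-z-m_{fc}(z)|>\tfrac12N^{-1/(\mathsf b+1)-\epsilon}\ \text{ for all } a\in A\}.$$ *The event $\Omega_V$.* Fix constants $\mathfrak c<1$ and $C_V>0$. The diagonal entries $1\ge v_1\ge\dots\ge v_N\ge-1$ are in $\Omega_V$ if for every $k\in\{1,\dots,n_0-1\}$: (1) $N^{-\epsilon}\kappa_0<|v_j-v_k|$ for all $j\ne k$, $|v_j-v_k|<(\log N)\kappa_0$ for all $j\le n_0$, $j\neq k$, and $N^{-\epsilon}\kappa_0<|1-v_1|<(\log N)\kappa_0$; (2) $\frac1N\sum_{i\ne k}|\lambda v_i-z-m_{fc}(z)|^{-2}<\mathfrak c$ for all $z\in\mathcal D_\epsilon$ such that $\lambda v_k$ is, among $(\lambda v_i)_{i=1}^N$, closest to $\mathrm{Re}(z+m_{fc}(z))$; and (3) $\big|\frac1N\sum_i\frac1{\lambda v_i-z-m_{fc}(z)}-\int\frac{d\mu(x)}{\lambda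 x-z-m_{fc}(z)}\big|\le C_VN^{3\epsilon/2}N^{-1/2}$ for all $z\in\mathcal D_\epsilon$. *The matrix.* $W=(w_{ij})$ is an $N\times N$ real symmetric or complex Hermitian random matrix with entries independent up to symmetry, centered, with $\mathbb P(\sqrt N|w_{ij}|>x)\le C_0e^{-x^{1/\theta}}$ for all $x>0$ ($C_0>0$, $\theta>1$ fixed), and $\mathbb E w_{ij}^2=(1+\delta_{ij})/N$ in the real case, $\mathbb E|w_{ij}|^2=1/N$ and $\mathbb E w_{ij}^2=0$ ($i\ne j$) in the complex case. The $v_i$ are held fixed (they are independent of $W$), and $\mathbb E^W$, $\mathbb P^W$ refer to the randomness of $W$ only. Put $G(z)=(\lambda\,\mathrm{diag}(v)+W-z)^{-1}$, $m(z)=\frac1N\mathrm{Tr}\,G(z)$, let $G^{(T)}$ be the resolvent of the minor with rows and columns in $T$ removed, and $F_{ab}^{(T,T')}=G_{ab}^{(T)}/G_{bb}^{(T')}$, $F_{ab}=F_{ab}^{(\emptyset,\emptyset)}$. Let $\mathbb E_a$ be the partial expectation with respect to the $a$-th row and column of $W$, and $Q_a=1-\mathbb E_a$. *The event $\Xi(z)$.*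 Fix $c_\Xi>0$. $\Xi(z)$ is the event that $|m(z)-\widehat m_{fc}(z)|\le N^{-1/2+2\epsilon}$; $\mathrm{Im}\,m(z)\le N^{-1/2+2\epsilon}$; $|F_{ab}(z)|\le\varphi_N^{c_\Xi\xi}N^{-\mathfrak b/2+\epsilon}$ and $\big|F_{ab}^{(\emptyset,\{a\})}(z)/G_{aa}(z)\big|\le\varphi_N^{c_\Xi\xi}N^{-1/2+2\epsilon}$ for all $a\ne b$ in $A$; $|Q_a(1/G_{aa}(z))|\le\varphi_N^{c_\Xi\xi}N^{-1/2+2\epsilon}$ for all $a\in A$; and $|w_{ij}|\le\varphi_N^{c_\Xi\xi}N^{-1/2}$ for all $i,j$. **Lemma (Fluctuation Average Lemma).** Fix $\nu>0$. There exist positive constants $C,c,c_0$ and $N_0$, depending only on the parameters fixed above (including $\nu$), such that for all $N\ge N_0$, all such $W$, all $v\in\Omega_V$, all $z\in\mathcal D'_\epsilon$ with $\mathbb P^W(\Xi(z)^c)\le e^{-\nu(\log N)^\xi}$, and all $p=2r$ with $r\in\{1,2,\dots\}$ and $p\le(\log N)^{\xi-3/2}$, the expectation below is finite and $$\mathbb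 E^W\Big|\frac1N\sum_{a\in A}Q_a\Big(\frac1{G_{aa}(z)}\Big)\Big|^p\le(Cp)^{cp}\,\varphi_N^{c_0p\xi}\,N^{-p/2-p\mathfrak b/2}\,N^{3p\epsilon}.$$ In particular the bound holds simultaneously for all $z\in\mathcal D'_\epsilon$ if $\bigcap_{z\in\mathcal D'_\epsilon}\Xi(z)$ satisfies the same probability estimate. -/

import Mathlib

open MeasureTheory ProbabilityTheory

noncomputable section

namespace DeformedWigner

/-! ### Scales and constants -/

/-- `ξ = 10 log log N`. -/
def xi (N : ℕ) : ℝ := 10 * Real.log (Real.log N)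

/-- `φ_N = (log N) ^ K`, with a fixed exponent `K ≥ 1`. -/
def phi (K : ℝ) (N : ℕ) : ℝ := Real.log N ^ K

/-- `𝔟 = 1/2 - 1/(b+1) = (b-1)/(2(b+1))`. -/
def frakB (b : ℝ) : ℝ := 1 / 2 - 1 / (b + 1)

/-- `κ₀ = N ^ (-1/(b+1))`. -/
def kappa0 (b : ℝ) (N : ℕ) : ℝ := (N : ℝ) ^ (-(1 / (b + 1)))

/-! ### The law of the diagonal entries and the deformed semicircle law -/

/-- The measure on `[-1,1]` with density `(1+v)^a (1-v)^b d(v)`, not yet normalised. -/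
def jacobiWeight (a b : ℝ) (d : ℝ → ℝ) : Measure ℝ :=
  (volume.restrict (Set.Icc (-1) 1)).withDensity
    fun v => ENNReal.ofReal ((1 + v) ^ a * (1 - v) ^ b * d v)

/-- The Jacobi measure with density `Z⁻¹ (1+v)^a (1-v)^b d(v) 1_{[-1,1]}(v)`, where `Z` is the
normalisation constant. -/
def jacobiMeasure (a b : ℝ) (d : ℝ → ℝ) : Measure ℝ :=
  (jacobiWeight a b d Set.univ)⁻¹ • jacobiWeight a b d

/-- `λ₊ = (∫ (1-v)⁻² dμ(v)) ^ (1/2)`. -/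
def lambdaPlus (μ : Measure ℝ) : ℝ := Real.sqrt (∫ v, ((1 - v) ^ 2)⁻¹ ∂μ)

/-- `m` solves the Pastur relation at `z`:
`m = ∫ dρ(v) / (λ v - z - m)` and `Im m ≥ 0`. -/
def IsPasturSolution (ρ : Measure ℝ) (lam : ℝ) (z m : ℂ) : Prop :=
  0 ≤ m.im ∧ m = ∫ v, ((lam : ℂ) * (v : ℂ) - z - m)⁻¹ ∂ρ

/-- The Stieltjes transform at `z` (with `Im z > 0`) of the free convolution of the semicircle law
with the law of `λ v`, `v` distributed according to the probability measure `ρ`: the solution of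
the Pastur relation at `z`, which exists and is unique for every `z` in the upper half plane. -/
def freeConvStieltjes (ρ : Measure ℝ) (lam : ℝ) (z : ℂ) : ℂ :=
  Classical.epsilon fun m => IsPasturSolution ρ lam z m

/-- The empirical measure `N⁻¹ ∑ᵢ δ_{vᵢ}`. -/
def empirical {N : ℕ} (v : Fin N → ℝ) : Measure ℝ :=
  (N : ENNReal)⁻¹ • ∑ i, Measure.dirac (v i)

/-! ### Spectral domains and the event `Ω_V`

The entry `v i` with `i : Fin N` is the `(i+1)`-st largest entry, so that the one-based index
of `i` is `(i : ℕ) + 1`. -/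

/-- The domain `D_ε`. -/
def domainD (b lam ε : ℝ) (N : ℕ) : Set ℂ :=
  {z | 0 < z.im ∧ -3 - lam ≤ z.re ∧ z.re ≤ 3 + lam ∧
    (N : ℝ) ^ (-(1 / 2) - ε) ≤ z.im ∧ z.im ≤ (N : ℝ) ^ (-(1 / (b + 1)) + ε)}

/-- The index set `A = {n₀, …, N}`. -/
def indexA (n₀ N : ℕ) : Finset (Fin N) := Finset.univ.filter fun a => n₀ ≤ (a : ℕ) + 1

/-- The domain `D'_ε`. -/
def domainD' (μ : Measure ℝ) (b lam ε : ℝ) (n₀ : ℕ) {N : ℕ} (v : Fin N → ℝ) : Set ℂ :=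
  {z | z ∈ domainD b lam ε N ∧ ∀ a ∈ indexA n₀ N,
    1 / 2 * (N : ℝ) ^ (-(1 / (b + 1)) - ε) <
      ‖(lam : ℂ) * (v a : ℂ) - z - freeConvStieltjes μ lam z‖}

/-- The configuration `v` of diagonal entries lies in `Ω_V`, with the two `N`-independent constants
`𝔠 < 1` and `CV` that enter conditions two and three. -/
structure OmegaV (μ : Measure ℝ) (b lam ε : ℝ) (n₀ : ℕ) (𝔠 CV : ℝ) {N : ℕ} (v : Fin N → ℝ) :
    Prop where
  /-- All entries lie in the support of their law. -/
  mem_support : ∀ i, v i ∈ Set.Icc (-1 : ℝ) 1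
  /-- `v₁ ≥ v₂ ≥ … ≥ v_N`. -/
  ordered : Antitone v
  /-- The `n₀ - 1` largest entries are separated from all the others. -/
  gap_lower : ∀ k : Fin N, (k : ℕ) + 1 < n₀ → ∀ j, j ≠ k →
    (N : ℝ) ^ (-ε) * kappa0 b N < |v j - v k|
  /-- The `n₀` largest entries are close to one another. -/
  gap_upper : ∀ k : Fin N, (k : ℕ) + 1 < n₀ → ∀ j : Fin N, (j : ℕ) + 1 ≤ n₀ → j ≠ k →
    |v j - v k| < Real.log N * kappa0 b N
  /-- The largest entry is at the right distance from the edge `1`. -/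
  top : ∀ k : Fin N, (k : ℕ) = 0 →
    (N : ℝ) ^ (-ε) * kappa0 b N < |1 - v k| ∧ |1 - v k| < Real.log N * kappa0 b N
  /-- If `λ v_k`, `k < n₀`, is closest to `Re (z + m_fc(z))`, then the sum without `k` of the
  squares is below `𝔠`. -/
  sum_lt : ∀ k : Fin N, (k : ℕ) + 1 < n₀ → ∀ z ∈ domainD b lam ε N,
    (∀ i, |(z + freeConvStieltjes μ lam z).re - lam * v k| ≤
      |(z + freeConvStieltjes μ lam z).re - lam * v i|) →
    1 / (N : ℝ) * ∑ i ∈ Finset.univ.erase k,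
      1 / ‖(lam : ℂ) * (v i : ℂ) - z - freeConvStieltjes μ lam z‖ ^ 2 < 𝔠
  /-- The fluctuation of the empirical average of the `vᵢ`. -/
  average : ∀ z ∈ domainD b lam ε N,
    ‖1 / (N : ℂ) * ∑ i, ((lam : ℂ) * (v i : ℂ) - z - freeConvStieltjes μ lam z)⁻¹
      - ∫ x, ((lam : ℂ) * (x : ℂ) - z - freeConvStieltjes μ lam z)⁻¹ ∂μ‖
      ≤ CV * (N : ℝ) ^ (3 * ε / 2) / Real.sqrt N

/-! ### Wigner matrices -/

/-- `W` is a real symmetric or complex Hermitian Wigner matrix: entries independent up to the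
symmetry, centered, of variance `1/N` (`2/N` on the diagonal in the real case), with
`P(√N |w_ij| > x) ≤ C₀ exp(-x^{1/θ})`. -/
structure IsWigner {N : ℕ} {Ω : Type*} [MeasurableSpace Ω] (P : Measure Ω) (C₀ θ : ℝ)
    (W : Ω → Matrix (Fin N) (Fin N) ℂ) : Prop where
  hermitian : ∀ ω, (W ω).IsHermitian
  measurable : ∀ i j, Measurable fun ω => W ω i j
  indep : iIndepFun (fun (p : {p : Fin N × Fin N // p.1 ≤ p.2}) ω => W ω p.1.1 p.1.2) P
  centered : ∀ i j, ∫ ω, W ω i j ∂P = 0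
  subexp : ∀ i j, ∀ x : ℝ, 0 < x →
    P.real {ω | x < Real.sqrt N * ‖W ω i j‖} ≤ C₀ * Real.exp (-(x ^ (1 / θ)))
  symmetry_class :
    ((∀ ω i j, (W ω i j).im = 0) ∧
      ∀ i j, ∫ ω, (W ω i j) ^ 2 ∂P = (if i = j then 2 else 1) / (N : ℂ)) ∨
    ((∀ i j, ∫ ω, ‖W ω i j‖ ^ 2 ∂P = 1 / (N : ℝ)) ∧
      ∀ i j, i ≠ j → ∫ ω, (W ω i j) ^ 2 ∂P = 0)

/-! ### Green functions

Everything below is a function of the diagonal `v` and of the matrix `M`, the value of `W`. -/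

/-- `H = λ V + W`. -/
def ham {N : ℕ} (lam : ℝ) (v : Fin N → ℝ) (M : Matrix (Fin N) (Fin N) ℂ) :
    Matrix (Fin N) (Fin N) ℂ :=
  Matrix.diagonal (fun i => (lam : ℂ) * (v i : ℂ)) + M

/-- `(H - z)⁻¹`. -/
def resolvent {N : ℕ} (H : Matrix (Fin N) (Fin N) ℂ) (z : ℂ) : Matrix (Fin N) (Fin N) ℂ :=
  (H - z • (1 : Matrix (Fin N) (Fin N) ℂ))⁻¹

/-- The operation `π_T`: all rows and columns indexed by `T` are set to zero. -/
def removeRows {N : ℕ} (T : Finset (Fin N)) (H : Matrix (Fin N) (Fin N) ℂ) :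
    Matrix (Fin N) (Fin N) ℂ :=
  Matrix.of fun i j => if i ∈ T ∨ j ∈ T then 0 else H i j

/-- `G(z) = (λ V + W - z)⁻¹`. -/
def green {N : ℕ} (lam : ℝ) (v : Fin N → ℝ) (M : Matrix (Fin N) (Fin N) ℂ) (z : ℂ) :
    Matrix (Fin N) (Fin N) ℂ :=
  resolvent (ham lam v M) z

/-- The Green function `G^{(T)}(z)` of the minor. Only entries with both indices outside `T` are
used; there `(π_T(H) - z)⁻¹` agrees with the resolvent of the minor obtained by deleting the rows
and columns in `T`, as `π_T(H) - z` is block diagonal. -/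
def greenMinor {N : ℕ} (T : Finset (Fin N)) (lam : ℝ) (v : Fin N → ℝ)
    (M : Matrix (Fin N) (Fin N) ℂ) (z : ℂ) : Matrix (Fin N) (Fin N) ℂ :=
  resolvent (removeRows T (ham lam v M)) z

/-- `m(z) = N⁻¹ Tr G(z)`. -/
def meanGreen {N : ℕ} (lam : ℝ) (v : Fin N → ℝ) (M : Matrix (Fin N) (Fin N) ℂ) (z : ℂ) : ℂ :=
  1 / (N : ℂ) * (green lam v M z).trace

/-- `F_ab^{(T,T')} = G_ab^{(T)} / G_bb^{(T')}`. -/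
def fraction {N : ℕ} (T T' : Finset (Fin N)) (lam : ℝ) (v : Fin N → ℝ)
    (M : Matrix (Fin N) (Fin N) ℂ) (z : ℂ) (a b : Fin N) : ℂ :=
  greenMinor T lam v M z a b / greenMinor T' lam v M z b b

/-! ### Partial expectations -/

/-- The matrix `M` with its `a`-th row and column replaced by those of `M'`. -/
def replaceRow {N : ℕ} (a : Fin N) (M M' : Matrix (Fin N) (Fin N) ℂ) :
    Matrix (Fin N) (Fin N) ℂ :=
  Matrix.of fun i j => if i = a ∨ j = a then M' i j else M i j

/-- The partial expectation `E_a f` with respect to the `a`-th column/row of `W`, as a function of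
the matrix: the `a`-th row and column are averaged over an independent copy, all other entries are
kept fixed. -/
def partialExp {N : ℕ} {Ω : Type*} [MeasurableSpace Ω] (P : Measure Ω)
    (W : Ω → Matrix (Fin N) (Fin N) ℂ) (a : Fin N)
    (f : Matrix (Fin N) (Fin N) ℂ → ℂ) (M : Matrix (Fin N) (Fin N) ℂ) : ℂ :=
  ∫ ω', f (replaceRow a M (W ω')) ∂P

/-- `Q_a (1 / G_aa(z))`, where `Q_a = 1 - E_a`, as a function of the matrix. -/
def fluct {N : ℕ} {Ω : Type*} [MeasurableSpace Ω] (P : Measure Ω)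
    (W : Ω → Matrix (Fin N) (Fin N) ℂ) (lam : ℝ) (v : Fin N → ℝ) (z : ℂ) (a : Fin N)
    (M : Matrix (Fin N) (Fin N) ℂ) : ℂ :=
  1 / green lam v M z a a - partialExp P W a (fun M' => 1 / green lam v M' z a a) M

/-! ### The event `Ξ` -/

/-- The value `M` of `W` lies in the event `Ξ(z)`, with the constant `cΞ` in the exponents. -/
structure EventXi (b lam ε : ℝ) (n₀ : ℕ) (K cΞ : ℝ) {N : ℕ} {Ω : Type*} [MeasurableSpace Ω]
    (P : Measure Ω) (W : Ω → Matrix (Fin N) (Fin N) ℂ) (v : Fin N → ℝ) (z : ℂ)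
    (M : Matrix (Fin N) (Fin N) ℂ) : Prop where
  /-- `|m(z) - m̂_fc(z)| ≤ N^{-1/2+2ε}`. -/
  local_law : ‖meanGreen lam v M z - freeConvStieltjes (empirical v) lam z‖
    ≤ (N : ℝ) ^ (-(1 / 2) + 2 * ε)
  /-- `Im m(z) ≤ N^{-1/2+2ε}`. -/
  im_bound : (meanGreen lam v M z).im ≤ (N : ℝ) ^ (-(1 / 2) + 2 * ε)
  /-- `|F_ab| ≤ φ^{cξ} N^{-𝔟/2} N^ε`. -/
  fraction_bound : ∀ a ∈ indexA n₀ N, ∀ a' ∈ indexA n₀ N, a ≠ a' →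
    ‖fraction ∅ ∅ lam v M z a a'‖ ≤
      phi K N ^ (cΞ * xi N) * (N : ℝ) ^ (-(frakB b) / 2) * (N : ℝ) ^ ε
  /-- `|F_ab^{(∅,a)} / G_aa| ≤ φ^{cξ} N^{-1/2} N^{2ε}`. -/
  fraction_div_bound : ∀ a ∈ indexA n₀ N, ∀ a' ∈ indexA n₀ N, a ≠ a' →
    ‖fraction ∅ {a} lam v M z a a' / green lam v M z a a‖ ≤
      phi K N ^ (cΞ * xi N) * (N : ℝ) ^ (-(1 / 2) : ℝ) * (N : ℝ) ^ (2 * ε)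
  /-- `|Q_a(1/G_aa)| ≤ φ^{cξ} N^{-1/2+2ε}`. -/
  fluct_bound : ∀ a ∈ indexA n₀ N, ‖fluct P W lam v z a M‖ ≤
      phi K N ^ (cΞ * xi N) * (N : ℝ) ^ (-(1 / 2) + 2 * ε)
  /-- `|w_ij| ≤ φ^{cξ} / √N`. -/
  entry_bound : ∀ i j, ‖M i j‖ ≤ phi K N ^ (cΞ * xi N) / Real.sqrt N

end DeformedWigner

end

/-! Write `Q_a = 1 - E_a`, `q_a = Q_a (1/G_aa)` and `Z = N⁻¹ ∑ q_a`. On the good event each `q_a` is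
at most `X = φ^{cξ} N^{-1/2+2ε}`; the average must gain one further factor of the size `Y = φ^{cξ}
N^{-𝔟/2+ε}` of the fractions `F_ab`, because `X Y` is the claimed bound up to logarithms.

The gain comes from a recursion on moments instead of an expansion of the `p`-th power. For `p =
2s+2`, `𝔼|Z|^p` is the average over `a` of `𝔼 [q_a Z^s conj(Z)^{s+1}]`. If `d_a` is the part of `Z`
that feels row `a`, then `Z - d_a` does not depend on that row, so `q_a` is orthogonal to every
function of it (`integral_mul_fluctOver`). Only the increment from `Z - d_a` to `Z` survives, and
Young's inequality gives `𝔼|Z|^p ≤ (c p)^p (√(𝔼|q|^p 𝔼|d|^p) + 𝔼|d|^p)` with suprema over `a`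
(`integral_norm_fluctMean_pow_le`). Up to the single term `q_a / N`, `d_a` is again an average of
fluctuations, now over one more row. Iterating this replaces a gain `g` by `√(y g)`, hence yields
`y^{1-2^{-n}}` after `n` steps (`integral_norm_fluctMean_pow_le_gain`). With `n` about `2 log log
N`, this is `y` up to a constant.

The recursion needs a factor `y`, comparable to `n Y`, for each extra row in `Q_a ∏_{b∈S} Q_b
(1/G_aa)`. Since `1/G_aa^{(T)}` ignores the rows in `T`, `1/G_aa` may be replaced here by `∑_{T⊆S}
(-1)^{|T|} / G_aa^{(T)}`. By the Schur complement, `1/G_aa^{(T)}` solves a linear system indexed by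
`T ∪ {a}` whose off-diagonal coefficients are the `F_ij`. Its low order Picard iterates are
polynomials of low degree in the set `T`, so the alternating sum annihilates them and leaves a
remainder of order `Y^{|S|}` (`norm_alternating_sum_minor_le`).

Off the good event, `|1/G_aa^{(T)}|` is at most a quadratic polynomial in the entries of row `a`
divided by `Im z`. Its moments are at most a power of `N` of order `p`, which the square root of the
small probability beats. If `ε ≥ 𝔟/2`, no gain is needed and the bound by `X` already suffices. -/

noncomputable section

namespace FluctuationAveraging

/-! ### Functions with all moments -/

section Moments

variable {α : Type*} [MeasurableSpace α] {π : Measure α}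

/-- Measurable functions all of whose absolute moments are finite. -/
structure HasMoments (π : Measure α) (f : α → ℂ) : Prop where
  measurable : Measurable f
  integrable_pow : ∀ n : ℕ, Integrable (fun x => ‖f x‖ ^ n) π

theorem HasMoments.integrable {f : α → ℂ} (hf : HasMoments π f) : Integrable f π := by
  have h := hf.integrable_pow 1
  simp only [pow_one] at h
  exact (integrable_norm_iff hf.measurable.aestronglyMeasurable).1 h

theorem HasMoments.add {f g : α → ℂ} (hf : HasMoments π f) (hg : HasMoments π g) :
    HasMoments π (fun x => f x + g x) where
  measurable := hf.measurable.add hg.measurable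
  integrable_pow n := by
    refine ((((hf.integrable_pow n).add (hg.integrable_pow n))).const_mul ((2 : ℝ) ^ n)).mono'
      ((hf.measurable.add hg.measurable).norm.pow_const n).aestronglyMeasurable
      (.of_forall fun x => ?_)
    rw [Real.norm_of_nonneg (by positivity)]
    have h1 : ‖f x + g x‖ ≤ 2 * max ‖f x‖ ‖g x‖ := by
      have := norm_add_le (f x) (g x)
      have := le_max_left ‖f x‖ ‖g x‖
      have := le_max_right ‖f x‖ ‖g x‖
      linarith
    calc ‖f x + g x‖ ^ n ≤ (2 * max ‖f x‖ ‖g x‖) ^ n := pow_le_pow_left₀ (norm_nonneg _) h1 n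
      _ = 2 ^ n * max ‖f x‖ ‖g x‖ ^ n := mul_pow _ _ _
      _ ≤ 2 ^ n * (‖f x‖ ^ n + ‖g x‖ ^ n) := by
        gcongr
        rcases le_total ‖f x‖ ‖g x‖ with h | h
        · rw [max_eq_right h]; exact le_add_of_nonneg_left (by positivity)
        · rw [max_eq_left h]; exact le_add_of_nonneg_right (by positivity)

theorem HasMoments.mul {f g : α → ℂ} (hf : HasMoments π f) (hg : HasMoments π g) :
    HasMoments π (fun x => f x * g x) where
  measurable := hf.measurable.mul hg.measurable
  integrable_pow n := by
    -- Products cost a doubled exponent, `|fg|^n ≤ |f|^{2n} + |g|^{2n}`; closure under products is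
    -- the reason to ask for all moments.
    refine (((hf.integrable_pow (n * 2)).add (hg.integrable_pow (n * 2)))).mono'
      ((hf.measurable.mul hg.measurable).norm.pow_const n).aestronglyMeasurable
      (.of_forall fun x => ?_)
    rw [Real.norm_of_nonneg (by positivity), norm_mul, mul_pow]
    simp only [Pi.add_apply, pow_mul]
    nlinarith [sq_nonneg (‖f x‖ ^ n - ‖g x‖ ^ n), sq_nonneg (‖f x‖ ^ n), sq_nonneg (‖g x‖ ^ n)]

theorem HasMoments.const [IsFiniteMeasure π] (c : ℂ) : HasMoments π (fun _ => c) where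
  measurable := measurable_const
  integrable_pow _ := integrable_const _

theorem HasMoments.const_mul {f : α → ℂ} (c : ℂ) (hf : HasMoments π f) :
    HasMoments π (fun x => c * f x) where
  measurable := hf.measurable.const_mul c
  integrable_pow n := by
    simp only [norm_mul, mul_pow]
    exact (hf.integrable_pow n).const_mul _

theorem HasMoments.sub {f g : α → ℂ} (hf : HasMoments π f) (hg : HasMoments π g) :
    HasMoments π (fun x => f x - g x) := by
  have := hf.add (hg.const_mul (-1))
  simpa [sub_eq_add_neg] using this

theorem HasMoments.sum [IsFiniteMeasure π] {β : Type*} (s : Finset β) {f : β → α → ℂ}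
    (hf : ∀ b ∈ s, HasMoments π (f b)) : HasMoments π (fun x => ∑ b ∈ s, f b x) := by
  classical
  induction s using Finset.induction_on with
  | empty => simpa using HasMoments.const (π := π) 0
  | insert a s ha ih =>
    simp only [Finset.sum_insert ha]
    exact (hf a (by simp)).add (ih fun b hb => hf b (by simp [hb]))

theorem HasMoments.pow [IsFiniteMeasure π] {f : α → ℂ} (hf : HasMoments π f) (n : ℕ) :
    HasMoments π (fun x => f x ^ n) where
  measurable := hf.measurable.pow_const n
  integrable_pow m := by
    simp only [norm_pow, ← pow_mul]
    exact hf.integrable_pow _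

theorem HasMoments.conj {f : α → ℂ} (hf : HasMoments π f) :
    HasMoments π (fun x => (starRingEnd ℂ) (f x)) where
  measurable := Complex.continuous_conj.measurable.comp hf.measurable
  integrable_pow m := by
    simp only [RCLike.norm_conj]
    exact hf.integrable_pow _

theorem HasMoments.comp {α' : Type*} [MeasurableSpace α'] {π' : Measure α'} {f : α → ℂ}
    (hf : HasMoments π f) {φ : α' → α} (hφ : MeasurePreserving φ π' π) :
    HasMoments π' (fun x => f (φ x)) where
  measurable := hf.measurable.comp hφ.measurable
  integrable_pow n := (hφ.integrable_comp (hf.integrable_pow n).aestronglyMeasurable).2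
    (hf.integrable_pow n)

theorem HasMoments.integrable_norm_mul_pow {f g : α → ℂ} (hf : HasMoments π f)
    (hg : HasMoments π g) (m n : ℕ) [IsFiniteMeasure π] :
    Integrable (fun x => ‖f x‖ ^ m * ‖g x‖ ^ n) π := by
  have := ((hf.pow m).mul (hg.pow n)).integrable_pow 1
  simpa using this

theorem integral_mul_le_sqrt_mul_sqrt {f g : α → ℝ} (hf0 : ∀ x, 0 ≤ f x) (hg0 : ∀ x, 0 ≤ g x)
    (hf : AEStronglyMeasurable f π) (hg : AEStronglyMeasurable g π)
    (hf2 : Integrable (fun x => f x ^ 2) π) (hg2 : Integrable (fun x => g x ^ 2) π) :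
    ∫ x, f x * g x ∂π ≤ √(∫ x, f x ^ 2 ∂π) * √(∫ x, g x ^ 2 ∂π) := by
  have h := integral_mul_le_Lp_mul_Lq_of_nonneg (μ := π) (p := 2) (q := 2)
    Real.HolderConjugate.two_two (f := f) (g := g) (.of_forall hf0) (.of_forall hg0)
    (by simpa using (memLp_two_iff_integrable_sq hf).2 hf2)
    (by simpa using (memLp_two_iff_integrable_sq hg).2 hg2)
  simpa [Real.sqrt_eq_rpow] using h

end Moments

/-! ### Resampling coordinates of a product measure -/

section Resampling

variable {ι α : Type*} [DecidableEq ι]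

/-- The point `x` with its coordinates in `R` replaced by those of `x'`. -/
def mix (R : Finset ι) (x x' : ι → α) : ι → α := fun i => if i ∈ R then x' i else x i

theorem mix_empty (x x' : ι → α) : mix ∅ x x' = x := by
  funext i; simp [mix]

variable [Fintype ι] [MeasurableSpace α] (μ : ι → Measure α)

/-- The average of `f` over the coordinates in `R`. -/
def avgOver (R : Finset ι) (f : (ι → α) → ℂ) (x : ι → α) : ℂ :=
  ∫ x', f (mix R x x') ∂(Measure.pi μ)

theorem avgOver_empty [∀ i, IsProbabilityMeasure (μ i)] (f : (ι → α) → ℂ) (x : ι → α) : avgOver μ ∅ f x = f x := by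
  simp [avgOver, mix_empty]

/-- The value of `f` does not depend on the coordinates in `R`. -/
def IndepOf (R : Finset ι) (f : (ι → α) → ℂ) : Prop :=
  ∀ x y, (∀ i, i ∉ R → x i = y i) → f x = f y

theorem avgOver_union_of_indepOf {R R' : Finset ι} {f : (ι → α) → ℂ} (hf : IndepOf R' f)
    (x : ι → α) : avgOver μ (R ∪ R') f x = avgOver μ R f x := by
  unfold avgOver
  congr 1
  funext x'
  refine hf _ _ fun i hi => ?_
  by_cases h : i ∈ R <;> simp [mix, h, hi]

theorem indepOf_avgOver {R R' : Finset ι} (h : R' ⊆ R) (f : (ι → α) → ℂ) :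
    IndepOf R' (avgOver μ R f) := by
  intro x y hxy
  unfold avgOver
  congr 1
  funext x'
  congr 1
  funext i
  by_cases hi : i ∈ R
  · simp [mix, hi]
  · simp [mix, hi, hxy i (fun h' => hi (h h'))]

variable [∀ i, IsProbabilityMeasure (μ i)]

/-- Two independent copies of `x` form a product over `i` of pairs with law `μ i × μ i`. Each of
these laws is symmetric, so any set of pairs may be swapped. -/
theorem measurePreserving_swap_mix (R : Finset ι) :
    MeasurePreserving (fun q : (ι → α) × (ι → α) => (mix R q.1 q.2, mix R q.2 q.1))
      ((Measure.pi μ).prod (Measure.pi μ)) ((Measure.pi μ).prod (Measure.pi μ)) := by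
  have e := measurePreserving_arrowProdEquivProdArrow α α ι μ μ
  have hs : MeasurePreserving (fun (a : ι → α × α) i => (if i ∈ R then Prod.swap else id) (a i))
      (Measure.pi fun i => (μ i).prod (μ i)) (Measure.pi fun i => (μ i).prod (μ i)) := by
    refine measurePreserving_pi _ _ (f := fun i a => (if i ∈ R then Prod.swap else id) a)
      fun i => ?_
    by_cases hi : i ∈ R
    · simpa only [hi, if_true] using Measure.measurePreserving_swap (μ := μ i) (ν := μ i)
    · simpa only [hi, if_false] using MeasurePreserving.id _
  have := (e.comp hs).comp (e.symm _)
  convert this using 1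
  funext q
  refine Prod.ext ?_ ?_ <;>
  · funext i
    by_cases hi : i ∈ R <;>
      simp [mix, hi, MeasurableEquiv.arrowProdEquivProdArrow, Equiv.arrowProdEquivProdArrow]

theorem measurePreserving_mix (R : Finset ι) :
    MeasurePreserving (fun q : (ι → α) × (ι → α) => mix R q.1 q.2)
      ((Measure.pi μ).prod (Measure.pi μ)) (Measure.pi μ) :=
  measurePreserving_fst.comp (measurePreserving_swap_mix μ R)

theorem measurable_avgOver (R : Finset ι) {f : (ι → α) → ℂ} (hf : Measurable f) :
    Measurable (avgOver μ R f) := by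
  have h : Measurable (Function.uncurry fun x x' : ι → α => f (mix R x x')) :=
    hf.comp (measurePreserving_mix μ R).measurable
  exact (h.stronglyMeasurable.integral_prod_right).measurable

theorem norm_integral_pow_le {γ : Type*} [MeasurableSpace γ] {ρ : Measure γ}
    [IsProbabilityMeasure ρ] {f : γ → ℂ} (n : ℕ)
    (hf : Integrable f ρ) (hn : Integrable (fun x => ‖f x‖ ^ n) ρ) :
    ‖∫ x, f x ∂ρ‖ ^ n ≤ ∫ x, ‖f x‖ ^ n ∂ρ := by
  have hc : ConvexOn ℝ Set.univ (fun w : ℂ => ‖w‖ ^ n) :=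
    (convexOn_norm convex_univ).pow (fun _ _ => norm_nonneg _) n
  exact hc.map_integral_le (by fun_prop) isClosed_univ (by simp) hf hn

/-- Conditional expectations contract moments: Jensen in the resampled copy, then invariance of the
law under `mix`. -/
theorem integrable_avgOver_pow (R : Finset ι) {f : (ι → α) → ℂ}
    (hf : HasMoments (Measure.pi μ) f) (n : ℕ) :
    Integrable (fun x => ‖avgOver μ R f x‖ ^ n) (Measure.pi μ) ∧
      ∫ x, ‖avgOver μ R f x‖ ^ n ∂(Measure.pi μ) ≤ ∫ x, ‖f x‖ ^ n ∂(Measure.pi μ) := by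
  have hmp := measurePreserving_mix μ R
  have hF := hf.comp hmp
  have hn := hF.integrable_pow n
  have h1 := hF.integrable
  have hae : ∀ᵐ x ∂(Measure.pi μ), ‖avgOver μ R f x‖ ^ n ≤
      ∫ x', ‖f (mix R x x')‖ ^ n ∂(Measure.pi μ) := by
    filter_upwards [h1.prod_right_ae, hn.prod_right_ae] with x hx hx'
    exact norm_integral_pow_le n hx hx'
  have hint := hn.integral_prod_left
  have hI : Integrable (fun x => ‖avgOver μ R f x‖ ^ n) (Measure.pi μ) := by
    refine hint.mono' ((measurable_avgOver μ R hf.measurable).norm.pow_const n).aestronglyMeasurable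
      ?_
    filter_upwards [hae] with x hx
    rw [Real.norm_of_nonneg (by positivity)]
    exact hx
  refine ⟨hI, (integral_mono_ae hI hint hae).trans ?_⟩
  have hmap : AEStronglyMeasurable (fun x => ‖f x‖ ^ n)
      (Measure.map (fun q : (ι → α) × (ι → α) => mix R q.1 q.2)
        ((Measure.pi μ).prod (Measure.pi μ))) := by
    rw [hmp.map_eq]
    exact (hf.integrable_pow n).aestronglyMeasurable
  have h2 := integral_map hmp.measurable.aemeasurable hmap
  rw [hmp.map_eq] at h2
  rw [h2, integral_prod _ hn]

theorem HasMoments.avgOver (R : Finset ι) {f : (ι → α) → ℂ}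
    (hf : HasMoments (Measure.pi μ) f) : HasMoments (Measure.pi μ) (avgOver μ R f) where
  measurable := measurable_avgOver μ R hf.measurable
  integrable_pow n := (integrable_avgOver_pow μ R hf n).1

/-- The abstract form of `𝔼 [g E_{R'} h] = 𝔼 [g h]` for `g` blind to `R'`. Stating it with a union
of coordinate sets avoids composing averages. -/
theorem integral_mul_avgOver_union {R R' : Finset ι} {f g : (ι → α) → ℂ}
    (hf : HasMoments (Measure.pi μ) f) (hg : HasMoments (Measure.pi μ) g) (hgi : IndepOf R' g) :
    ∫ x, g x * avgOver μ (R ∪ R') f x ∂(Measure.pi μ) =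
      ∫ x, g x * avgOver μ R f x ∂(Measure.pi μ) := by
  have key : ∀ R₀ : Finset ι, ∫ x, g x * avgOver μ R₀ f x ∂(Measure.pi μ) =
      ∫ q : (ι → α) × (ι → α), g q.1 * f (mix R₀ q.1 q.2)
        ∂((Measure.pi μ).prod (Measure.pi μ)) := by
    intro R₀
    have hI := ((hg.comp measurePreserving_fst).mul (hf.comp (measurePreserving_mix μ R₀))
      (π := (Measure.pi μ).prod (Measure.pi μ))).integrable
    rw [integral_prod _ hI]
    simp only [avgOver, integral_const_mul]
  rw [key, key]
  -- Exchanging the coordinates in `R' \ R` between the two copies leaves `g` unchanged and turns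
  -- `mix (R ∪ R')` into `mix R`.
  have hmp := measurePreserving_swap_mix μ (R' \ R)
  have hm : Measurable fun q : (ι → α) × (ι → α) => g q.1 * f (mix (R ∪ R') q.1 q.2) :=
    (hg.measurable.comp measurable_fst).mul
      (hf.measurable.comp (measurePreserving_mix μ (R ∪ R')).measurable)
  conv_lhs => rw [← hmp.map_eq]
  rw [integral_map hmp.measurable.aemeasurable hm.aestronglyMeasurable]
  congr 1
  funext q
  congr 1
  · exact hgi _ _ fun i hi => by simp [mix, hi]
  · congr 1
    funext i
    by_cases h : i ∈ R <;> by_cases h' : i ∈ R' <;> simp [mix, h, h']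

end Resampling

/-! ### Elementary inequalities -/

theorem norm_pow_succ_sub_pow_succ_le (w w' : ℂ) {M : ℝ} (hw : ‖w‖ ≤ M) (hw' : ‖w'‖ ≤ M) (m : ℕ) :
    ‖w ^ (m + 1) - w' ^ (m + 1)‖ ≤ (m + 1) * ‖w - w'‖ * M ^ m := by
  have hM : 0 ≤ M := (norm_nonneg _).trans hw
  induction m with
  | zero => simp
  | succ m ih =>
    have e : w ^ (m + 1 + 1) - w' ^ (m + 1 + 1) =
        (w ^ (m + 1) - w' ^ (m + 1)) * w + w' ^ (m + 1) * (w - w') := by ring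
    rw [e]
    calc _ ≤ ‖w ^ (m + 1) - w' ^ (m + 1)‖ * ‖w‖ + ‖w'‖ ^ (m + 1) * ‖w - w'‖ := by
          refine (norm_add_le _ _).trans ?_
          rw [norm_mul, norm_mul, norm_pow]
      _ ≤ ((m + 1) * ‖w - w'‖ * M ^ m) * M + M ^ (m + 1) * ‖w - w'‖ := by gcongr
      _ = _ := by push_cast; ring

/-- `w ↦ w ^ s * conj w ^ (s + 1)`, so that `w * conjPow s w = ‖w‖ ^ (2 * s + 2)`. -/
def conjPow (s : ℕ) (w : ℂ) : ℂ := w ^ s * (starRingEnd ℂ) w ^ (s + 1)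

theorem mul_conjPow (s : ℕ) (w : ℂ) : w * conjPow s w = ((‖w‖ ^ (2 * s + 2) : ℝ) : ℂ) := by
  have : w * conjPow s w = (w * (starRingEnd ℂ) w) ^ (s + 1) := by
    unfold conjPow; ring
  rw [this, Complex.mul_conj, Complex.normSq_eq_norm_sq]
  push_cast
  ring

theorem norm_conjPow_sub_le (s : ℕ) (w w' : ℂ) {M : ℝ} (hw : ‖w‖ ≤ M) (hw' : ‖w'‖ ≤ M) :
    ‖conjPow s w - conjPow s w'‖ ≤ (2 * s + 1) * ‖w - w'‖ * M ^ (2 * s) := by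
  have hM : 0 ≤ M := (norm_nonneg _).trans hw
  have hc : ‖(starRingEnd ℂ) w ^ (s + 1) - (starRingEnd ℂ) w' ^ (s + 1)‖
      ≤ (s + 1) * ‖w - w'‖ * M ^ s := by
    have := norm_pow_succ_sub_pow_succ_le w w' hw hw' s
    rwa [← map_pow, ← map_pow, ← map_sub, RCLike.norm_conj]
  have e : conjPow s w - conjPow s w' = (w ^ s - w' ^ s) * (starRingEnd ℂ) w ^ (s + 1) +
      w' ^ s * ((starRingEnd ℂ) w ^ (s + 1) - (starRingEnd ℂ) w' ^ (s + 1)) := by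
    unfold conjPow; ring
  have h1 : ‖w ^ s - w' ^ s‖ * M ^ (s + 1) ≤ s * ‖w - w'‖ * M ^ (2 * s) := by
    cases s with
    | zero => simp
    | succ m =>
      calc _ ≤ ((m + 1) * ‖w - w'‖ * M ^ m) * M ^ (m + 1 + 1) := by
            gcongr; exact norm_pow_succ_sub_pow_succ_le w w' hw hw' m
        _ = _ := by push_cast; ring
  rw [e]
  calc _ ≤ ‖w ^ s - w' ^ s‖ * ‖w‖ ^ (s + 1) + ‖w'‖ ^ s *
        ‖(starRingEnd ℂ) w ^ (s + 1) - (starRingEnd ℂ) w' ^ (s + 1)‖ := by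
        refine (norm_add_le _ _).trans ?_
        rw [norm_mul, norm_mul, norm_pow, norm_pow, RCLike.norm_conj]
    _ ≤ ‖w ^ s - w' ^ s‖ * M ^ (s + 1) + M ^ s * ((s + 1) * ‖w - w'‖ * M ^ s) := by gcongr
    _ ≤ s * ‖w - w'‖ * M ^ (2 * s) + M ^ s * ((s + 1) * ‖w - w'‖ * M ^ s) := by gcongr
    _ = _ := by ring

/-- Here `q`, `d`, `z` stand for `|q_a|`, `|d_a|`, `|Z|`. The coefficient `1/2` lets the term in
`|Z|^p` be absorbed into the left side of the moment estimate; what remains carries `q` only through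
the product `q d`, which is where the square root of the gain comes from. -/
theorem mul_add_pow_le_half_pow_add (s : ℕ) {q d z : ℝ} (hq : 0 ≤ q) (hd : 0 ≤ d) (hz : 0 ≤ z) :
    q * ((2 * s + 1) * d * (z + d) ^ (2 * s)) ≤ 1 / 2 * z ^ (2 * s + 2) +
      (6 * (2 * s + 2)) ^ (2 * s + 2) * ((q * d) ^ (s + 1) + d ^ (2 * s + 2)) := by
  set p : ℝ := 2 * s + 2 with hp
  have hs0 : (0 : ℝ) ≤ s := Nat.cast_nonneg s
  have hp2 : 2 ≤ p := by linarith
  have hp0 : 0 < p := by linarith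
  have h6 : 1 ≤ 6 * p := by linarith
  have hqd : 0 ≤ q * d := mul_nonneg hq hd
  rcases le_or_gt (p * d) z with h | h
  · have h1 : (z + d) ^ (2 * s) ≤ z ^ (2 * s) * 3 := by
      have : z + d ≤ z * (1 + 1 / p) := by
        have : d ≤ z / p := by rw [le_div_iff₀ hp0]; linarith
        calc z + d ≤ z + z / p := by linarith
          _ = _ := by ring
      calc (z + d) ^ (2 * s) ≤ (z * (1 + 1 / p)) ^ (2 * s) := by gcongr
        _ = z ^ (2 * s) * (1 + 1 / p) ^ (2 * s) := mul_pow _ _ _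
        _ ≤ z ^ (2 * s) * 3 := by
          gcongr
          have h2 : 1 + 1 / p ≤ Real.exp (1 / p) := by
            have := Real.add_one_le_exp (1 / p); linarith
          calc (1 + 1 / p) ^ (2 * s) ≤ Real.exp (1 / p) ^ (2 * s) := by gcongr
            _ = Real.exp ((2 * s : ℕ) * (1 / p)) := (Real.exp_nat_mul _ _).symm
            _ ≤ Real.exp 1 := by
              apply Real.exp_le_exp.2
              rw [mul_one_div, div_le_one hp0]
              push_cast; linarith
            _ ≤ 3 := by have := Real.exp_one_lt_d9; linarith
    have h3 : q * ((2 * s + 1) * d * (z + d) ^ (2 * s)) ≤ 3 * p * (q * d) * z ^ (2 * s) := by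
      calc q * ((2 * s + 1) * d * (z + d) ^ (2 * s))
          ≤ q * (p * d * (z ^ (2 * s) * 3)) := by gcongr; linarith
        _ = _ := by ring
    refine h3.trans ?_
    -- For `z ≥ p d` the shift by `d` costs only a factor `(1+1/p)^{2s} ≤ 3`, leaving `3p (qd)
    -- z^{p-2}`. It is absorbed if `6p qd ≤ z²`, and otherwise `z` itself is bounded by `√(6p qd)`.
    rcases le_or_gt (6 * p * (q * d)) (z ^ 2) with h4 | h4
    · calc 3 * p * (q * d) * z ^ (2 * s) = 1 / 2 * (6 * p * (q * d)) * z ^ (2 * s) := by ring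
        _ ≤ 1 / 2 * z ^ 2 * z ^ (2 * s) := by gcongr
        _ = 1 / 2 * z ^ (2 * s + 2) := by ring
        _ ≤ _ := le_add_of_nonneg_right (by positivity)
    · calc 3 * p * (q * d) * z ^ (2 * s) ≤ 6 * p * (q * d) * (6 * p * (q * d)) ^ s := by
            rw [pow_mul]; gcongr; linarith
        _ = (6 * p) ^ (s + 1) * (q * d) ^ (s + 1) := by rw [← mul_pow]; ring
        _ ≤ (6 * p) ^ (2 * s + 2) * ((q * d) ^ (s + 1) + d ^ (2 * s + 2)) := by
            gcongr ?_ * ?_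
            · exact pow_le_pow_right₀ h6 (by omega)
            · exact le_add_of_nonneg_right (by positivity)
        _ ≤ _ := le_add_of_nonneg_left (by positivity)
  -- Now `z < p d`, so everything is controlled by `q d^{p-1}`, and comparing `q` with `d` decides
  -- which of the two remaining terms dominates.
  · have h1 : (2 * s + 1) * (z + d) ^ (2 * s) ≤ (6 * p) ^ (2 * s + 2) * d ^ (2 * s) := by
      calc (2 * s + 1) * (z + d) ^ (2 * s) ≤ (6 * p) ^ 2 * (6 * p * d) ^ (2 * s) := by
            gcongr
            · nlinarith
            · nlinarith
        _ = _ := by rw [mul_pow (6 * p) d]; ring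
    have h2 : q * d * d ^ (2 * s) ≤ (q * d) ^ (s + 1) + d ^ (2 * s + 2) := by
      rcases le_total q d with h3 | h3
      · calc q * d * d ^ (2 * s) ≤ d * d * d ^ (2 * s) := by gcongr
          _ = d ^ (2 * s + 2) := by ring
          _ ≤ _ := le_add_of_nonneg_left (by positivity)
      · calc q * d * d ^ (2 * s) ≤ q * d * (q * d) ^ s := by
              rw [pow_mul]; gcongr; nlinarith
          _ = (q * d) ^ (s + 1) := by ring
          _ ≤ _ := le_add_of_nonneg_right (by positivity)
    calc q * ((2 * s + 1) * d * (z + d) ^ (2 * s))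
        = q * d * ((2 * s + 1) * (z + d) ^ (2 * s)) := by ring
      _ ≤ q * d * ((6 * p) ^ (2 * s + 2) * d ^ (2 * s)) := by gcongr
      _ = (6 * p) ^ (2 * s + 2) * (q * d * d ^ (2 * s)) := by ring
      _ ≤ (6 * p) ^ (2 * s + 2) * ((q * d) ^ (s + 1) + d ^ (2 * s + 2)) := by gcongr
      _ ≤ _ := le_add_of_nonneg_left (by positivity)

/-! ### Iterated fluctuations -/

section Fluct

variable {ι α β : Type*} [DecidableEq ι] [DecidableEq β] [Fintype ι] [MeasurableSpace α]
  (μ : ι → Measure α) (R : β → Finset ι)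

/-- The fluctuation `∏_{b ∈ S} (1 - E_b) f`, where `E_b` averages over the coordinates in `R b`. -/
def fluctOver (S : Finset β) (f : (ι → α) → ℂ) (x : ι → α) : ℂ :=
  ∑ V ∈ S.powerset, (-1) ^ V.card * avgOver μ (V.biUnion R) f x

/-- Splits the inclusion–exclusion sum according to whether the subset contains `a`. The products of
averages enter as averages over unions, which is correct even though two rows share an entry. -/
theorem fluctOver_insert {S : Finset β} {a : β} (ha : a ∉ S) (f : (ι → α) → ℂ) (x : ι → α) :
    fluctOver μ R (insert a S) f x = fluctOver μ R S f x -
      ∑ V ∈ S.powerset, (-1) ^ V.card * avgOver μ (V.biUnion R ∪ R a) f x := by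
  unfold fluctOver
  rw [Finset.sum_powerset_insert ha, sub_eq_add_neg, ← Finset.sum_neg_distrib]
  congr 1
  refine Finset.sum_congr rfl fun V hV => ?_
  have hav : a ∉ V := fun h => ha (Finset.mem_powerset.1 hV h)
  rw [Finset.card_insert_of_notMem hav, Finset.biUnion_insert, Finset.union_comm, pow_succ]
  ring

theorem fluctOver_of_indepOf {S : Finset β} {b : β} (hb : b ∈ S) {f : (ι → α) → ℂ}
    (hf : IndepOf (R b) f) (x : ι → α) : fluctOver μ R S f x = 0 := by
  rw [← Finset.insert_erase hb, fluctOver_insert μ R (Finset.notMem_erase b S)]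
  simp only [avgOver_union_of_indepOf μ hf]
  exact sub_self _

variable [∀ i, IsProbabilityMeasure (μ i)]

theorem fluctOver_singleton (a : β) (f : (ι → α) → ℂ) (x : ι → α) :
    fluctOver μ R {a} f x = f x - avgOver μ (R a) f x := by
  rw [← insert_empty_eq, fluctOver_insert μ R (Finset.notMem_empty a)]
  simp [fluctOver, avgOver_empty]

omit [DecidableEq β] in
theorem HasMoments.fluctOver (S : Finset β) {f : (ι → α) → ℂ}
    (hf : HasMoments (Measure.pi μ) f) : HasMoments (Measure.pi μ) (fluctOver μ R S f) :=
  HasMoments.sum _ fun V _ => (hf.avgOver μ (V.biUnion R)).const_mul _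

/-- The orthogonality behind the recursion: against a function blind to row `b`, the average `E_b`
integrates like the identity, so the factor `1 - E_b` cancels. -/
theorem integral_mul_fluctOver {S : Finset β} {b : β} (hb : b ∈ S) {f g : (ι → α) → ℂ}
    (hf : HasMoments (Measure.pi μ) f) (hg : HasMoments (Measure.pi μ) g)
    (hgi : IndepOf (R b) g) :
    ∫ x, g x * fluctOver μ R S f x ∂(Measure.pi μ) = 0 := by
  have hI : ∀ R' : Finset ι, ∀ n : ℕ, Integrable
      (fun x => g x * ((-1) ^ n * avgOver μ R' f x)) (Measure.pi μ) := fun R' n =>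
    (hg.mul ((hf.avgOver μ R').const_mul _)).integrable
  rw [← Finset.insert_erase hb]
  simp only [fluctOver_insert μ R (Finset.notMem_erase b S)]
  simp only [fluctOver, mul_sub, Finset.mul_sum]
  rw [integral_sub (integrable_finsetSum _ fun V _ => hI _ _)
    (integrable_finsetSum _ fun V _ => hI _ _), integral_finsetSum _ fun V _ => hI _ _,
    integral_finsetSum _ fun V _ => hI _ _, sub_eq_zero]
  refine Finset.sum_congr rfl fun V _ => ?_
  have := integral_mul_avgOver_union μ (R := V.biUnion R) hf hg hgi
  simp only [mul_left_comm (g _), integral_const_mul]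
  rw [this]

theorem norm_sum_pow_le {γ : Type*} (s : Finset γ) (f : γ → ℂ) {n : ℕ} (hn : n ≠ 0) :
    ‖∑ i ∈ s, f i‖ ^ n ≤ (s.card : ℝ) ^ (n - 1) * ∑ i ∈ s, ‖f i‖ ^ n := by
  obtain ⟨m, rfl⟩ := Nat.exists_eq_succ_of_ne_zero hn
  rcases s.eq_empty_or_nonempty with rfl | hs
  · simp
  have h1 := pow_sum_div_card_le_sum_pow (s := s) (f := fun i => ‖f i‖)
    (fun i _ => norm_nonneg _) m
  have hc : (0 : ℝ) < (s.card : ℝ) ^ m := pow_pos (by exact_mod_cast hs.card_pos) m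
  rw [div_le_iff₀ hc] at h1
  calc _ ≤ (∑ i ∈ s, ‖f i‖) ^ (m + 1) := by gcongr; exact norm_sum_le _ _
    _ ≤ _ := by simpa [mul_comm] using h1

-- A sum of `2^|S|` averages, each of which contracts moments.
omit [DecidableEq β] in
theorem integral_norm_fluctOver_pow_le (S : Finset β) {f : (ι → α) → ℂ}
    (hf : HasMoments (Measure.pi μ) f) {n : ℕ} (hn : n ≠ 0) :
    ∫ x, ‖fluctOver μ R S f x‖ ^ n ∂(Measure.pi μ) ≤
      (2 ^ S.card) ^ n * ∫ x, ‖f x‖ ^ n ∂(Measure.pi μ) := by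
  have hc : (S.powerset.card : ℝ) = 2 ^ S.card := by simp [Finset.card_powerset]
  have hI : ∀ V ∈ S.powerset,
      Integrable (fun x => ‖avgOver μ (V.biUnion R) f x‖ ^ n) (Measure.pi μ) := fun V _ =>
    (integrable_avgOver_pow μ _ hf n).1
  calc ∫ x, ‖fluctOver μ R S f x‖ ^ n ∂(Measure.pi μ)
      ≤ ∫ x, (2 ^ S.card) ^ (n - 1) * ∑ V ∈ S.powerset,
          ‖avgOver μ (V.biUnion R) f x‖ ^ n ∂(Measure.pi μ) := by
        refine integral_mono ((hf.fluctOver μ R S).integrable_pow n)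
          ((integrable_finsetSum _ hI).const_mul _) fun x => ?_
        have := norm_sum_pow_le S.powerset
          (fun V => (-1) ^ V.card * avgOver μ (V.biUnion R) f x) hn
        rw [hc] at this
        simpa [fluctOver] using this
    _ = (2 ^ S.card) ^ (n - 1) * ∑ V ∈ S.powerset,
          ∫ x, ‖avgOver μ (V.biUnion R) f x‖ ^ n ∂(Measure.pi μ) := by
        rw [integral_const_mul, integral_finsetSum _ hI]
    _ ≤ (2 ^ S.card) ^ (n - 1) * ∑ V ∈ S.powerset, ∫ x, ‖f x‖ ^ n ∂(Measure.pi μ) := by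
        refine mul_le_mul_of_nonneg_left (Finset.sum_le_sum fun V _ => ?_) (by positivity)
        exact (integrable_avgOver_pow μ _ hf n).2
    _ = _ := by
        rw [Finset.sum_const, nsmul_eq_mul, hc, ← mul_assoc, pow_sub_one_mul hn]

/-- Only almost everywhere, since integrability of the slices of `h i` is known only for almost
every `x`. -/
theorem avgOver_sum_ae {γ : Type*} (s : Finset γ) (R' : Finset ι) (c : γ → ℂ)
    {h : γ → (ι → α) → ℂ} (hh : ∀ i ∈ s, HasMoments (Measure.pi μ) (h i)) :
    ∀ᵐ x ∂(Measure.pi μ), avgOver μ R' (fun y => ∑ i ∈ s, c i * h i y) x =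
      ∑ i ∈ s, c i * avgOver μ R' (h i) x := by
  have : ∀ i ∈ s, ∀ᵐ x ∂(Measure.pi μ),
      Integrable (fun x' => h i (mix R' x x')) (Measure.pi μ) := fun i hi =>
    ((hh i hi).comp (measurePreserving_mix μ R')).integrable.prod_right_ae
  filter_upwards [(Finset.eventually_all s).2 this] with x hx
  simp only [avgOver]
  rw [integral_finsetSum _ fun i hi => (hx i hi).const_mul _]
  simp only [integral_const_mul]

/-- Subtracting from `f` functions that do not see some of the rows in `S` leaves the fluctuation
over `S` unchanged. -/
theorem fluctOver_ae_eq_fluctOver_alternating {S S' : Finset β} (hS : S ⊆ S')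
    {h : Finset β → (ι → α) → ℂ} (hh : ∀ T ∈ S.powerset, HasMoments (Measure.pi μ) (h T))
    (hi : ∀ T ∈ S.powerset, ∀ b ∈ T, IndepOf (R b) (h T)) :
    ∀ᵐ x ∂(Measure.pi μ), fluctOver μ R S' (h ∅) x =
      fluctOver μ R S' (fun y => ∑ T ∈ S.powerset, (-1) ^ T.card * h T y) x := by
  have : ∀ V ∈ S'.powerset, ∀ᵐ x ∂(Measure.pi μ),
      avgOver μ (V.biUnion R) (fun y => ∑ T ∈ S.powerset, (-1) ^ T.card * h T y) x =
        ∑ T ∈ S.powerset, (-1) ^ T.card * avgOver μ (V.biUnion R) (h T) x := fun V _ =>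
    avgOver_sum_ae μ _ _ _ hh
  filter_upwards [(Finset.eventually_all _).2 this] with x hx
  have e : fluctOver μ R S' (fun y => ∑ T ∈ S.powerset, (-1) ^ T.card * h T y) x =
      ∑ T ∈ S.powerset, (-1) ^ T.card * fluctOver μ R S' (h T) x := by
    simp only [fluctOver, Finset.mul_sum]
    rw [Finset.sum_comm]
    refine Finset.sum_congr rfl fun V hV => ?_
    rw [hx V hV, Finset.mul_sum]
    exact Finset.sum_congr rfl fun T _ => by ring
  rw [e, Finset.sum_eq_single ∅]
  · simp
  · intro T hT hne
    obtain ⟨b, hb⟩ := Finset.nonempty_iff_ne_empty.2 hne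
    rw [fluctOver_of_indepOf μ R (hS (Finset.mem_powerset.1 hT hb)) (hi T hT b hb), mul_zero]
  · simp

end Fluct

/-! ### The moment recursion -/

section Recursion

variable {ι α β : Type*} [DecidableEq ι] [DecidableEq β] [Fintype ι] [MeasurableSpace α]
  (μ : ι → Measure α) (R : β → Finset ι)

/-- The average over `a ∈ A \ S` of the fluctuations of `f a` over the rows `a` and `S`. -/
def fluctMean (A : Finset β) (w : ℝ) (f : β → (ι → α) → ℂ) (S : Finset β) (x : ι → α) : ℂ :=
  (w : ℂ) * ∑ a ∈ A \ S, fluctOver μ R (insert a S) (f a) x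

/-- The part of `fluctMean` that depends on the row `a`. -/
def fluctMeanDiff (A : Finset β) (w : ℝ) (f : β → (ι → α) → ℂ) (S : Finset β) (a : β)
    (x : ι → α) : ℂ :=
  fluctMean μ R A w f (insert a S) x + (w : ℂ) * fluctOver μ R (insert a S) (f a) x

/-- The `a`-th summand cancels, and for every other `b` one is left with `Q_b Q_S f_b - Q_a Q_b Q_S
f_b = E_a Q_b Q_S f_b`, an average over row `a`. -/
theorem indepOf_fluctMean_sub {A S : Finset β} {w : ℝ} {f : β → (ι → α) → ℂ} {a : β}
    (ha : a ∈ A \ S) :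
    IndepOf (R a) fun x => fluctMean μ R A w f S x - fluctMeanDiff μ R A w f S a x := by
  have e : ∀ x, fluctMean μ R A w f S x - fluctMeanDiff μ R A w f S a x =
      (w : ℂ) * ∑ b ∈ (A \ S).erase a, ∑ V ∈ (insert b S).powerset,
        (-1) ^ V.card * avgOver μ (V.biUnion R ∪ R a) (f b) x := by
    intro x
    have hs : A \ insert a S = (A \ S).erase a := by
      ext b; simp only [Finset.mem_sdiff, Finset.mem_insert, Finset.mem_erase]; tauto
    unfold fluctMeanDiff fluctMean
    rw [← Finset.add_sum_erase _ _ ha, hs]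
    have : ∀ b ∈ (A \ S).erase a, fluctOver μ R (insert b (insert a S)) (f b) x =
        fluctOver μ R (insert b S) (f b) x - ∑ V ∈ (insert b S).powerset,
        (-1) ^ V.card * avgOver μ (V.biUnion R ∪ R a) (f b) x := by
      intro b hb
      rw [Finset.insert_comm]
      refine fluctOver_insert μ R (fun h => ?_) (f b) x
      simp only [Finset.mem_insert, Finset.mem_sdiff, Finset.mem_erase] at h hb ha
      rcases h with h | h
      · exact hb.1 h.symm
      · exact ha.2 h
    rw [Finset.sum_congr rfl this, Finset.sum_sub_distrib]
    ring
  intro x y hxy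
  show fluctMean μ R A w f S x - fluctMeanDiff μ R A w f S a x =
    fluctMean μ R A w f S y - fluctMeanDiff μ R A w f S a y
  rw [e, e]
  congr 1
  refine Finset.sum_congr rfl fun b _ => Finset.sum_congr rfl fun V _ => ?_
  rw [indepOf_avgOver μ Finset.subset_union_right (f b) x y hxy]

variable [∀ i, IsProbabilityMeasure (μ i)]

theorem HasMoments.fluctMean {A : Finset β} {w : ℝ} {f : β → (ι → α) → ℂ}
    (hf : ∀ a ∈ A, HasMoments (Measure.pi μ) (f a)) (S : Finset β) :
    HasMoments (Measure.pi μ) (fluctMean μ R A w f S) :=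
  (HasMoments.sum _ fun a ha => (hf a (Finset.sdiff_subset ha)).fluctOver μ R _).const_mul _

theorem HasMoments.fluctMeanDiff {A : Finset β} {w : ℝ} {f : β → (ι → α) → ℂ}
    (hf : ∀ a ∈ A, HasMoments (Measure.pi μ) (f a)) (S : Finset β) {a : β} (ha : a ∈ A) :
    HasMoments (Measure.pi μ) (fluctMeanDiff μ R A w f S a) :=
  (HasMoments.fluctMean μ R hf _).add (((hf a ha).fluctOver μ R _).const_mul _)

theorem HasMoments.conjPow {γ : Type*} [MeasurableSpace γ] {π : Measure γ} [IsFiniteMeasure π]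
    {f : γ → ℂ} (hf : HasMoments π f) (s : ℕ) : HasMoments π (fun x => conjPow s (f x)) :=
  (hf.pow s).mul (hf.conj.pow (s + 1))

/-- One step of the recursion: the fluctuation average over `S` is controlled by the individual
fluctuations and by the part of it that depends on a further row. -/
theorem integral_norm_fluctMean_pow_le {A S : Finset β} {w : ℝ} {f : β → (ι → α) → ℂ}
    (hf : ∀ a ∈ A, HasMoments (Measure.pi μ) (f a)) (hw : 0 ≤ w) (hwA : w * A.card ≤ 1) (s : ℕ)
    {B D : ℝ} (hB : 0 ≤ B) (hD : 0 ≤ D)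
    (hfB : ∀ a ∈ A \ S,
      ∫ x, ‖fluctOver μ R (insert a S) (f a) x‖ ^ (2 * s + 2) ∂(Measure.pi μ) ≤ B)
    (hfD : ∀ a ∈ A \ S,
      ∫ x, ‖fluctMeanDiff μ R A w f S a x‖ ^ (2 * s + 2) ∂(Measure.pi μ) ≤ D) :
    ∫ x, ‖fluctMean μ R A w f S x‖ ^ (2 * s + 2) ∂(Measure.pi μ) ≤
      2 * (6 * (2 * s + 2)) ^ (2 * s + 2) * (√(B * D) + D) := by
  set π := Measure.pi μ
  set Z := fluctMean μ R A w f S with hZ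
  have hZm : HasMoments π Z := HasMoments.fluctMean μ R hf S
  set q : β → (ι → α) → ℂ := fun a => fluctOver μ R (insert a S) (f a) with hq
  have hqm : ∀ a ∈ A \ S, HasMoments π (q a) := fun a ha =>
    (hf a (Finset.sdiff_subset ha)).fluctOver μ R _
  set d : β → (ι → α) → ℂ := fun a => fluctMeanDiff μ R A w f S a with hd
  have hdm : ∀ a ∈ A \ S, HasMoments π (d a) := fun a ha =>
    HasMoments.fluctMeanDiff μ R hf S (Finset.sdiff_subset ha)
  set I := ∫ x, ‖Z x‖ ^ (2 * s + 2) ∂π with hI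
  set κ : ℝ := (6 * (2 * s + 2)) ^ (2 * s + 2) with hκ
  have hI0 : 0 ≤ I := integral_nonneg fun x => by positivity
  have hκ0 : 0 ≤ κ := by positivity
  have term : ∀ a ∈ A \ S, ‖∫ x, q a x * conjPow s (Z x) ∂π‖ ≤
      1 / 2 * I + κ * (√(B * D) + D) := by
    intro a ha
    have hqa := hqm a ha
    have hda := hdm a ha
    have hZ' : HasMoments π (fun x => conjPow s (Z x - d a x)) := (hZm.sub hda).conjPow s
    -- `Z - d_a` is blind to row `a`, so it is orthogonal to `q_a` in any nonlinear function;
    -- `conjPow s (Z - d_a)` may be subtracted for free.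
    have h0 : ∫ x, conjPow s (Z x - d a x) * q a x ∂π = 0 := by
      refine integral_mul_fluctOver μ R (Finset.mem_insert_self a S)
        (hf a (Finset.sdiff_subset ha)) hZ' fun x y hxy => ?_
      show conjPow s (Z x - d a x) = conjPow s (Z y - d a y)
      exact congrArg (conjPow s) (indepOf_fluctMean_sub μ R ha x y hxy)
    have h1 : ∫ x, q a x * conjPow s (Z x) ∂π =
        ∫ x, q a x * (conjPow s (Z x) - conjPow s (Z x - d a x)) ∂π := by
      simp only [mul_sub]
      rw [integral_sub (hqa.mul (hZm.conjPow s)).integrable (hqa.mul hZ').integrable]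
      simp only [mul_comm (q a _) (conjPow s (Z _ - d a _))]
      rw [h0, sub_zero]
    have i1 := hZm.integrable_pow (2 * s + 2)
    have i2 : Integrable (fun x => ‖q a x‖ ^ (s + 1) * ‖d a x‖ ^ (s + 1)) π :=
      hqa.integrable_norm_mul_pow hda _ _
    have i3 := hda.integrable_pow (2 * s + 2)
    have h2 : ∫ x, ‖q a x‖ ^ (s + 1) * ‖d a x‖ ^ (s + 1) ∂π ≤ √(B * D) := by
      have := integral_mul_le_sqrt_mul_sqrt (π := π) (f := fun x => ‖q a x‖ ^ (s + 1))
        (g := fun x => ‖d a x‖ ^ (s + 1)) (fun x => by positivity) (fun x => by positivity)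
        (hqa.integrable_pow _).aestronglyMeasurable (hda.integrable_pow _).aestronglyMeasurable
        (by simp only [← pow_mul]; exact hqa.integrable_pow _)
        (by simp only [← pow_mul]; exact hda.integrable_pow _)
      simp only [← pow_mul, show (s + 1) * 2 = 2 * s + 2 by ring] at this
      refine this.trans ?_
      rw [Real.sqrt_mul hB]
      gcongr
      · exact hfB a ha
      · exact hfD a ha
    rw [h1]
    calc _ ≤ ∫ x, (1 / 2 * ‖Z x‖ ^ (2 * s + 2) + κ * (‖q a x‖ ^ (s + 1) * ‖d a x‖ ^ (s + 1) +
            ‖d a x‖ ^ (2 * s + 2))) ∂π := by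
          refine norm_integral_le_of_norm_le ((i1.const_mul _).add ((i2.add i3).const_mul _))
            (.of_forall fun x => ?_)
          rw [norm_mul, ← mul_pow]
          refine le_trans ?_ (mul_add_pow_le_half_pow_add s (norm_nonneg (q a x))
            (norm_nonneg (d a x)) (norm_nonneg (Z x)))
          gcongr
          have := norm_conjPow_sub_le s (Z x) (Z x - d a x) (M := ‖Z x‖ + ‖d a x‖)
            (by linarith [norm_nonneg (d a x)]) (norm_sub_le _ _)
          simpa using this
      _ = 1 / 2 * I + κ * ((∫ x, ‖q a x‖ ^ (s + 1) * ‖d a x‖ ^ (s + 1) ∂π) +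
            ∫ x, ‖d a x‖ ^ (2 * s + 2) ∂π) := by
          have i23 := (i2.add i3).const_mul κ
          simp only [Pi.add_apply] at i23
          rw [integral_add (i1.const_mul _) i23, integral_const_mul,
            integral_const_mul, integral_add i2 i3]
      _ ≤ _ := by gcongr; exact hfD a ha
  -- Averaging the termwise bounds with total weight `w * A.card ≤ 1` puts `I` on both sides with
  -- coefficient `1/2` on the right.
  have hmain : I ≤ 1 / 2 * I + κ * (√(B * D) + D) := by
    have e : ((I : ℝ) : ℂ) = (w : ℂ) * ∑ a ∈ A \ S, ∫ x, q a x * conjPow s (Z x) ∂π := by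
      rw [hI, ← integral_complex_ofReal, ← integral_finsetSum _
        fun a ha => ((hqm a ha).mul (hZm.conjPow s)).integrable, ← integral_const_mul]
      congr 1
      funext x
      rw [← Finset.sum_mul, ← mul_assoc]
      exact (mul_conjPow s (Z x)).symm
    have e' : I = w * ‖∑ a ∈ A \ S, ∫ x, q a x * conjPow s (Z x) ∂π‖ := by
      rw [← Real.norm_of_nonneg hI0, ← Complex.norm_real, e, norm_mul, Complex.norm_real,
        Real.norm_of_nonneg hw]
    have hT0 : 0 ≤ 1 / 2 * I + κ * (√(B * D) + D) := by positivity
    calc I = w * ‖∑ a ∈ A \ S, ∫ x, q a x * conjPow s (Z x) ∂π‖ := e'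
      _ ≤ w * ((A \ S).card * (1 / 2 * I + κ * (√(B * D) + D))) := by
          gcongr
          refine (norm_sum_le _ _).trans ((Finset.sum_le_sum term).trans ?_)
          rw [Finset.sum_const, nsmul_eq_mul]
      _ ≤ w * (A.card * (1 / 2 * I + κ * (√(B * D) + D))) := by
          gcongr; exact Finset.sdiff_subset
      _ = (w * A.card) * (1 / 2 * I + κ * (√(B * D) + D)) := by ring
      _ ≤ 1 * (1 / 2 * I + κ * (√(B * D) + D)) := by gcongr
      _ = _ := one_mul _
  linarith

/-- The average is bounded by the largest of the individual moments. -/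
theorem integral_norm_fluctMean_pow_le_of_forall {A S : Finset β} {w : ℝ}
    {f : β → (ι → α) → ℂ} (hf : ∀ a ∈ A, HasMoments (Measure.pi μ) (f a)) (hw : 0 ≤ w)
    (hwA : w * A.card ≤ 1) {n : ℕ} (hn : n ≠ 0) {B : ℝ} (hB : 0 ≤ B)
    (hfB : ∀ a ∈ A \ S,
      ∫ x, ‖fluctOver μ R (insert a S) (f a) x‖ ^ n ∂(Measure.pi μ) ≤ B) :
    ∫ x, ‖fluctMean μ R A w f S x‖ ^ n ∂(Measure.pi μ) ≤ B := by
  have hqm : ∀ a ∈ A \ S, HasMoments (Measure.pi μ) (fluctOver μ R (insert a S) (f a)) :=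
    fun a ha => (hf a (Finset.sdiff_subset ha)).fluctOver μ R _
  calc ∫ x, ‖fluctMean μ R A w f S x‖ ^ n ∂(Measure.pi μ)
      ≤ ∫ x, w ^ n * (((A \ S).card : ℝ) ^ (n - 1) *
          ∑ a ∈ A \ S, ‖fluctOver μ R (insert a S) (f a) x‖ ^ n) ∂(Measure.pi μ) := by
        refine integral_mono ((HasMoments.fluctMean μ R hf S).integrable_pow n)
          (((integrable_finsetSum _ fun a ha => (hqm a ha).integrable_pow n).const_mul _).const_mul
            _) fun x => ?_
        simp only [fluctMean, norm_mul, Complex.norm_real, Real.norm_of_nonneg hw, mul_pow]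
        gcongr
        exact norm_sum_pow_le _ _ hn
    _ = w ^ n * (((A \ S).card : ℝ) ^ (n - 1) *
          ∑ a ∈ A \ S, ∫ x, ‖fluctOver μ R (insert a S) (f a) x‖ ^ n ∂(Measure.pi μ)) := by
        rw [integral_const_mul, integral_const_mul,
          integral_finsetSum _ fun a ha => (hqm a ha).integrable_pow n]
    _ ≤ w ^ n * (((A \ S).card : ℝ) ^ (n - 1) * ((A \ S).card * B)) := by
        gcongr
        refine (Finset.sum_le_sum hfB).trans ?_
        simp
    _ = (w * (A \ S).card) ^ n * B := by
        rw [← mul_assoc (((A \ S).card : ℝ) ^ (n - 1)), pow_sub_one_mul hn, mul_pow]; ring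
    _ ≤ 1 ^ n * B := by
        gcongr
        refine le_trans ?_ hwA
        gcongr
        exact Finset.sdiff_subset
    _ = B := by simp

/-- The exponents gained by the recursion: `gain y j = y ^ (1 - 2 ^ (-j))`. -/
def gain (y : ℝ) : ℕ → ℝ
  | 0 => 1
  | j + 1 => √(y * gain y j)

theorem gain_pos {y : ℝ} (hy : 0 < y) (j : ℕ) : 0 < gain y j := by
  induction j with
  | zero => exact one_pos
  | succ j ih => exact Real.sqrt_pos.2 (mul_pos hy ih)

/-- The lower bound lets the diagonal term `w q_a`, of relative size at most `y²`, be bounded by `y`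
times the current gain. -/
theorem le_gain {y : ℝ} (hy : 0 < y) (hy1 : y ≤ 1) (j : ℕ) : y ≤ gain y j ∧ gain y j ≤ 1 := by
  induction j with
  | zero => exact ⟨hy1, le_rfl⟩
  | succ j ih =>
    constructor
    · apply Real.le_sqrt_of_sq_le
      nlinarith [ih.1]
    · rw [gain, Real.sqrt_le_one]
      nlinarith [ih.1, ih.2]

theorem gain_eq {y : ℝ} (hy : 0 < y) (j : ℕ) : gain y j = y * y⁻¹ ^ ((1 / 2 : ℝ) ^ j) := by
  induction j with
  | zero => simp [gain, hy.ne']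
  | succ j ih =>
    have hyi : 0 < y⁻¹ := inv_pos.2 hy
    rw [gain, ih, ← mul_assoc, Real.sqrt_mul (mul_self_nonneg y), Real.sqrt_mul_self hy.le,
      Real.sqrt_eq_rpow, ← Real.rpow_mul hyi.le, pow_succ]

/-- **Fluctuation averaging.** If the iterated fluctuations of `f a` over `k` further rows gain a
factor `y ^ k`, the average of the fluctuations gains almost a factor `y`. -/
theorem integral_norm_fluctMean_pow_le_gain {A : Finset β} {w : ℝ} {f : β → (ι → α) → ℂ}
    (hf : ∀ a ∈ A, HasMoments (Measure.pi μ) (f a)) (hw : 0 ≤ w) (hwA : w * A.card ≤ 1) (s n : ℕ)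
    {X y : ℝ} (hX : 0 < X) (hy : 0 < y) (hy1 : y ≤ 1) (hwy : w ≤ y ^ 2)
    (hsy : 48 * (2 * s + 2) * √y ≤ 1)
    (hfX : ∀ S ⊆ A, S.card ≤ n → ∀ a ∈ A \ S,
      ∫ x, ‖fluctOver μ R (insert a S) (f a) x‖ ^ (2 * s + 2) ∂(Measure.pi μ) ≤
        (X * y ^ S.card) ^ (2 * s + 2)) :
    ∀ j, j ≤ n → ∀ S ⊆ A, S.card + j = n →
      ∫ x, ‖fluctMean μ R A w f S x‖ ^ (2 * s + 2) ∂(Measure.pi μ) ≤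
        ((24 * (2 * s + 2)) ^ 2 * X * y ^ S.card * gain y j) ^ (2 * s + 2) := by
  intro j
  set P : ℕ := 2 * s + 2 with hP
  set p : ℝ := 2 * s + 2 with hp
  have hp2 : 2 ≤ p := by have : (0 : ℝ) ≤ s := Nat.cast_nonneg s; linarith
  have hP0 : P ≠ 0 := by omega
  have hM1 : 1 ≤ (24 * p) ^ 2 := by nlinarith
  induction j with
  | zero =>
    intro _ S hS hSn
    refine (integral_norm_fluctMean_pow_le_of_forall μ R hf hw hwA hP0 (by positivity)
      (hfX S hS (by omega))).trans ?_
    rw [gain, mul_one]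
    gcongr
    nlinarith
  | succ j ih =>
    intro hj S hS hSn
    set g := gain y j with hg
    have hg0 : 0 < g := gain_pos hy j
    obtain ⟨hyg, hg1⟩ := le_gain hy hy1 j
    have hstep : ∀ a ∈ A \ S,
        ∫ x, ‖fluctMeanDiff μ R A w f S a x‖ ^ P ∂(Measure.pi μ) ≤
          (4 * (24 * p) ^ 2 * X * y ^ (S.card + 1) * g) ^ P := by
      intro a ha
      have haA : a ∈ A := Finset.sdiff_subset ha
      have hcard : (insert a S).card = S.card + 1 :=
        Finset.card_insert_of_notMem (Finset.mem_sdiff.1 ha).2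
      have h1 := ih (by omega) (insert a S) (Finset.insert_subset haA hS) (by omega)
      rw [hcard] at h1
      have h2 := hfX S hS (by omega) a ha
      have m1 := HasMoments.fluctMean μ R hf (w := w) (insert a S)
      have m2 := ((hf a haA).fluctOver μ R (insert a S)).const_mul (w : ℂ)
      have i1 := m1.integrable_pow P
      have i2 := m2.integrable_pow P
      have h3 : ∫ x, ‖(w : ℂ) * fluctOver μ R (insert a S) (f a) x‖ ^ P ∂(Measure.pi μ) ≤
          ((24 * p) ^ 2 * X * y ^ (S.card + 1) * g) ^ P := by
        -- `w ≤ y²`: one factor `y` pays for the extra row, the other is at most `g`.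
        have h4 : w * X * y ^ S.card ≤ (24 * p) ^ 2 * X * y ^ (S.card + 1) * g := by
          calc w * X * y ^ S.card ≤ y ^ 2 * X * y ^ S.card := by gcongr
            _ = 1 * X * y ^ (S.card + 1) * y := by ring
            _ ≤ _ := by gcongr
        calc ∫ x, ‖(w : ℂ) * fluctOver μ R (insert a S) (f a) x‖ ^ P ∂(Measure.pi μ)
            = w ^ P * ∫ x, ‖fluctOver μ R (insert a S) (f a) x‖ ^ P ∂(Measure.pi μ) := by
              rw [← integral_const_mul]
              congr 1
              funext x
              rw [norm_mul, mul_pow, Complex.norm_real, Real.norm_of_nonneg hw]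
          _ ≤ w ^ P * (X * y ^ S.card) ^ P := by gcongr
          _ = (w * X * y ^ S.card) ^ P := by rw [← mul_pow, mul_assoc]
          _ ≤ _ := by gcongr
      calc ∫ x, ‖fluctMeanDiff μ R A w f S a x‖ ^ P ∂(Measure.pi μ)
          ≤ ∫ x, 2 ^ (P - 1) * (‖fluctMean μ R A w f (insert a S) x‖ ^ P +
              ‖(w : ℂ) * fluctOver μ R (insert a S) (f a) x‖ ^ P) ∂(Measure.pi μ) := by
            refine integral_mono ((HasMoments.fluctMeanDiff μ R hf S haA).integrable_pow P)
              ((i1.add i2).const_mul _) fun x => ?_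
            refine (pow_le_pow_left₀ (norm_nonneg _) (norm_add_le _ _) P).trans ?_
            exact add_pow_le (norm_nonneg _) (norm_nonneg _) P
        _ ≤ 2 ^ (P - 1) * (((24 * p) ^ 2 * X * y ^ (S.card + 1) * g) ^ P +
              ((24 * p) ^ 2 * X * y ^ (S.card + 1) * g) ^ P) := by
            rw [integral_const_mul, integral_add i1 i2]
            gcongr
        _ = 2 ^ P * ((24 * p) ^ 2 * X * y ^ (S.card + 1) * g) ^ P := by
            rw [← pow_sub_one_mul hP0 (2 : ℝ)]; ring
        _ ≤ 4 ^ P * ((24 * p) ^ 2 * X * y ^ (S.card + 1) * g) ^ P := by gcongr; norm_num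
        _ = _ := by rw [← mul_pow]; ring_nf
    set t := gain y (j + 1) with ht
    have ht0 : 0 < t := gain_pos hy _
    have ht2 : t ^ 2 = y * g := Real.sq_sqrt (by positivity)
    have hty : t ≤ √y := by
      rw [ht, gain]; apply Real.sqrt_le_sqrt; nlinarith
    have hsq : √((X * y ^ S.card) ^ P * (4 * (24 * p) ^ 2 * X * y ^ (S.card + 1) * g) ^ P) =
        (48 * p * X * y ^ S.card * t) ^ P := by
      rw [← mul_pow]
      have : X * y ^ S.card * (4 * (24 * p) ^ 2 * X * y ^ (S.card + 1) * g) =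
          (48 * p * X * y ^ S.card * t) ^ 2 := by
        rw [mul_pow _ t, ht2]; ring
      rw [this, pow_right_comm, Real.sqrt_sq (by positivity)]
    refine (integral_norm_fluctMean_pow_le μ R hf hw hwA s (by positivity) (by positivity)
      (hfX S hS (by omega)) hstep).trans ?_
    rw [hsq]
    -- The term `D` is smaller than `√(B D)` because `t² = y g` and `48 p t ≤ 48 p √y ≤ 1`.
    have hD : 4 * (24 * p) ^ 2 * X * y ^ (S.card + 1) * g ≤ 48 * p * X * y ^ S.card * t := by
      calc 4 * (24 * p) ^ 2 * X * y ^ (S.card + 1) * g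
          = 48 * p * X * y ^ S.card * (48 * p * t ^ 2) := by rw [ht2]; ring
        _ ≤ 48 * p * X * y ^ S.card * t := by
            gcongr
            calc 48 * p * t ^ 2 = (48 * p * t) * t := by ring
              _ ≤ (48 * p * √y) * t := by gcongr
              _ ≤ 1 * t := by gcongr
              _ = t := one_mul t
    -- The constant `(24p)²` reproduces itself: it enters under the square root as `2 · 24p = 48p`,
    -- and `2 · 6p · 48p = (24p)²`.
    calc 2 * (6 * p) ^ P * ((48 * p * X * y ^ S.card * t) ^ P +
          (4 * (24 * p) ^ 2 * X * y ^ (S.card + 1) * g) ^ P)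
        ≤ 2 * (6 * p) ^ P * ((48 * p * X * y ^ S.card * t) ^ P +
          (48 * p * X * y ^ S.card * t) ^ P) := by gcongr
      _ = 2 ^ 2 * ((6 * p) * (48 * p * X * y ^ S.card * t)) ^ P := by
          rw [mul_pow (6 * p)]; ring
      _ ≤ 2 ^ P * ((6 * p) * (48 * p * X * y ^ S.card * t)) ^ P := by
          gcongr
          · norm_num
          · omega
      _ = ((24 * p) ^ 2 * X * y ^ S.card * t) ^ P := by rw [← mul_pow]; ring_nf

end Recursion

/-! ### Alternating sums of minors -/

section Alternating

variable {β : Type*} [DecidableEq β]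

/-- The Picard iterates of the equation `x i = δ i a - ∑ j ∈ insert a T, F i j * x j`. -/
def picard (F : β → β → ℂ) (a : β) : ℕ → Finset β → β → ℂ
  | 0, _, i => if i = a then 1 else 0
  | m + 1, T, i => (if i = a then 1 else 0) - ∑ j ∈ insert a T, F i j * picard F a m T j

/-- The sets containing `j` are `insert j T` with `T ⊆ W.erase j`, of opposite sign. This transfers
`j` from the alternating variables to the fixed ones. -/
theorem sum_powerset_sum_mem (W : Finset β) (g : Finset β → β → ℂ) :
    ∑ T ∈ W.powerset, (-1) ^ T.card * ∑ j ∈ T, g T j =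
      -∑ j ∈ W, ∑ T ∈ (W.erase j).powerset, (-1) ^ T.card * g (insert j T) j := by
  have h1 : ∀ T ∈ W.powerset, (-1) ^ T.card * ∑ j ∈ T, g T j =
      ∑ j ∈ W, if j ∈ T then (-1) ^ T.card * g T j else 0 := by
    intro T hT
    rw [← Finset.sum_filter, Finset.filter_mem_eq_inter,
      Finset.inter_eq_right.2 (Finset.mem_powerset.1 hT), Finset.mul_sum]
  rw [Finset.sum_congr rfl h1, Finset.sum_comm, ← Finset.sum_neg_distrib]
  refine Finset.sum_congr rfl fun j hj => ?_
  conv_lhs => rw [← Finset.insert_erase hj]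
  rw [Finset.sum_powerset_insert (Finset.notMem_erase j W), ← Finset.sum_neg_distrib]
  rw [Finset.sum_eq_zero fun T hT => if_neg fun h =>
    Finset.notMem_erase j W (Finset.mem_powerset.1 hT h), zero_add]
  refine Finset.sum_congr rfl fun T hT => ?_
  have hjT : j ∉ T := fun h => Finset.notMem_erase j W (Finset.mem_powerset.1 hT h)
  rw [if_pos (Finset.mem_insert_self j T), Finset.card_insert_of_notMem hjT, pow_succ]
  ring

omit [DecidableEq β] in
theorem sum_powerset_const_eq_zero {W : Finset β} (hW : W.Nonempty) (c : ℂ) :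
    ∑ T ∈ W.powerset, (-1) ^ T.card * c = 0 := by
  have h := Finset.sum_powerset_neg_one_pow_card_of_nonempty hW
  rw [← Finset.sum_mul]
  have h' : (∑ T ∈ W.powerset, (-1 : ℂ) ^ T.card) = 0 := by exact_mod_cast h
  rw [h', zero_mul]

/-- The `m`-th Picard iterate, as a function of the set `T`, has degree less than `m`. -/
theorem sum_powerset_picard_eq_zero (F : β → β → ℂ) (a : β) (m : ℕ) :
    ∀ V W : Finset β, a ∉ V → a ∉ W → Disjoint V W → W.Nonempty → m ≤ W.card → ∀ i,
      ∑ T ∈ W.powerset, (-1) ^ T.card * picard F a m (V ∪ T) i = 0 := by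
  induction m with
  | zero =>
    intro V W _ _ _ hW _ i
    exact sum_powerset_const_eq_zero hW _
  | succ m ih =>
    intro V W haV haW hVW hW hm i
    -- The sum over `insert a (V ∪ T)` splits into `a`, `V` and `T`. The first two fall under the
    -- induction hypothesis with the same `W`; the third moves some `j` from `W` to `V`, lowering
    -- the size of `W` and the order `m` together.
    have e : ∀ T ∈ W.powerset, (-1) ^ T.card * picard F a (m + 1) (V ∪ T) i =
        (-1) ^ T.card * (if i = a then 1 else 0) -
          F i a * ((-1) ^ T.card * picard F a m (V ∪ T) a) -
          ∑ j ∈ V, F i j * ((-1) ^ T.card * picard F a m (V ∪ T) j) -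
          (-1) ^ T.card * ∑ j ∈ T, F i j * picard F a m (V ∪ T) j := by
      intro T hT
      have hTW := Finset.mem_powerset.1 hT
      have ha : a ∉ V ∪ T := by
        rw [Finset.mem_union]; rintro (h | h)
        · exact haV h
        · exact haW (hTW h)
      rw [picard, Finset.sum_insert ha, Finset.sum_union (hVW.mono_right hTW)]
      simp only [mul_left_comm (F i _) ((-1) ^ T.card), ← Finset.mul_sum]
      ring
    rw [Finset.sum_congr rfl e, Finset.sum_sub_distrib, Finset.sum_sub_distrib,
      Finset.sum_sub_distrib, sum_powerset_const_eq_zero hW, ← Finset.mul_sum,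
      ih V W haV haW hVW hW (by omega), Finset.sum_comm,
      Finset.sum_eq_zero (s := V) fun j _ => by
        rw [← Finset.mul_sum, ih V W haV haW hVW hW (by omega), mul_zero],
      sum_powerset_sum_mem W fun T j => F i j * picard F a m (V ∪ T) j]
    rw [Finset.sum_eq_zero (s := W) fun j hj => ?_]
    · simp
    · have e2 : ∀ T ∈ (W.erase j).powerset,
          (-1) ^ T.card * (F i j * picard F a m (V ∪ insert j T) j) =
            F i j * ((-1) ^ T.card * picard F a m (insert j V ∪ T) j) := by
        intro T _
        rw [Finset.union_insert, Finset.insert_union]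
        ring
      rw [Finset.sum_congr rfl e2, ← Finset.mul_sum]
      have hja : j ≠ a := fun h => haW (h ▸ hj)
      have hcard := Finset.card_erase_of_mem hj
      -- With no alternating variable left the induction hypothesis is unavailable, but then `m =
      -- 0`, and the zeroth iterate vanishes at `j ≠ a`.
      rcases (W.erase j).eq_empty_or_nonempty with h0 | h0
      · have hm0 : m = 0 := by
          rw [h0, Finset.card_empty] at hcard; omega
        subst hm0
        simp [h0, picard, hja]
      · rw [ih (insert j V) (W.erase j) ?_ (fun h => haW (Finset.mem_of_mem_erase h)) ?_ h0
          (by omega), mul_zero]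
        · rw [Finset.mem_insert]; rintro (h | h)
          · exact hja h.symm
          · exact haV h
        · rw [Finset.disjoint_insert_left]
          exact ⟨Finset.notMem_erase j W, hVW.mono_right (Finset.erase_subset j W)⟩

omit [DecidableEq β] in
theorem norm_sum_mul_le {U : Finset β} {f x : β → ℂ} {Y M : ℝ} {k : ℝ} (hY : 0 ≤ Y)
    (hM : 0 ≤ M) (hk : (U.card : ℝ) ≤ k) (hf : ∀ j ∈ U, ‖f j‖ ≤ Y) (hx : ∀ j ∈ U, ‖x j‖ ≤ M) :
    ‖∑ j ∈ U, f j * x j‖ ≤ k * Y * M := by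
  calc _ ≤ ∑ j ∈ U, ‖f j * x j‖ := norm_sum_le _ _
    _ ≤ ∑ j ∈ U, Y * M := Finset.sum_le_sum fun j hj => by
        rw [norm_mul]; exact mul_le_mul (hf j hj) (hx j hj) (norm_nonneg _) hY
    _ = U.card * (Y * M) := by rw [Finset.sum_const, nsmul_eq_mul]
    _ ≤ k * (Y * M) := by gcongr
    _ = _ := by ring

/-- Evaluate the equation where `‖x i‖` is maximal: `‖x i‖ ≤ 1 + ‖x i‖ / 2`. -/
theorem norm_le_two_of_eq_sub_sum {F : β → β → ℂ} {a : β} {T : Finset β} {x : β → ℂ} {Y k : ℝ}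
    (hY : 0 ≤ Y) (hk : ((insert a T).card : ℝ) ≤ k) (hkY : k * Y ≤ 1 / 2)
    (hF : ∀ i ∈ insert a T, ∀ j ∈ insert a T, ‖F i j‖ ≤ Y)
    (hx : ∀ i ∈ insert a T, x i = (if i = a then 1 else 0) - ∑ j ∈ insert a T, F i j * x j) :
    ∀ i ∈ insert a T, ‖x i‖ ≤ 2 := by
  obtain ⟨i, hi, hmax⟩ := Finset.exists_max_image (insert a T) (fun i => ‖x i‖)
    (Finset.insert_nonempty a T)
  have h1 : ‖x i‖ ≤ 1 + k * Y * ‖x i‖ := by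
    conv_lhs => rw [hx i hi]
    refine (norm_sub_le _ _).trans (add_le_add ?_ ?_)
    · split_ifs <;> simp
    · exact norm_sum_mul_le hY (norm_nonneg _) hk (hF i hi) hmax
  have h2 : ‖x i‖ ≤ 2 := by nlinarith [norm_nonneg (x i)]
  exact fun j hj => (hmax j hj).trans h2

/-- Alternating sums over `T ⊆ S` of solutions of `x i = δ i a - ∑ j ∈ insert a T, F i j * x j`
gain a factor `‖F‖` for every element of `S`. -/
theorem norm_alternating_sum_le {F : β → β → ℂ} {a : β} {S : Finset β} (ha : a ∉ S)
    (hS : S.Nonempty) {x : Finset β → β → ℂ} {γ : ℂ} {X Y k : ℝ} (hY : 0 ≤ Y) (hX : 0 ≤ X)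
    (hk : ((insert a S).card : ℝ) ≤ k) (hkY : k * Y ≤ 1 / 2)
    (hF : ∀ i ∈ insert a S, ∀ j ∈ insert a S, ‖F i j‖ ≤ Y)
    (hγ : ∀ j ∈ insert a S, ‖γ * F a j‖ ≤ X)
    (hx : ∀ T ⊆ S, ∀ i ∈ insert a T,
      x T i = (if i = a then 1 else 0) - ∑ j ∈ insert a T, F i j * x T j) :
    ‖∑ T ∈ S.powerset, (-1) ^ T.card * (γ * x T a)‖ ≤
      2 ^ S.card * (2 * k * X * (k * Y) ^ S.card) := by
  have hk0 : 0 ≤ k := (Nat.cast_nonneg _).trans hk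
  have hsub : ∀ T ⊆ S, insert a T ⊆ insert a S := fun T hT => Finset.insert_subset_insert a hT
  have hcard : ∀ T ⊆ S, ((insert a T).card : ℝ) ≤ k := fun T hT =>
    le_trans (by exact_mod_cast Finset.card_le_card (hsub T hT)) hk
  -- Each Picard step contracts the error by `k * Y`.
  have err : ∀ m, ∀ T ⊆ S, ∀ i ∈ insert a T,
      ‖x T i - picard F a m T i‖ ≤ 2 * (k * Y) ^ (m + 1) := by
    intro m
    induction m with
    | zero =>
      intro T hT i hi
      have : x T i - picard F a 0 T i = -∑ j ∈ insert a T, F i j * x T j := by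
        rw [hx T hT i hi, picard]; ring
      rw [this, norm_neg]
      refine (norm_sum_mul_le (M := 2) hY (by norm_num) (hcard T hT)
        (fun j hj => hF i (hsub T hT hi) j (hsub T hT hj)) ?_).trans
          (le_of_eq (by ring))
      exact norm_le_two_of_eq_sub_sum hY (hcard T hT) hkY
        (fun i hi j hj => hF i (hsub T hT hi) j (hsub T hT hj)) (hx T hT)
    | succ m ih =>
      intro T hT i hi
      have : x T i - picard F a (m + 1) T i =
          -∑ j ∈ insert a T, F i j * (x T j - picard F a m T j) := by
        simp only [mul_sub, Finset.sum_sub_distrib]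
        rw [hx T hT i hi, picard]; ring
      rw [this, norm_neg]
      refine (norm_sum_mul_le hY (by positivity) (hcard T hT)
        (fun j hj => hF i (hsub T hT hi) j (hsub T hT hj)) (ih T hT)).trans (le_of_eq ?_)
      ring
  obtain ⟨m, hm⟩ : ∃ m, S.card = m + 1 := Nat.exists_eq_succ_of_ne_zero hS.card_ne_zero
  -- The last step is taken at row `a` together with the prefactor `γ`, so that it costs `X` instead
  -- of `Y`. The iterate of order `|S|` is thus still annihilated by the alternating sum, with an
  -- error of order `X (kY)^|S|`.
  have herr : ∀ T ∈ S.powerset,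
      ‖γ * (x T a - picard F a (m + 1) T a)‖ ≤ 2 * k * X * (k * Y) ^ (m + 1) := by
    intro T hT
    have hT := Finset.mem_powerset.1 hT
    have : γ * (x T a - picard F a (m + 1) T a) =
        -∑ j ∈ insert a T, (γ * F a j) * (x T j - picard F a m T j) := by
      simp only [mul_assoc, ← Finset.mul_sum, mul_sub, Finset.sum_sub_distrib]
      rw [hx T hT a (Finset.mem_insert_self a T), picard]; ring
    rw [this, norm_neg]
    refine (norm_sum_mul_le hX (by positivity) (hcard T hT)
      (fun j hj => hγ j (hsub T hT hj)) (err m T hT)).trans (le_of_eq ?_)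
    ring
  have h0 := sum_powerset_picard_eq_zero F a (m + 1) ∅ S (Finset.notMem_empty a) ha
    (Finset.disjoint_empty_left S) hS hm.ge a
  simp only [Finset.empty_union] at h0
  have e : ∑ T ∈ S.powerset, (-1) ^ T.card * (γ * x T a) =
      ∑ T ∈ S.powerset, (-1) ^ T.card * (γ * (x T a - picard F a (m + 1) T a)) := by
    have : γ * ∑ T ∈ S.powerset, (-1) ^ T.card * picard F a (m + 1) T a = 0 := by
      rw [h0, mul_zero]
    rw [Finset.mul_sum] at this
    rw [← sub_zero (∑ T ∈ S.powerset, (-1) ^ T.card * (γ * x T a)), ← this,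
      ← Finset.sum_sub_distrib]
    exact Finset.sum_congr rfl fun T _ => by ring
  rw [e]
  calc _ ≤ ∑ T ∈ S.powerset, 2 * k * X * (k * Y) ^ (m + 1) := by
        refine (norm_sum_le _ _).trans (Finset.sum_le_sum fun T hT => ?_)
        rw [norm_mul, norm_pow, norm_neg, norm_one, one_pow, one_mul]
        exact herr T hT
    _ = _ := by
        rw [Finset.sum_const, Finset.card_powerset, nsmul_eq_mul, hm]; push_cast; ring

end Alternating

/-! ### Resolvents of Hermitian matrices and their minors -/

section Resolvent

open DeformedWigner Matrix

variable {N : ℕ} {H : Matrix (Fin N) (Fin N) ℂ} {z : ℂ}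

theorem im_star_dotProduct_sub_mulVec (hH : H.IsHermitian) (z : ℂ) (g : Fin N → ℂ) :
    (star g ⬝ᵥ ((H - z • (1 : Matrix (Fin N) (Fin N) ℂ)) *ᵥ g)).im =
      -(z.im * ∑ j, ‖g j‖ ^ 2) := by
  have h1 : (star g ⬝ᵥ H *ᵥ g).im = 0 := hH.im_star_dotProduct_mulVec_self g
  have h2 : star g ⬝ᵥ g = ((∑ j, ‖g j‖ ^ 2 : ℝ) : ℂ) := by
    simp only [dotProduct, Pi.star_apply, RCLike.star_def]
    push_cast
    refine Finset.sum_congr rfl fun j _ => ?_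
    rw [mul_comm, Complex.mul_conj, Complex.normSq_eq_norm_sq]
    push_cast; rfl
  rw [sub_mulVec, smul_mulVec, one_mulVec, dotProduct_sub, dotProduct_smul, h2, Complex.sub_im, h1,
    smul_eq_mul, Complex.mul_im, Complex.ofReal_re, Complex.ofReal_im]
  ring

theorem isUnit_det_sub_smul (hH : H.IsHermitian) (hz : 0 < z.im) :
    IsUnit (H - z • (1 : Matrix (Fin N) (Fin N) ℂ)).det := by
  rw [isUnit_iff_ne_zero]
  intro h0
  obtain ⟨g, hg, hg0⟩ := exists_mulVec_eq_zero_iff.2 h0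
  have h := im_star_dotProduct_sub_mulVec hH z g
  rw [hg0, dotProduct_zero, Complex.zero_im] at h
  obtain ⟨i, hi⟩ : ∃ i, g i ≠ 0 := Function.ne_iff.1 hg
  have hpos : 0 < ∑ j, ‖g j‖ ^ 2 :=
    Finset.sum_pos' (fun j _ => by positivity) ⟨i, Finset.mem_univ i, by positivity⟩
  nlinarith

theorem sub_smul_mulVec_resolvent_col (hH : H.IsHermitian) (hz : 0 < z.im) (a : Fin N) :
    (H - z • (1 : Matrix (Fin N) (Fin N) ℂ)) *ᵥ (fun j => DeformedWigner.resolvent H z j a) =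
      Pi.single a 1 := by
  funext i
  have h := Matrix.mul_nonsing_inv _ (isUnit_det_sub_smul hH hz)
  have := congrFun (congrFun h i) a
  rw [Matrix.mul_apply] at this
  simp only [mulVec, dotProduct, DeformedWigner.resolvent]
  rw [this, Matrix.one_apply, Pi.single_apply]

theorem im_resolvent_diag (hH : H.IsHermitian) (hz : 0 < z.im) (a : Fin N) :
    (DeformedWigner.resolvent H z a a).im =
      z.im * ∑ j, ‖DeformedWigner.resolvent H z j a‖ ^ 2 := by
  have h := im_star_dotProduct_sub_mulVec hH z (fun j => DeformedWigner.resolvent H z j a)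
  rw [sub_smul_mulVec_resolvent_col hH hz, dotProduct_single] at h
  simp at h
  exact h

/-- Cauchy–Schwarz in the `(a,a)` entry of `(H - z) G = 1`. With `Im G_aa = Im z ∑ |G_ja|²` it
bounds `|G_aa|` from below without any probability. -/
theorem one_le_sum_sq_mul (hH : H.IsHermitian) (hz : 0 < z.im) (a : Fin N) :
    1 ≤ (∑ j, ‖(H - z • (1 : Matrix (Fin N) (Fin N) ℂ)) a j‖ ^ 2) *
      ∑ j, ‖DeformedWigner.resolvent H z j a‖ ^ 2 := by
  have h := congrFun (sub_smul_mulVec_resolvent_col hH hz a) a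
  rw [Pi.single_eq_same] at h
  have h1 : (1 : ℝ) ≤ ∑ j, ‖(H - z • (1 : Matrix (Fin N) (Fin N) ℂ)) a j‖ *
      ‖DeformedWigner.resolvent H z j a‖ := by
    calc (1 : ℝ) = ‖(1 : ℂ)‖ := by simp
      _ ≤ _ := by
        rw [← h, mulVec, dotProduct]
        refine (norm_sum_le _ _).trans (le_of_eq ?_)
        simp only [norm_mul]
  calc (1 : ℝ) ≤ (∑ j, ‖(H - z • (1 : Matrix (Fin N) (Fin N) ℂ)) a j‖ *
      ‖DeformedWigner.resolvent H z j a‖) ^ 2 := by nlinarith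
    _ ≤ _ := Finset.sum_mul_sq_le_sq_mul_sq _ _ _

theorem sum_sq_resolvent_col_pos (hH : H.IsHermitian) (hz : 0 < z.im) (a : Fin N) :
    0 < ∑ j, ‖DeformedWigner.resolvent H z j a‖ ^ 2 := by
  have h := one_le_sum_sq_mul hH hz a
  have h0 : 0 ≤ ∑ j, ‖(H - z • (1 : Matrix (Fin N) (Fin N) ℂ)) a j‖ ^ 2 :=
    Finset.sum_nonneg fun j _ => by positivity
  by_contra hc
  nlinarith

theorem resolvent_diag_ne_zero (hH : H.IsHermitian) (hz : 0 < z.im) (a : Fin N) :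
    DeformedWigner.resolvent H z a a ≠ 0 := by
  intro h
  have h1 := im_resolvent_diag hH hz a
  rw [h, Complex.zero_im] at h1
  have := mul_pos hz (sum_sq_resolvent_col_pos hH hz a)
  linarith

theorem norm_inv_resolvent_diag_le (hH : H.IsHermitian) (hz : 0 < z.im) (a : Fin N) :
    ‖1 / DeformedWigner.resolvent H z a a‖ ≤
      (∑ j, ‖(H - z • (1 : Matrix (Fin N) (Fin N) ℂ)) a j‖ ^ 2) / z.im := by
  have h1 := im_resolvent_diag hH hz a
  have h2 := one_le_sum_sq_mul hH hz a
  have h3 := (le_abs_self _).trans (Complex.abs_im_le_norm (DeformedWigner.resolvent H z a a))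
  have h4 : 0 < ‖DeformedWigner.resolvent H z a a‖ :=
    norm_pos_iff.2 (resolvent_diag_ne_zero hH hz a)
  set A := ∑ j, ‖(H - z • (1 : Matrix (Fin N) (Fin N) ℂ)) a j‖ ^ 2
  set B := ∑ j, ‖DeformedWigner.resolvent H z j a‖ ^ 2
  have hA : 0 ≤ A := Finset.sum_nonneg fun j _ => by positivity
  rw [norm_div, norm_one, div_le_div_iff₀ h4 hz, one_mul]
  calc z.im ≤ z.im * (A * B) := le_mul_of_one_le_right hz.le h2
    _ = A * (z.im * B) := by ring
    _ ≤ A * ‖DeformedWigner.resolvent H z a a‖ := by rw [← h1]; gcongr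

theorem isHermitian_removeRows (hH : H.IsHermitian) (T : Finset (Fin N)) :
    (removeRows T H).IsHermitian := by
  ext i j
  rw [conjTranspose_apply]
  simp only [removeRows, Matrix.of_apply]
  by_cases h : i ∈ T ∨ j ∈ T
  · rw [if_pos h, if_pos h.symm, star_zero]
  · rw [if_neg h, if_neg (fun h' => h h'.symm)]
    exact hH.apply i j

/-- The entry `1 / G_aa^{(T)}` is the `a`-th entry of the solution of the linear system given by
the restriction of the Green function to `insert a T`. -/
theorem exists_solution_minor (hH : H.IsHermitian) (hz : 0 < z.im) {T : Finset (Fin N)}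
    {a : Fin N} (ha : a ∉ T) :
    ∃ y : Fin N → ℂ, y a = 1 / DeformedWigner.resolvent (removeRows T H) z a a ∧
      ∀ i ∈ insert a T, ∑ j ∈ insert a T, DeformedWigner.resolvent H z i j * y j =
        if i = a then 1 else 0 := by
  set HT := removeRows T H with hHT
  have hHTh : HT.IsHermitian := isHermitian_removeRows hH T
  set g : Fin N → ℂ := fun j => DeformedWigner.resolvent HT z j a with hg
  have hga : g a ≠ 0 := resolvent_diag_ne_zero hHTh hz a
  have hcol := sub_smul_mulVec_resolvent_col hHTh hz a
  rw [← hg] at hcol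
  have hz0 : z ≠ 0 := by rintro rfl; simp at hz
  have hsub : ∀ (K : Matrix (Fin N) (Fin N) ℂ) i,
      ((K - z • (1 : Matrix (Fin N) (Fin N) ℂ)) *ᵥ g) i = (K *ᵥ g) i - z * g i := by
    intro K i
    rw [sub_mulVec, smul_mulVec, one_mulVec]; rfl
  have hgT : ∀ i ∈ T, g i = 0 := by
    intro i hi
    have h := congrFun hcol i
    have hia : i ≠ a := fun h => ha (h ▸ hi)
    rw [hsub, Pi.single_eq_of_ne hia] at h
    have h0 : (HT *ᵥ g) i = 0 := by
      rw [mulVec, dotProduct]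
      exact Finset.sum_eq_zero fun j _ => by simp [hHT, removeRows, hi]
    rw [h0, zero_sub, neg_eq_zero] at h
    exact (mul_eq_zero.1 h).resolve_left hz0
  -- `g` is column `a` of the minor's resolvent and vanishes on `T`. Applying the full `H - z` to it
  -- therefore gives the unit vector at `a` off `T`, so `c` is supported on `insert a T`, and `G c =
  -- g` read on that set is the system, after division by `g a`.
  set c : Fin N → ℂ := (H - z • (1 : Matrix (Fin N) (Fin N) ℂ)) *ᵥ g with hc
  have hcT : ∀ i, i ∉ T → c i = if i = a then 1 else 0 := by
    intro i hi
    have h := congrFun hcol i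
    rw [hsub, Pi.single_apply] at h
    rw [hc, hsub, ← h]
    congr 1
    rw [mulVec, mulVec, dotProduct, dotProduct]
    refine Finset.sum_congr rfl fun j _ => ?_
    by_cases hj : j ∈ T
    · simp [hgT j hj]
    · simp [hHT, removeRows, hi, hj]
  refine ⟨fun j => c j / g a, ?_, fun i hi => ?_⟩
  · show c a / g a = 1 / g a
    rw [hcT a ha, if_pos rfl]
  · have hinv : DeformedWigner.resolvent H z *ᵥ c = g := by
      rw [hc, mulVec_mulVec, DeformedWigner.resolvent,
        Matrix.nonsing_inv_mul _ (isUnit_det_sub_smul hH hz), one_mulVec]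
    have h1 : ∑ j ∈ insert a T, DeformedWigner.resolvent H z i j * (c j / g a) =
        ∑ j, DeformedWigner.resolvent H z i j * (c j / g a) := by
      refine Finset.sum_subset (Finset.subset_univ _) fun j _ hj => ?_
      rw [Finset.mem_insert, not_or] at hj
      rw [hcT j hj.2, if_neg hj.1, zero_div, mul_zero]
    have h2 : ∑ j, DeformedWigner.resolvent H z i j * (c j / g a) = g i / g a := by
      rw [← congrFun hinv i, mulVec, dotProduct, Finset.sum_div]
      simp only [mul_div_assoc]
    rw [h1, h2]
    split_ifs with hia
    · rw [hia, div_self hga]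
    · rw [hgT i ((Finset.mem_insert.1 hi).resolve_left hia), zero_div]

/-- The two-by-two Schur complement. It converts the assumed bound, which has `G_jj^{(a)}` in the
denominator, into one with `G_jj`. -/
theorem resolvent_removeRows_singleton (hH : H.IsHermitian) (hz : 0 < z.im) {a j : Fin N}
    (haj : a ≠ j) :
    1 / DeformedWigner.resolvent H z j j =
      1 / DeformedWigner.resolvent (removeRows {a} H) z j j *
        (1 - DeformedWigner.resolvent H z j a / DeformedWigner.resolvent H z a a *
          (DeformedWigner.resolvent H z a j / DeformedWigner.resolvent H z j j)) := by
  obtain ⟨y, hy, hsys⟩ := exists_solution_minor hH hz (T := {a}) (a := j) (by simpa using haj.symm)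
  have hja : j ∉ ({a} : Finset (Fin N)) := by simpa using haj.symm
  have h1 := hsys j (by simp)
  have h2 := hsys a (by simp)
  rw [Finset.sum_insert hja, Finset.sum_singleton, if_pos rfl] at h1
  rw [Finset.sum_insert hja, Finset.sum_singleton, if_neg haj] at h2
  have ga := resolvent_diag_ne_zero hH hz a
  have gj := resolvent_diag_ne_zero hH hz j
  rw [← hy]
  have h3 : y a = -(DeformedWigner.resolvent H z a j * y j) / DeformedWigner.resolvent H z a a := by
    rw [eq_div_iff ga]; linear_combination h2
  rw [h3] at h1
  field_simp at h1 ⊢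
  linear_combination -h1

/-- Smallness of the fractions `G_ij / G_jj` and of `G_aj / (G_aa G_jj^{(a)})` forces the
alternating sum of `1 / G_aa^{(T)}` over `T ⊆ S` to be small. -/
theorem norm_alternating_sum_minor_le (hH : H.IsHermitian) (hz : 0 < z.im) {S : Finset (Fin N)}
    {a : Fin N} (ha : a ∉ S) (hS : S.Nonempty) {X Y k : ℝ} (hY : 0 ≤ Y) (hX : 0 ≤ X)
    (hk : ((insert a S).card : ℝ) ≤ k) (hkY : k * Y ≤ 1 / 2)
    (hF : ∀ i ∈ insert a S, ∀ j ∈ insert a S, i ≠ j →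
      ‖DeformedWigner.resolvent H z i j / DeformedWigner.resolvent H z j j‖ ≤ Y)
    (hFa : ∀ j ∈ S, ‖DeformedWigner.resolvent H z a j /
      DeformedWigner.resolvent (removeRows {a} H) z j j / DeformedWigner.resolvent H z a a‖ ≤ X) :
    ‖∑ T ∈ S.powerset, (-1) ^ T.card * (1 / DeformedWigner.resolvent (removeRows T H) z a a)‖ ≤
      2 ^ S.card * (2 * k * (2 * X) * (k * Y) ^ S.card) := by
  set G := DeformedWigner.resolvent H z with hG
  have hk1 : 1 ≤ k := by
    refine le_trans ?_ hk
    exact_mod_cast Finset.card_pos.2 (Finset.insert_nonempty a S)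
  have hY1 : Y ≤ 1 := by nlinarith
  have hd : ∀ i, G i i ≠ 0 := resolvent_diag_ne_zero hH hz
  have hsol : ∀ T : Finset (Fin N), ∃ y : Fin N → ℂ, T ⊆ S →
      y a = 1 / DeformedWigner.resolvent (removeRows T H) z a a ∧
      ∀ i ∈ insert a T, ∑ j ∈ insert a T, G i j * y j = if i = a then 1 else 0 := by
    intro T
    by_cases hT : T ⊆ S
    · obtain ⟨y, hy⟩ := exists_solution_minor hH hz (T := T) (a := a) (fun h => ha (hT h))
      exact ⟨y, fun _ => hy⟩
    · exact ⟨0, fun h => absurd h hT⟩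
  choose y hy using hsol
  -- Rescaling by `x j = G_jj y j` makes the diagonal of the system equal to one and its
  -- off-diagonal part the fractions `F_ij`. The `2` in `2 * X` bounds `1 - F_ja F_aj`.
  have main := norm_alternating_sum_le (F := fun i j => if i = j then 0 else G i j / G j j)
    (x := fun T j => G j j * y T j) (γ := 1 / G a a) (X := 2 * X) (Y := Y) (k := k) ha hS hY
    (by positivity) hk hkY ?_ ?_ ?_
  · have e : ∀ T ∈ S.powerset, (-1 : ℂ) ^ T.card * (1 / G a a * (G a a * y T a)) =
        (-1) ^ T.card * (1 / DeformedWigner.resolvent (removeRows T H) z a a) := by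
      intro T hT
      rw [← (hy T (Finset.mem_powerset.1 hT)).1, ← mul_assoc (1 / G a a), one_div_mul_cancel (hd a),
        one_mul]
    rw [← Finset.sum_congr rfl e]
    exact main
  · intro i hi j hj
    split_ifs with h
    · simpa using hY
    · exact hF i hi j hj h
  · intro j hj
    split_ifs with h
    · simpa using hX
    · have hjS : j ∈ S := (Finset.mem_insert.1 hj).resolve_left (Ne.symm h)
      have h1 := resolvent_removeRows_singleton hH hz h
      rw [← hG] at h1
      have h2 : 1 / G a a * (G a j / G j j) =
          G a j / DeformedWigner.resolvent (removeRows {a} H) z j j / G a a *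
            (1 - G j a / G a a * (G a j / G j j)) := by
        have h3 : 1 / G a a * (G a j / G j j) = G a j / G a a * (1 / G j j) := by ring
        rw [h3, h1]
        ring
      rw [h2, norm_mul, mul_comm 2 X]
      refine mul_le_mul (hFa j hjS) ?_ (norm_nonneg _) hX
      refine (norm_sub_le _ _).trans ?_
      rw [norm_one, norm_mul]
      have h3 := hF j hj a (Finset.mem_insert_self a S) (Ne.symm h)
      have h4 := hF a (Finset.mem_insert_self a S) j hj h
      have : ‖G j a / G a a‖ * ‖G a j / G j j‖ ≤ 1 * 1 :=
        mul_le_mul (h3.trans hY1) (h4.trans hY1) (norm_nonneg _) one_pos.le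
      linarith
  · intro T hT i hi
    have h := (hy T hT).2 i hi
    rw [← Finset.add_sum_erase _ _ hi] at h ⊢
    rw [if_pos rfl, zero_mul, zero_add, ← h]
    have e : ∀ j ∈ (insert a T).erase i,
        (if i = j then 0 else G i j / G j j) * (G j j * y T j) = G i j * y T j := by
      intro j hj
      rw [if_neg (Finset.ne_of_mem_erase hj).symm, ← mul_assoc, div_mul_cancel₀ _ (hd j)]
    rw [Finset.sum_congr rfl e]
    ring

theorem greenMinor_empty (lam : ℝ) (v : Fin N → ℝ) (M : Matrix (Fin N) (Fin N) ℂ) (z : ℂ) :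
    greenMinor ∅ lam v M z = green lam v M z := by
  unfold greenMinor green
  congr 1

theorem isHermitian_ham (lam : ℝ) (v : Fin N → ℝ) {M : Matrix (Fin N) (Fin N) ℂ}
    (hM : M.IsHermitian) : (ham lam v M).IsHermitian := by
  refine IsHermitian.add ?_ hM
  rw [isHermitian_diagonal_iff]
  intro i
  rw [IsSelfAdjoint, RCLike.star_def, map_mul, Complex.conj_ofReal, Complex.conj_ofReal]

theorem norm_inv_greenMinor_le (lam : ℝ) {v : Fin N → ℝ} (hv : ∀ i, v i ∈ Set.Icc (-1 : ℝ) 1)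
    {M : Matrix (Fin N) (Fin N) ℂ} (hM : M.IsHermitian) (hz : 0 < z.im) (T : Finset (Fin N))
    (a : Fin N) :
    ‖1 / greenMinor T lam v M z a a‖ ≤
      2 * (∑ j, ‖M a j‖ ^ 2 + (|lam| + ‖z‖) ^ 2) / z.im := by
  refine (norm_inv_resolvent_diag_le (isHermitian_removeRows (isHermitian_ham lam v hM) T) hz a
    ).trans ?_
  gcongr
  have hj : ∀ j, ‖(removeRows T (ham lam v M) - z • (1 : Matrix (Fin N) (Fin N) ℂ)) a j‖ ^ 2 ≤
      2 * (‖M a j‖ ^ 2 + if a = j then (|lam| + ‖z‖) ^ 2 else 0) := by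
    intro j
    have hva : |v a| ≤ 1 := abs_le.2 ⟨(hv a).1, (hv a).2⟩
    have h1 : ‖(removeRows T (ham lam v M) - z • (1 : Matrix (Fin N) (Fin N) ℂ)) a j‖ ≤
        ‖M a j‖ + if a = j then |lam| + ‖z‖ else 0 := by
      rw [Matrix.sub_apply, Matrix.smul_apply, smul_eq_mul, Matrix.one_apply]
      have h2 : ‖removeRows T (ham lam v M) a j‖ ≤ ‖M a j‖ + if a = j then |lam| else 0 := by
        simp only [removeRows, Matrix.of_apply]
        split_ifs with h h'
        · simp only [norm_zero]; positivity
        · simp only [norm_zero]; positivity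
        · simp only [ham, Matrix.add_apply, Matrix.diagonal_apply, if_pos ‹a = j›]
          refine (norm_add_le _ _).trans ?_
          rw [norm_mul, Complex.norm_real, Complex.norm_real, Real.norm_eq_abs, Real.norm_eq_abs,
            add_comm]
          gcongr
          exact mul_le_of_le_one_right (abs_nonneg _) hva
        · simp [ham, ‹¬ a = j›]
      refine (norm_sub_le _ _).trans ?_
      split_ifs at h2 ⊢ with h
      · rw [mul_one]; linarith
      · rw [mul_zero, norm_zero]; linarith
    calc _ ≤ (‖M a j‖ + if a = j then |lam| + ‖z‖ else 0) ^ 2 := by gcongr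
      _ ≤ 2 * (‖M a j‖ ^ 2 + (if a = j then |lam| + ‖z‖ else 0) ^ 2) := add_sq_le
      _ = _ := by split_ifs <;> simp
  refine (Finset.sum_le_sum fun j _ => hj j).trans (le_of_eq ?_)
  rw [← Finset.mul_sum, Finset.sum_add_distrib]
  simp

end Resolvent

/-! ### Moments of variables with stretched exponential tails -/

section Tails

variable {Ω : Type*} [MeasurableSpace Ω] {P : Measure Ω} [IsProbabilityMeasure P]

/-- A bound for `𝔼 exp (T / 2)` when `ℙ (T > m) ≤ C₀ exp (-m)`. -/
def expMomentBound (C₀ : ℝ) : ℝ :=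
  Real.exp (1 / 2) + ∑' m : ℕ, Real.exp (1 / 2) * C₀ * Real.exp (-(1 / 2)) ^ (m + 1)

theorem summable_expMomentBound (C₀ : ℝ) :
    Summable fun m : ℕ => Real.exp (1 / 2) * C₀ * Real.exp (-(1 / 2)) ^ (m + 1) := by
  have h := summable_geometric_of_lt_one (Real.exp_pos (-(1 / 2))).le
    (by rw [← Real.exp_zero]; exact Real.exp_lt_exp.2 (by norm_num))
  exact ((summable_nat_add_iff 1).2 h).mul_left _

theorem expMomentBound_pos {C₀ : ℝ} (hC₀ : 0 ≤ C₀) : 0 < expMomentBound C₀ := by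
  have : 0 ≤ ∑' m : ℕ, Real.exp (1 / 2) * C₀ * Real.exp (-(1 / 2)) ^ (m + 1) :=
    tsum_nonneg fun m => by positivity
  have := Real.exp_pos (1 / 2)
  unfold expMomentBound
  linarith

/-- Layers `m + 1 < T ≤ m + 2`: halving the exponent makes `exp ((m+2)/2) · C₀ exp (-(m+1))`
summable. -/
theorem integral_exp_half_le {C₀ : ℝ} (hC₀ : 0 ≤ C₀) {T : Ω → ℝ} (hT : Measurable T)
    (htail : ∀ m : ℕ, P.real {ω | ((m + 1 : ℕ) : ℝ) < T ω} ≤ C₀ * Real.exp (-((m + 1 : ℕ) : ℝ))) :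
    Integrable (fun ω => Real.exp (T ω / 2)) P ∧
      ∫ ω, Real.exp (T ω / 2) ∂P ≤ expMomentBound C₀ := by
  set A : ℕ → Set Ω := fun m => {ω | ((m + 1 : ℕ) : ℝ) < T ω} with hA
  have hAm : ∀ m, MeasurableSet (A m) := fun m => measurableSet_lt measurable_const hT
  have hmeas : Measurable fun ω => Real.exp (T ω / 2) := by fun_prop
  have hpt : ∀ ω, ENNReal.ofReal (Real.exp (T ω / 2)) ≤ ENNReal.ofReal (Real.exp (1 / 2)) +
      ∑' m : ℕ, (A m).indicator
        (fun _ => ENNReal.ofReal (Real.exp (1 / 2) * Real.exp (((m + 1 : ℕ) : ℝ) / 2))) ω := by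
    intro ω
    rcases le_or_gt (T ω) 1 with h | h
    · refine le_trans ?_ le_self_add
      gcongr
    · refine le_trans ?_ le_add_self
      obtain ⟨m, hm⟩ : ∃ m, ⌈T ω⌉₊ = m + 2 := by
        have : 1 < ⌈T ω⌉₊ := Nat.lt_ceil.2 (by simpa using h)
        exact ⟨⌈T ω⌉₊ - 2, by omega⟩
      have h1 : ((m + 1 : ℕ) : ℝ) < T ω := Nat.lt_ceil.1 (by omega)
      have h2 : T ω ≤ ((m + 2 : ℕ) : ℝ) := hm ▸ Nat.le_ceil _
      refine le_trans ?_ (ENNReal.le_tsum m)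
      rw [Set.indicator_of_mem (show ω ∈ A m from h1), ← Real.exp_add]
      gcongr
      push_cast at h2 ⊢
      linarith
  have hbound : ∫⁻ ω, ENNReal.ofReal (Real.exp (T ω / 2)) ∂P ≤
      ENNReal.ofReal (expMomentBound C₀) := by
    calc _ ≤ ∫⁻ ω, (ENNReal.ofReal (Real.exp (1 / 2)) + ∑' m : ℕ, (A m).indicator
        (fun _ => ENNReal.ofReal (Real.exp (1 / 2) * Real.exp (((m + 1 : ℕ) : ℝ) / 2))) ω) ∂P :=
          lintegral_mono hpt
      _ = ENNReal.ofReal (Real.exp (1 / 2)) + ∑' m : ℕ,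
          ENNReal.ofReal (Real.exp (1 / 2) * Real.exp (((m + 1 : ℕ) : ℝ) / 2)) * P (A m) := by
          rw [lintegral_add_left measurable_const, lintegral_const, measure_univ, mul_one,
            lintegral_tsum fun m => (measurable_const.indicator (hAm m)).aemeasurable]
          congr 2
          funext m
          rw [lintegral_indicator_const (hAm m)]
      _ ≤ ENNReal.ofReal (Real.exp (1 / 2)) + ∑' m : ℕ,
          ENNReal.ofReal (Real.exp (1 / 2) * C₀ * Real.exp (-(1 / 2)) ^ (m + 1)) := by
          gcongr with m
          rw [← ofReal_measureReal, ← ENNReal.ofReal_mul (by positivity)]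
          apply ENNReal.ofReal_le_ofReal
          calc _ ≤ Real.exp (1 / 2) * Real.exp (((m + 1 : ℕ) : ℝ) / 2) *
                (C₀ * Real.exp (-((m + 1 : ℕ) : ℝ))) := by gcongr; exact htail m
            _ = Real.exp (1 / 2) * C₀ * (Real.exp (((m + 1 : ℕ) : ℝ) / 2) *
                Real.exp (-((m + 1 : ℕ) : ℝ))) := by ring
            _ = _ := by
                rw [← Real.exp_add, ← Real.exp_nat_mul]
                congr 2
                ring
      _ = _ := by
          rw [← ENNReal.ofReal_tsum_of_nonneg (fun m => by positivity)
            (summable_expMomentBound C₀), ← ENNReal.ofReal_add (by positivity)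
            (tsum_nonneg fun m => by positivity)]
          rfl
  refine ⟨⟨hmeas.aestronglyMeasurable, ?_⟩, ?_⟩
  · rw [hasFiniteIntegral_iff_ofReal (.of_forall fun ω => (Real.exp_pos _).le)]
    exact hbound.trans_lt ENNReal.ofReal_lt_top
  · rw [integral_eq_lintegral_of_nonneg_ae (.of_forall fun ω => (Real.exp_pos _).le)
      hmeas.aestronglyMeasurable]
    exact ENNReal.toReal_le_of_le_ofReal (expMomentBound_pos hC₀).le hbound

theorem pow_le_factorial_mul_exp_half {t : ℝ} (ht : 0 ≤ t) (k : ℕ) :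
    t ^ k ≤ 2 ^ k * k.factorial * Real.exp (t / 2) := by
  have h := Real.pow_div_factorial_le_exp (t / 2) (by positivity) k
  rw [div_le_iff₀ (by positivity), div_pow, div_le_iff₀ (by positivity)] at h
  linarith

/-- A bound for the moments of order at most `k / θ` of a variable with tails
`C₀ exp (-x ^ (1 / θ))`. -/
def momentBound (C₀ : ℝ) (k : ℕ) : ℝ := 1 + 2 ^ k * k.factorial * expMomentBound C₀

theorem one_le_momentBound {C₀ : ℝ} (hC₀ : 0 ≤ C₀) (k : ℕ) : 1 ≤ momentBound C₀ k := by
  have := expMomentBound_pos hC₀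
  unfold momentBound
  exact le_add_of_nonneg_right (by positivity)

theorem integral_pow_le_momentBound {C₀ θ : ℝ} (hC₀ : 0 ≤ C₀) (hθ : 0 < θ) {U : Ω → ℝ}
    (hU : Measurable U) (hU0 : ∀ ω, 0 ≤ U ω)
    (htail : ∀ x : ℝ, 0 < x → P.real {ω | x < U ω} ≤ C₀ * Real.exp (-(x ^ (1 / θ)))) {n k : ℕ}
    (hk : θ * n ≤ k) :
    Integrable (fun ω => U ω ^ n) P ∧ ∫ ω, U ω ^ n ∂P ≤ momentBound C₀ k := by
  set T : Ω → ℝ := fun ω => U ω ^ (1 / θ) with hTdef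
  have hT : Measurable T := hU.pow_const _
  have hT0 : ∀ ω, 0 ≤ T ω := fun ω => Real.rpow_nonneg (hU0 ω) _
  have hTθ : ∀ ω, T ω ^ θ = U ω := fun ω => by
    rw [hTdef, ← Real.rpow_mul (hU0 ω), one_div_mul_cancel hθ.ne', Real.rpow_one]
  -- With `T = U^{1/θ}` the tail assumption at `x = (m+1)^θ` becomes plainly exponential.
  obtain ⟨hI, hle⟩ := integral_exp_half_le (P := P) hC₀ hT fun m => by
    have hm : (0 : ℝ) < ((m + 1 : ℕ) : ℝ) := by positivity
    have h := htail (((m + 1 : ℕ) : ℝ) ^ θ) (by positivity)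
    rw [← Real.rpow_mul hm.le, mul_one_div_cancel hθ.ne', Real.rpow_one] at h
    refine le_trans (measureReal_mono fun ω hω => ?_) h
    rw [Set.mem_ofPred_eq] at hω ⊢
    rw [← hTθ]
    exact Real.rpow_lt_rpow hm.le hω hθ
  have hpt : ∀ ω, U ω ^ n ≤ 1 + 2 ^ k * k.factorial * Real.exp (T ω / 2) := by
    intro ω
    have e : U ω ^ n = T ω ^ (θ * n) := by
      rw [Real.rpow_mul (hT0 ω), hTθ, Real.rpow_natCast]
    rw [e]
    rcases le_or_gt (T ω) 1 with h | h
    · have : T ω ^ (θ * n) ≤ 1 := Real.rpow_le_one (hT0 ω) h (by positivity)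
      have : 0 ≤ 2 ^ k * k.factorial * Real.exp (T ω / 2) := by positivity
      linarith
    · have h1 : T ω ^ (θ * n) ≤ T ω ^ (k : ℝ) := Real.rpow_le_rpow_of_exponent_le h.le hk
      rw [Real.rpow_natCast] at h1
      have := pow_le_factorial_mul_exp_half (hT0 ω) k
      linarith
  have hIr := (integrable_const (1 : ℝ) (μ := P)).add (hI.const_mul (2 ^ k * k.factorial : ℝ))
  have hI' : Integrable (fun ω => U ω ^ n) P := hIr.mono' (hU.pow_const n).aestronglyMeasurable
    (.of_forall fun ω => by
      rw [Real.norm_of_nonneg (pow_nonneg (hU0 ω) n)]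
      exact hpt ω)
  refine ⟨hI', (integral_mono hI' hIr hpt).trans ?_⟩
  simp only [Pi.add_apply]
  rw [integral_add (integrable_const _) (hI.const_mul _), integral_const_mul]
  simp only [integral_const, probReal_univ, one_smul, momentBound]
  gcongr

/-- Moments of a function that is small outside an event of small probability. -/
theorem integral_norm_pow_le_of_event {f : Ω → ℂ} (hf : HasMoments P f) {E : Set Ω} {n : ℕ}
    {b δ V : ℝ} (hb : 0 ≤ b) (hfE : ∀ ω ∈ E, ‖f ω‖ ≤ b) (hE : P.real Eᶜ ≤ δ)
    (hV : ∫ ω, ‖f ω‖ ^ (2 * n) ∂P ≤ V) :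
    ∫ ω, ‖f ω‖ ^ n ∂P ≤ b ^ n + √δ * √V := by
  -- The event `E` is not assumed measurable; a measurable hull of its complement has the same
  -- measure.
  set S := toMeasurable P Eᶜ with hS
  have hSm : MeasurableSet S := measurableSet_toMeasurable P Eᶜ
  have hSδ : P.real S ≤ δ := by rwa [hS, measureReal_def, measure_toMeasurable, ← measureReal_def]
  have hpt : ∀ ω, ‖f ω‖ ^ n ≤ b ^ n + S.indicator 1 ω * ‖f ω‖ ^ n := by
    intro ω
    by_cases h : ω ∈ S
    · rw [Set.indicator_of_mem h, Pi.one_apply, one_mul]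
      exact le_add_of_nonneg_left (by positivity)
    · rw [Set.indicator_of_notMem h, zero_mul, add_zero]
      have : ω ∈ E := by
        by_contra h'
        exact h (subset_toMeasurable P Eᶜ h')
      exact pow_le_pow_left₀ (norm_nonneg _) (hfE ω this) n
  have hi1 : Integrable (fun ω => S.indicator (1 : Ω → ℝ) ω * ‖f ω‖ ^ n) P := by
    have : (fun ω => S.indicator (1 : Ω → ℝ) ω * ‖f ω‖ ^ n) =
        S.indicator fun ω => ‖f ω‖ ^ n := by
      funext ω
      by_cases h : ω ∈ S <;> simp [h]
    rw [this]
    exact (hf.integrable_pow n).indicator hSm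
  have hsq : ∀ ω, S.indicator (1 : Ω → ℝ) ω ^ 2 = S.indicator (1 : Ω → ℝ) ω := by
    intro ω
    by_cases h : ω ∈ S <;> simp [h]
  have hpow : ∀ ω, (‖f ω‖ ^ n) ^ 2 = ‖f ω‖ ^ (2 * n) := fun ω => by
    rw [← pow_mul, mul_comm]
  have hcs := integral_mul_le_sqrt_mul_sqrt (π := P) (f := S.indicator (1 : Ω → ℝ))
    (g := fun ω => ‖f ω‖ ^ n) (fun ω => Set.indicator_nonneg (fun _ _ => zero_le_one) ω)
    (fun ω => by positivity) (measurable_one.indicator hSm).aestronglyMeasurable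
    (hf.integrable_pow n).aestronglyMeasurable
    (by simp only [hsq]; exact (integrable_const (1 : ℝ)).indicator hSm)
    (by simp only [hpow]; exact hf.integrable_pow _)
  simp only [hsq, hpow] at hcs
  rw [integral_indicator_one hSm] at hcs
  calc ∫ ω, ‖f ω‖ ^ n ∂P ≤ ∫ ω, (b ^ n + S.indicator 1 ω * ‖f ω‖ ^ n) ∂P :=
        integral_mono (hf.integrable_pow n) ((integrable_const _).add hi1) hpt
    _ = b ^ n + ∫ ω, S.indicator 1 ω * ‖f ω‖ ^ n ∂P := by
        rw [integral_add (integrable_const _) hi1]; simp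
    _ ≤ b ^ n + √(P.real S) * √(∫ ω, ‖f ω‖ ^ (2 * n) ∂P) := by gcongr
    _ ≤ _ := by gcongr

end Tails

/-! ### Wigner matrices as functions of independent coordinates -/

section Wigner

open DeformedWigner Matrix

/-- The index set of the entries on and above the diagonal. -/
abbrev UpperIndex (N : ℕ) : Type := {p : Fin N × Fin N // p.1 ≤ p.2}

variable {N : ℕ}

/-- The Hermitian matrix with given entries above the diagonal. -/
def hermitianOf (x : UpperIndex N → ℂ) : Matrix (Fin N) (Fin N) ℂ :=
  Matrix.of fun i j =>
    if h : i < j then x ⟨(i, j), h.le⟩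
    else if h' : j < i then (starRingEnd ℂ) (x ⟨(j, i), h'.le⟩)
    else ((x ⟨(i, i), le_rfl⟩).re : ℂ)

theorem measurable_hermitianOf (i j : Fin N) :
    Measurable fun x : UpperIndex N → ℂ => hermitianOf x i j := by
  simp only [hermitianOf, Matrix.of_apply]
  split_ifs with h h'
  · exact measurable_pi_apply _
  · exact Complex.continuous_conj.measurable.comp (measurable_pi_apply _)
  · exact Complex.measurable_ofReal.comp (Complex.measurable_re.comp (measurable_pi_apply _))

/-- Taking real parts on the diagonal makes `hermitianOf x` Hermitian for every `x`, and loses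
nothing when the matrix already is. -/
theorem hermitianOf_upper {M : Matrix (Fin N) (Fin N) ℂ} (hM : M.IsHermitian) :
    hermitianOf (fun p : UpperIndex N => M p.1.1 p.1.2) = M := by
  ext i j
  simp only [hermitianOf, Matrix.of_apply]
  rcases lt_trichotomy i j with h | h | h
  · rw [dif_pos h]
  · subst h
    rw [dif_neg (lt_irrefl i), dif_neg (lt_irrefl i)]
    exact Complex.conj_eq_iff_re.1 (hM.apply i i)
  · rw [dif_neg h.not_gt, dif_pos h]
    exact hM.apply i j

/-- The coordinates in the row and column `a`. -/
def rowCoords (a : Fin N) : Finset (UpperIndex N) :=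
  Finset.univ.filter fun p => p.1.1 = a ∨ p.1.2 = a

theorem mem_rowCoords {a : Fin N} {p : UpperIndex N} :
    p ∈ rowCoords a ↔ p.1.1 = a ∨ p.1.2 = a := by
  simp [rowCoords]

theorem hermitianOf_mix (a : Fin N) (x x' : UpperIndex N → ℂ) :
    hermitianOf (mix (rowCoords a) x x') =
      replaceRow a (hermitianOf x) (hermitianOf x') := by
  ext i j
  simp only [hermitianOf, replaceRow, Matrix.of_apply, mix, mem_rowCoords]
  rcases lt_trichotomy i j with h | h | h
  · simp only [dif_pos h]
  · subst h
    simp only [lt_irrefl, dite_false]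
    split_ifs <;> simp_all
  · simp only [dif_neg h.not_gt, dif_pos h]
    split_ifs <;> simp_all

theorem hermitianOf_congr {a i j : Fin N} (hi : i ≠ a) (hj : j ≠ a) {x y : UpperIndex N → ℂ}
    (h : ∀ p, p ∉ rowCoords a → x p = y p) : hermitianOf x i j = hermitianOf y i j := by
  have h' : ∀ p : UpperIndex N, p.1.1 ≠ a → p.1.2 ≠ a → x p = y p := fun p h1 h2 =>
    h p (by rw [mem_rowCoords]; tauto)
  simp only [hermitianOf, Matrix.of_apply]
  split_ifs
  · exact h' _ hi hj
  · rw [h' _ hj hi]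
  · rw [h' _ hi hi]

theorem measurable_matrix_det {γ : Type*} [MeasurableSpace γ]
    {A : γ → Matrix (Fin N) (Fin N) ℂ} (hA : ∀ i j, Measurable fun x => A x i j) :
    Measurable fun x => (A x).det := by
  simp only [Matrix.det_apply]
  exact Finset.measurable_sum _ fun σ _ =>
    (Finset.measurable_prod _ fun i _ => hA _ _).const_smul _

theorem measurable_matrix_inv {γ : Type*} [MeasurableSpace γ]
    {A : γ → Matrix (Fin N) (Fin N) ℂ} (hA : ∀ i j, Measurable fun x => A x i j)
    (i j : Fin N) : Measurable fun x => (A x)⁻¹ i j := by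
  simp only [Matrix.inv_def, Matrix.smul_apply, Ring.inverse_eq_inv', smul_eq_mul,
    Matrix.adjugate_apply]
  refine (measurable_matrix_det hA).inv.mul (measurable_matrix_det fun k l => ?_)
  simp only [Matrix.updateRow_apply]
  split_ifs
  · exact measurable_const
  · exact hA _ _

theorem measurable_greenMinor (T : Finset (Fin N)) (lam : ℝ) (v : Fin N → ℝ) (z : ℂ)
    {γ : Type*} [MeasurableSpace γ] {A : γ → Matrix (Fin N) (Fin N) ℂ}
    (hA : ∀ i j, Measurable fun x => A x i j) (i j : Fin N) :
    Measurable fun x => greenMinor T lam v (A x) z i j := by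
  refine measurable_matrix_inv (fun k l => ?_) i j
  simp only [Matrix.sub_apply, removeRows, Matrix.of_apply, ham, Matrix.add_apply]
  split_ifs
  · exact measurable_const
  · exact ((hA k l).const_add _).sub_const _

/-- The reciprocal of a diagonal entry of the Green function of a minor. -/
def invGreen (lam : ℝ) (v : Fin N → ℝ) (z : ℂ) (a : Fin N) (T : Finset (Fin N))
    (x : UpperIndex N → ℂ) : ℂ :=
  1 / greenMinor T lam v (hermitianOf x) z a a

theorem measurable_invGreen (lam : ℝ) (v : Fin N → ℝ) (z : ℂ) (a : Fin N)
    (T : Finset (Fin N)) : Measurable (invGreen lam v z a T) :=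
  (measurable_greenMinor T lam v z measurable_hermitianOf a a).const_div 1

theorem indepOf_invGreen (lam : ℝ) (v : Fin N → ℝ) (z : ℂ) (a : Fin N)
    {T : Finset (Fin N)} {b : Fin N} (hb : b ∈ T) :
    IndepOf (rowCoords b) (invGreen lam v z a T) := by
  intro x y hxy
  have : removeRows T (ham lam v (hermitianOf x)) = removeRows T (ham lam v (hermitianOf y)) := by
    ext i j
    simp only [removeRows, Matrix.of_apply]
    split_ifs with h
    · rfl
    · rw [not_or] at h
      simp only [ham, Matrix.add_apply]
      rw [hermitianOf_congr (ne_of_mem_of_not_mem hb h.1).symm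
        (ne_of_mem_of_not_mem hb h.2).symm hxy]
  simp only [invGreen, greenMinor, this]

variable {Ω : Type*} [MeasurableSpace Ω] {P : Measure Ω} [IsProbabilityMeasure P]
  {C₀ θ : ℝ} {W : Ω → Matrix (Fin N) (Fin N) ℂ}

/-- The laws of the entries. -/
def entryLaw (P : Measure Ω) (W : Ω → Matrix (Fin N) (Fin N) ℂ) (p : UpperIndex N) : Measure ℂ :=
  P.map fun ω => W ω p.1.1 p.1.2

/-- The entries on and above the diagonal. -/
def upperEntries (W : Ω → Matrix (Fin N) (Fin N) ℂ) (ω : Ω) (p : UpperIndex N) : ℂ :=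
  W ω p.1.1 p.1.2

theorem isProbabilityMeasure_entryLaw (hW : IsWigner P C₀ θ W) (p : UpperIndex N) :
    IsProbabilityMeasure (entryLaw P W p) :=
  Measure.isProbabilityMeasure_map (hW.measurable _ _).aemeasurable

theorem measurePreserving_upperEntries (hW : IsWigner P C₀ θ W) :
    MeasurePreserving (upperEntries W) P (Measure.pi (entryLaw P W)) where
  measurable := measurable_pi_lambda _ fun p => hW.measurable p.1.1 p.1.2
  map_eq := (iIndepFun_iff_map_fun_eq_pi_map fun p : UpperIndex N =>
    (hW.measurable p.1.1 p.1.2).aemeasurable).1 hW.indep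

omit [IsProbabilityMeasure P] in
theorem hermitianOf_upperEntries (hW : IsWigner P C₀ θ W) (ω : Ω) :
    hermitianOf (upperEntries W ω) = W ω :=
  hermitianOf_upper (hW.hermitian ω)

theorem integral_upperEntries (hW : IsWigner P C₀ θ W) {E : Type*} [NormedAddCommGroup E]
    [NormedSpace ℝ E] {f : (UpperIndex N → ℂ) → E}
    (hf : AEStronglyMeasurable f (Measure.pi (entryLaw P W))) :
    ∫ ω, f (upperEntries W ω) ∂P = ∫ x, f x ∂(Measure.pi (entryLaw P W)) := by
  have hmp := measurePreserving_upperEntries hW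
  rw [← hmp.map_eq] at hf ⊢
  rw [integral_map hmp.measurable.aemeasurable hf]

/-- The bridge to product measures: replacing row `a` by an independent copy of `W` is resampling
`rowCoords a`, and the entries on and above the diagonal have a product law. -/
theorem fluct_hermitianOf (hW : IsWigner P C₀ θ W) (lam : ℝ) (v : Fin N → ℝ) (z : ℂ)
    (a : Fin N) (x : UpperIndex N → ℂ) :
    fluct P W lam v z a (hermitianOf x) =
      fluctOver (entryLaw P W) rowCoords {a} (invGreen lam v z a ∅) x := by
  have := fun p => isProbabilityMeasure_entryLaw hW p
  rw [fluctOver_singleton]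
  have h1 : ∀ y : UpperIndex N → ℂ,
      1 / green lam v (hermitianOf y) z a a = invGreen lam v z a ∅ y := fun y => by
    rw [invGreen, greenMinor_empty]
  have h2 : ∫ ω, 1 / green lam v (replaceRow a (hermitianOf x) (W ω)) z a a ∂P =
      avgOver (entryLaw P W) (rowCoords a) (invGreen lam v z a ∅) x := by
    rw [avgOver, ← integral_upperEntries hW]
    · congr 1
      funext ω
      rw [← h1, hermitianOf_mix, hermitianOf_upperEntries hW]
    · have hm : Measurable fun x' : UpperIndex N → ℂ => mix (rowCoords a) x x' := by
        refine measurable_pi_lambda _ fun i => ?_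
        simp only [mix]
        split_ifs
        · exact measurable_pi_apply i
        · exact measurable_const
      exact ((measurable_invGreen lam v z a ∅).comp hm).aestronglyMeasurable
  rw [fluct, partialExp, h1, h2]

theorem fluct_eq_fluctOver (hW : IsWigner P C₀ θ W) (lam : ℝ) (v : Fin N → ℝ) (z : ℂ)
    (a : Fin N) (ω : Ω) :
    fluct P W lam v z a (W ω) =
      fluctOver (entryLaw P W) rowCoords {a} (invGreen lam v z a ∅) (upperEntries W ω) := by
  rw [← fluct_hermitianOf hW, hermitianOf_upperEntries hW]

/-! ### Moments of the reciprocal Green function entries -/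

theorem integral_norm_entry_pow_le (hW : IsWigner P C₀ θ W) (hC₀ : 0 ≤ C₀) (hθ : 0 < θ)
    {n k : ℕ} (hk : θ * n ≤ k) (i j : Fin N) :
    Integrable (fun ω => ‖W ω i j‖ ^ n) P ∧ ∫ ω, ‖W ω i j‖ ^ n ∂P ≤ momentBound C₀ k := by
  have hN : 0 < N := i.pos
  have hs : 1 ≤ √(N : ℝ) := Real.one_le_sqrt.2 (by exact_mod_cast hN)
  have hm := (hW.measurable i j).norm
  obtain ⟨hI, hle⟩ := integral_pow_le_momentBound (P := P) hC₀ hθ (hm.const_mul (√(N : ℝ)))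
    (fun ω => by positivity) (hW.subexp i j) hk
  have hpt : ∀ ω, ‖W ω i j‖ ^ n ≤ (√(N : ℝ) * ‖W ω i j‖) ^ n := fun ω =>
    pow_le_pow_left₀ (norm_nonneg _) (le_mul_of_one_le_left (norm_nonneg _) hs) n
  have hI' : Integrable (fun ω => ‖W ω i j‖ ^ n) P :=
    hI.mono' (hm.pow_const n).aestronglyMeasurable (.of_forall fun ω => by
      rw [Real.norm_of_nonneg (by positivity)]
      exact hpt ω)
  exact ⟨hI', (integral_mono hI' hI hpt).trans hle⟩

/-- The bound `norm_inv_greenMinor_le` for the Green function entries, as a random variable. -/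
def rowBound (lam : ℝ) (z : ℂ) (a : Fin N) (M : Matrix (Fin N) (Fin N) ℂ) : ℝ :=
  2 * (∑ j, ‖M a j‖ ^ 2 + (|lam| + ‖z‖) ^ 2) / z.im

/-- A bound for the `n`-th moment of `rowBound`, where `k ≥ 2 θ n`. -/
def rowMomentBound (C₀ lam : ℝ) (z : ℂ) (N n k : ℕ) : ℝ :=
  (2 / z.im) ^ n * (2 ^ n * ((N : ℝ) ^ n * momentBound C₀ k + ((|lam| + ‖z‖) ^ 2) ^ n))

theorem integral_rowBound_pow_le (hW : IsWigner P C₀ θ W) (hC₀ : 0 ≤ C₀) (hθ : 0 < θ)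
    {lam : ℝ} {z : ℂ} (hz : 0 < z.im) {n k : ℕ} (hn : n ≠ 0) (hk : θ * (2 * n : ℕ) ≤ k)
    (a : Fin N) :
    Integrable (fun ω => rowBound lam z a (W ω) ^ n) P ∧
      ∫ ω, rowBound lam z a (W ω) ^ n ∂P ≤ rowMomentBound C₀ lam z N n k := by
  set c : ℝ := (|lam| + ‖z‖) ^ 2 with hc
  have hc0 : 0 ≤ c := by positivity
  have hent := fun j => integral_norm_entry_pow_le hW hC₀ hθ hk a j
  have hpt : ∀ ω, rowBound lam z a (W ω) ^ n ≤ (2 / z.im) ^ n *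
      (2 ^ n * ((N : ℝ) ^ (n - 1) * ∑ j, ‖W ω a j‖ ^ (2 * n) + c ^ n)) := by
    intro ω
    have h1 : (∑ j, ‖W ω a j‖ ^ 2) ^ n ≤ (N : ℝ) ^ (n - 1) * ∑ j, ‖W ω a j‖ ^ (2 * n) := by
      have h := norm_sum_pow_le Finset.univ (fun j => ((‖W ω a j‖ ^ 2 : ℝ) : ℂ)) hn
      rw [← Complex.ofReal_sum, Complex.norm_real,
        Real.norm_of_nonneg (Finset.sum_nonneg fun j _ => by positivity)] at h
      simpa [← pow_mul] using h
    have h2 : (∑ j, ‖W ω a j‖ ^ 2 + c) ^ n ≤ 2 ^ n * ((∑ j, ‖W ω a j‖ ^ 2) ^ n + c ^ n) := by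
      refine (add_pow_le (Finset.sum_nonneg fun j _ => by positivity) hc0 n).trans ?_
      gcongr
      · norm_num
      · omega
    have e : rowBound lam z a (W ω) = 2 / z.im * (∑ j, ‖W ω a j‖ ^ 2 + c) := by
      unfold rowBound; ring
    rw [e, mul_pow]
    gcongr
    exact h2.trans (by gcongr)
  have hI : Integrable (fun ω => (2 / z.im) ^ n *
      (2 ^ n * ((N : ℝ) ^ (n - 1) * ∑ j, ‖W ω a j‖ ^ (2 * n) + c ^ n))) P :=
    ((((integrable_finsetSum _ fun j _ => (hent j).1).const_mul _).add
      (integrable_const _)).const_mul _).const_mul _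
  have hm : Measurable fun ω => rowBound lam z a (W ω) := by
    unfold rowBound
    exact (((Finset.measurable_sum _ fun j _ => (hW.measurable a j).norm.pow_const 2).add_const
      _).const_mul 2).div_const _
  have hr0 : ∀ ω, 0 ≤ rowBound lam z a (W ω) := fun ω => by unfold rowBound; positivity
  have hI' : Integrable (fun ω => rowBound lam z a (W ω) ^ n) P :=
    hI.mono' (hm.pow_const n).aestronglyMeasurable (.of_forall fun ω => by
      rw [Real.norm_of_nonneg (pow_nonneg (hr0 ω) n)]
      exact hpt ω)
  refine ⟨hI', (integral_mono hI' hI hpt).trans ?_⟩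
  have hi := (integrable_finsetSum Finset.univ fun j _ => (hent j).1).const_mul
    ((N : ℝ) ^ (n - 1))
  rw [integral_const_mul, integral_const_mul, integral_add hi (integrable_const _),
    integral_const_mul, integral_finsetSum _ fun j _ => (hent j).1]
  simp only [integral_const, probReal_univ, one_smul, rowMomentBound]
  have : (N : ℝ) ^ (n - 1) * ∑ j, ∫ ω, ‖W ω a j‖ ^ (2 * n) ∂P ≤
      (N : ℝ) ^ n * momentBound C₀ k := by
    calc (N : ℝ) ^ (n - 1) * ∑ j, ∫ ω, ‖W ω a j‖ ^ (2 * n) ∂P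
        ≤ (N : ℝ) ^ (n - 1) * ∑ _j : Fin N, momentBound C₀ k := by
          gcongr with j
          exact (hent j).2
      _ = _ := by
          rw [Finset.sum_const, Finset.card_univ, Fintype.card_fin, nsmul_eq_mul, ← mul_assoc,
            pow_sub_one_mul hn]
  gcongr

theorem hasMoments_invGreen (hW : IsWigner P C₀ θ W) (hC₀ : 0 ≤ C₀) (hθ : 0 < θ)
    {lam : ℝ} {v : Fin N → ℝ} (hv : ∀ i, v i ∈ Set.Icc (-1 : ℝ) 1) {z : ℂ} (hz : 0 < z.im)
    (a : Fin N) (T : Finset (Fin N)) :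
    HasMoments (Measure.pi (entryLaw P W)) (invGreen lam v z a T) where
  measurable := measurable_invGreen lam v z a T
  integrable_pow n := by
    have hmp := measurePreserving_upperEntries hW
    have hm := (measurable_invGreen lam v z a T).norm.pow_const n
    rcases eq_or_ne n 0 with rfl | hn
    · have := fun p => isProbabilityMeasure_entryLaw hW p
      simp
    rw [← hmp.integrable_comp hm.aestronglyMeasurable]
    have hI := (integral_rowBound_pow_le hW hC₀ hθ (lam := lam) hz hn (Nat.le_ceil _) a).1
    refine hI.mono' (hm.comp hmp.measurable).aestronglyMeasurable (.of_forall fun ω => ?_)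
    simp only [Function.comp_apply, norm_pow, norm_norm]
    refine pow_le_pow_left₀ (norm_nonneg _) ?_ n
    rw [invGreen, hermitianOf_upperEntries hW]
    exact norm_inv_greenMinor_le lam hv (hW.hermitian ω) hz T a

end Wigner

/-! ### Fluctuation averaging for the Green function -/

section Averaging

open DeformedWigner Matrix

variable {N : ℕ} {Ω : Type*} [MeasurableSpace Ω] {P : Measure Ω} [IsProbabilityMeasure P]
  {C₀ θ : ℝ} {W : Ω → Matrix (Fin N) (Fin N) ℂ}

/-- The control parameters `X` and `Y` of the Green function on an event `E`. -/
structure Control (P : Measure Ω) (W : Ω → Matrix (Fin N) (Fin N) ℂ) (lam : ℝ) (v : Fin N → ℝ)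
    (z : ℂ) (A : Finset (Fin N)) (E : Set Ω) (X Y : ℝ) : Prop where
  fraction_le : ∀ ω ∈ E, ∀ a ∈ A, ∀ a' ∈ A, a ≠ a' →
    ‖fraction ∅ ∅ lam v (W ω) z a a'‖ ≤ Y
  fraction_div_le : ∀ ω ∈ E, ∀ a ∈ A, ∀ a' ∈ A, a ≠ a' →
    ‖fraction ∅ {a} lam v (W ω) z a a' / green lam v (W ω) z a a‖ ≤ X
  fluct_le : ∀ ω ∈ E, ∀ a ∈ A, ‖fluct P W lam v z a (W ω)‖ ≤ X

variable {lam : ℝ} {v : Fin N → ℝ} {z : ℂ} {A : Finset (Fin N)} {E : Set Ω} {X Y δ : ℝ}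

theorem integral_norm_fluctOver_singleton_le (hW : IsWigner P C₀ θ W) (hC₀ : 0 ≤ C₀)
    (hθ : 0 < θ) (hv : ∀ i, v i ∈ Set.Icc (-1 : ℝ) 1) (hz : 0 < z.im)
    (hE : Control P W lam v z A E X Y) (hX : 0 ≤ X) (hδ : P.real Eᶜ ≤ δ) {n k : ℕ} (hn : n ≠ 0)
    (hk : θ * (2 * (2 * n) : ℕ) ≤ k) {a : Fin N} (ha : a ∈ A) :
    ∫ x, ‖fluctOver (entryLaw P W) rowCoords {a} (invGreen lam v z a ∅) x‖ ^ n
        ∂(Measure.pi (entryLaw P W)) ≤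
      X ^ n + 2 ^ n * (√δ * √(rowMomentBound C₀ lam z N (2 * n) k)) := by
  have := fun p => isProbabilityMeasure_entryLaw hW p
  have hf := hasMoments_invGreen hW hC₀ hθ (lam := lam) hv hz a ∅
  have hq := hf.fluctOver (entryLaw P W) rowCoords {a}
  have hmp := measurePreserving_upperEntries hW
  obtain ⟨hRI, hR⟩ := integral_rowBound_pow_le hW hC₀ hθ (lam := lam) hz (n := 2 * n)
    (by omega) hk a
  set V := rowMomentBound C₀ lam z N (2 * n) k
  rw [← integral_upperEntries hW (hq.integrable_pow n).aestronglyMeasurable]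
  have hV : ∫ ω, ‖fluctOver (entryLaw P W) rowCoords {a} (invGreen lam v z a ∅)
      (upperEntries W ω)‖ ^ (2 * n) ∂P ≤ (2 ^ n) ^ 2 * V := by
    rw [integral_upperEntries hW (hq.integrable_pow (2 * n)).aestronglyMeasurable]
    refine (integral_norm_fluctOver_pow_le _ _ _ hf (by omega)).trans ?_
    rw [Finset.card_singleton, pow_one, ← pow_mul, mul_comm n 2,
      ← integral_upperEntries hW (hf.integrable_pow (2 * n)).aestronglyMeasurable]
    gcongr
    refine (integral_mono (hf.comp hmp |>.integrable_pow _) hRI fun ω => ?_).trans hR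
    refine pow_le_pow_left₀ (norm_nonneg _) ?_ _
    rw [invGreen, hermitianOf_upperEntries hW]
    exact norm_inv_greenMinor_le lam hv (hW.hermitian ω) hz ∅ a
  refine (integral_norm_pow_le_of_event (hq.comp hmp) hX (fun ω hω => ?_) hδ hV).trans
    (le_of_eq ?_)
  · rw [← fluct_eq_fluctOver hW]
    exact hE.fluct_le ω hω a ha
  · rw [Real.sqrt_mul (by positivity), Real.sqrt_sq (by positivity)]
    ring

/-- The minors are subtracted before norms are taken. On `E` the alternating sum is small, and off
`E` its `2^|S|` terms all obey the same deterministic row bound. -/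
theorem integral_norm_fluctOver_insert_le (hW : IsWigner P C₀ θ W) (hC₀ : 0 ≤ C₀)
    (hθ : 0 < θ) (hv : ∀ i, v i ∈ Set.Icc (-1 : ℝ) 1) (hz : 0 < z.im)
    (hE : Control P W lam v z A E X Y) (hX : 0 ≤ X) (hY : 0 ≤ Y) (hδ : P.real Eᶜ ≤ δ)
    {n k : ℕ} (hn : n ≠ 0) (hk : θ * (2 * (2 * n) : ℕ) ≤ k) {S : Finset (Fin N)} (hSA : S ⊆ A)
    (hS : S.Nonempty) {l : ℝ} (hl : (S.card : ℝ) + 1 ≤ l) (hlY : l * Y ≤ 1 / 2) {a : Fin N}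
    (ha : a ∈ A \ S) :
    ∫ x, ‖fluctOver (entryLaw P W) rowCoords (insert a S) (invGreen lam v z a ∅) x‖ ^ n
        ∂(Measure.pi (entryLaw P W)) ≤
      (2 ^ (S.card + 1)) ^ n * ((2 ^ S.card * (2 * l * (2 * X) * (l * Y) ^ S.card)) ^ n +
        (2 ^ S.card) ^ n * (√δ * √(rowMomentBound C₀ lam z N (2 * n) k))) := by
  have := fun p => isProbabilityMeasure_entryLaw hW p
  have hf := hasMoments_invGreen hW hC₀ hθ (lam := lam) hv hz a
  have hmp := measurePreserving_upperEntries hW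
  obtain ⟨haA, haS⟩ := Finset.mem_sdiff.1 ha
  have hcard : (insert a S).card = S.card + 1 := Finset.card_insert_of_notMem haS
  obtain ⟨hRI, hR⟩ := integral_rowBound_pow_le hW hC₀ hθ (lam := lam) hz (n := 2 * n)
    (by omega) hk a
  set V := rowMomentBound C₀ lam z N (2 * n) k
  set D : (UpperIndex N → ℂ) → ℂ :=
    fun y => ∑ T ∈ S.powerset, (-1) ^ T.card * invGreen lam v z a T y with hD
  have hDm : HasMoments (Measure.pi (entryLaw P W)) D :=
    HasMoments.sum _ fun T _ => (hf T).const_mul _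
  have hae := fluctOver_ae_eq_fluctOver_alternating (entryLaw P W) rowCoords
    (Finset.subset_insert a S) (h := fun T => invGreen lam v z a T) (fun T _ => hf T)
    fun T _ b hb => indepOf_invGreen lam v z a hb
  have hval : ∀ ω T, invGreen lam v z a T (upperEntries W ω) =
      1 / greenMinor T lam v (W ω) z a a := fun ω T => by
    rw [invGreen, hermitianOf_upperEntries hW]
  calc ∫ x, ‖fluctOver (entryLaw P W) rowCoords (insert a S) (invGreen lam v z a ∅) x‖ ^ n
        ∂(Measure.pi (entryLaw P W))
      = ∫ x, ‖fluctOver (entryLaw P W) rowCoords (insert a S) D x‖ ^ n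
        ∂(Measure.pi (entryLaw P W)) := by
        refine integral_congr_ae ?_
        filter_upwards [hae] with x hx
        rw [hx]
    _ ≤ (2 ^ (S.card + 1)) ^ n * ∫ x, ‖D x‖ ^ n ∂(Measure.pi (entryLaw P W)) := by
        have := integral_norm_fluctOver_pow_le (entryLaw P W) rowCoords (insert a S) hDm hn
        rwa [hcard] at this
    _ ≤ _ := by
        gcongr
        rw [← integral_upperEntries hW (hDm.integrable_pow n).aestronglyMeasurable]
        have hV : ∫ ω, ‖D (upperEntries W ω)‖ ^ (2 * n) ∂P ≤ ((2 ^ S.card) ^ n) ^ 2 * V := by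
          calc ∫ ω, ‖D (upperEntries W ω)‖ ^ (2 * n) ∂P
              ≤ ∫ ω, (2 ^ S.card) ^ (2 * n) * rowBound lam z a (W ω) ^ (2 * n) ∂P := by
                refine integral_mono (hDm.comp hmp |>.integrable_pow _) (hRI.const_mul _)
                  fun ω => ?_
                rw [← mul_pow]
                refine pow_le_pow_left₀ (norm_nonneg _) ?_ _
                refine (norm_sum_le _ _).trans ((Finset.sum_le_sum (g := fun _ =>
                  rowBound lam z a (W ω)) fun T _ => ?_).trans ?_)
                · rw [norm_mul, norm_pow, norm_neg, norm_one, one_pow, one_mul, hval]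
                  exact norm_inv_greenMinor_le lam hv (hW.hermitian ω) hz T a
                · rw [Finset.sum_const, Finset.card_powerset, nsmul_eq_mul]
                  push_cast
                  exact le_rfl
            _ ≤ (2 ^ S.card) ^ (2 * n) * V := by
                rw [integral_const_mul]
                gcongr
            _ = _ := by rw [← pow_mul _ n 2, mul_comm n 2]
        refine (integral_norm_pow_le_of_event (hDm.comp hmp)
          (b := 2 ^ S.card * (2 * l * (2 * X) * (l * Y) ^ S.card)) ?_ (fun ω hω => ?_) hδ
          hV).trans (le_of_eq ?_)
        · have : 0 ≤ l := le_trans (by positivity) hl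
          positivity
        · have hmem : ∀ i ∈ insert a S, i ∈ A := fun i hi => by
            rcases Finset.mem_insert.1 hi with rfl | h
            · exact haA
            · exact hSA h
          have hres := norm_alternating_sum_minor_le (isHermitian_ham lam v (hW.hermitian ω)) hz
            haS hS hY hX (by rw [hcard]; push_cast; exact hl) hlY ?_ ?_
          · simp only [hD, hval]
            exact hres
          · intro i hi j hj hij
            have := hE.fraction_le ω hω i (hmem i hi) j (hmem j hj) hij
            simpa only [fraction, greenMinor_empty, green] using this
          · intro j hj
            have := hE.fraction_div_le ω hω a haA j (hSA hj)
              (ne_of_mem_of_not_mem hj haS).symm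
            rw [fraction, greenMinor_empty] at this
            exact this
        · rw [Real.sqrt_mul (by positivity), Real.sqrt_sq (by positivity)]
          ring

theorem fluctMean_empty_eq (hW : IsWigner P C₀ θ W) (lam : ℝ) (v : Fin N → ℝ) (z : ℂ)
    (A : Finset (Fin N)) (ω : Ω) :
    fluctMean (entryLaw P W) rowCoords A (1 / (N : ℝ)) (fun a => invGreen lam v z a ∅) ∅
      (upperEntries W ω) = 1 / (N : ℂ) * ∑ i ∈ A, fluct P W lam v z i (W ω) := by
  unfold fluctMean
  rw [Finset.sdiff_empty]
  push_cast
  congr 1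
  refine Finset.sum_congr rfl fun a _ => ?_
  rw [fluct_eq_fluctOver hW, insert_empty_eq]

theorem integrable_norm_mean_fluct_pow (hW : IsWigner P C₀ θ W) (hC₀ : 0 ≤ C₀)
    (hθ : 0 < θ) (hv : ∀ i, v i ∈ Set.Icc (-1 : ℝ) 1) (hz : 0 < z.im) (A : Finset (Fin N))
    (n : ℕ) :
    Integrable (fun ω => ‖1 / (N : ℂ) * ∑ i ∈ A, fluct P W lam v z i (W ω)‖ ^ n) P := by
  have := fun p => isProbabilityMeasure_entryLaw hW p
  have hm := HasMoments.fluctMean (entryLaw P W) rowCoords (A := A) (w := 1 / (N : ℝ))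
    (f := fun a => invGreen lam v z a ∅) (fun a _ => hasMoments_invGreen hW hC₀ hθ hv hz a ∅) ∅
  have := (hm.comp (measurePreserving_upperEntries hW)).integrable_pow n
  simpa only [fluctMean_empty_eq hW] using this

theorem integral_norm_mean_fluct_eq (hW : IsWigner P C₀ θ W) (hC₀ : 0 ≤ C₀)
    (hθ : 0 < θ) (hv : ∀ i, v i ∈ Set.Icc (-1 : ℝ) 1) (hz : 0 < z.im) (A : Finset (Fin N))
    (n : ℕ) :
    ∫ ω, ‖1 / (N : ℂ) * ∑ i ∈ A, fluct P W lam v z i (W ω)‖ ^ n ∂P =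
      ∫ x, ‖fluctMean (entryLaw P W) rowCoords A (1 / (N : ℝ)) (fun a => invGreen lam v z a ∅) ∅
        x‖ ^ n ∂(Measure.pi (entryLaw P W)) := by
  have := fun p => isProbabilityMeasure_entryLaw hW p
  have hm := HasMoments.fluctMean (entryLaw P W) rowCoords (A := A) (w := 1 / (N : ℝ))
    (f := fun a => invGreen lam v z a ∅) (fun a _ => hasMoments_invGreen hW hC₀ hθ hv hz a ∅) ∅
  rw [← integral_upperEntries hW (hm.integrable_pow n).aestronglyMeasurable]
  simp only [fluctMean_empty_eq hW]

theorem one_div_mul_card_le_one (A : Finset (Fin N)) : 1 / (N : ℝ) * A.card ≤ 1 := by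
  rcases Nat.eq_zero_or_pos N with rfl | hN
  · simp
  · have h : (A.card : ℝ) ≤ N := by exact_mod_cast A.card_le_univ.trans (by simp)
    rw [one_div, inv_mul_le_iff₀ (by positivity)]
    linarith

/-- No cancellation between different `a` is used; it serves when `Y` need not be small. -/
theorem integral_norm_mean_fluct_le_of_trivial (hW : IsWigner P C₀ θ W) (hC₀ : 0 ≤ C₀)
    (hθ : 0 < θ) (hv : ∀ i, v i ∈ Set.Icc (-1 : ℝ) 1) (hz : 0 < z.im)
    (hE : Control P W lam v z A E X Y) (hX : 0 ≤ X) (hδ : P.real Eᶜ ≤ δ) {n k : ℕ} (hn : n ≠ 0)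
    (hk : θ * (2 * (2 * n) : ℕ) ≤ k)
    (hsmall : 2 ^ n * (√δ * √(rowMomentBound C₀ lam z N (2 * n) k)) ≤ X ^ n) :
    ∫ ω, ‖1 / (N : ℂ) * ∑ i ∈ A, fluct P W lam v z i (W ω)‖ ^ n ∂P ≤ (2 * X) ^ n := by
  have := fun p => isProbabilityMeasure_entryLaw hW p
  rw [integral_norm_mean_fluct_eq hW hC₀ hθ hv hz]
  refine integral_norm_fluctMean_pow_le_of_forall _ _
    (fun a _ => hasMoments_invGreen hW hC₀ hθ hv hz a ∅) (by positivity)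
    (one_div_mul_card_le_one A) hn (by positivity) fun a ha => ?_
  rw [insert_empty_eq]
  refine (integral_norm_fluctOver_singleton_le hW hC₀ hθ hv hz hE hX hδ hn hk
    (Finset.sdiff_subset ha)).trans ?_
  calc _ ≤ X ^ n + X ^ n := by gcongr
    _ = 2 ^ 1 * X ^ n := by ring
    _ ≤ 2 ^ n * X ^ n := by gcongr <;> [norm_num; omega]
    _ = _ := (mul_pow _ _ _).symm

/-- In `y = 4(n+1)Y`, one factor `2` per row comes from the fluctuation operator and one from the
number of minors; `n + 1` bounds the size of each linear system. By `hsmall` at the deepest level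
`n`, the bad event is negligible for every `|S| ≤ n`. -/
theorem integral_norm_mean_fluct_le (hW : IsWigner P C₀ θ W) (hC₀ : 0 ≤ C₀)
    (hθ : 0 < θ) (hv : ∀ i, v i ∈ Set.Icc (-1 : ℝ) 1) (hz : 0 < z.im)
    (hE : Control P W lam v z A E X Y) (hX : 0 < X) (hY : 0 < Y) (hδ : P.real Eᶜ ≤ δ)
    (s n : ℕ) {k : ℕ} (hk : θ * (2 * (2 * (2 * s + 2)) : ℕ) ≤ k) {y : ℝ}
    (hy : y = 4 * (n + 1) * Y) (hy1 : y ≤ 1) (hNy : 1 / (N : ℝ) ≤ y ^ 2)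
    (hsy : 48 * (2 * s + 2) * √y ≤ 1)
    (hsmall : (2 ^ (n + 1)) ^ (2 * s + 2) *
      (√δ * √(rowMomentBound C₀ lam z N (2 * (2 * s + 2)) k)) ≤
        (X * (y / 2) ^ n) ^ (2 * s + 2)) :
    ∫ ω, ‖1 / (N : ℂ) * ∑ i ∈ A, fluct P W lam v z i (W ω)‖ ^ (2 * s + 2) ∂P ≤
      ((24 * (2 * s + 2)) ^ 2 * (16 * (n + 1) * X) * gain y n) ^ (2 * s + 2) := by
  have := fun p => isProbabilityMeasure_entryLaw hW p
  rw [integral_norm_mean_fluct_eq hW hC₀ hθ hv hz]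
  have hn0 : (0 : ℝ) ≤ n := Nat.cast_nonneg n
  have hy0 : 0 < y := by rw [hy]; positivity
  set p := 2 * s + 2 with hp
  have hp0 : p ≠ 0 := by omega
  set V := rowMomentBound C₀ lam z N (2 * p) k
  have main := integral_norm_fluctMean_pow_le_gain (entryLaw P W) rowCoords (A := A)
    (w := 1 / (N : ℝ)) (f := fun a => invGreen lam v z a ∅)
    (fun a _ => hasMoments_invGreen hW hC₀ hθ hv hz a ∅) (by positivity)
    (one_div_mul_card_le_one A) s n (X := 16 * (n + 1) * X) (y := y) (by positivity) hy0 hy1 hNy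
    hsy ?_ n le_rfl ∅ (Finset.empty_subset A) (by simp)
  · simpa using main
  · intro S hSA hSn a ha
    have hSn' : (S.card : ℝ) ≤ n := by exact_mod_cast hSn
    have hpow : ∀ m : ℕ, m ≤ n + 1 → (2 ^ m) ^ p * (√δ * √V) ≤ (X * (y / 2) ^ S.card) ^ p := by
      intro m hm
      calc (2 ^ m) ^ p * (√δ * √V) ≤ (2 ^ (n + 1)) ^ p * (√δ * √V) := by
            gcongr
            norm_num
        _ ≤ (X * (y / 2) ^ n) ^ p := hsmall
        _ ≤ _ := by
            gcongr ?_ ^ _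
            gcongr X * ?_
            exact pow_le_pow_of_le_one (by positivity) (by linarith) hSn
    rcases S.eq_empty_or_nonempty with rfl | hS
    · rw [insert_empty_eq]
      refine (integral_norm_fluctOver_singleton_le hW hC₀ hθ hv hz hE hX.le hδ hp0 hk
        (Finset.sdiff_subset ha)).trans ?_
      have h1 := hpow 1 (by omega)
      rw [pow_one, Finset.card_empty, pow_zero, mul_one] at h1
      calc _ ≤ X ^ p + X ^ p := by gcongr
        _ = 2 ^ 1 * X ^ p := by ring
        _ ≤ 2 ^ p * X ^ p := by gcongr <;> [norm_num; omega]
        _ = (2 * X) ^ p := (mul_pow _ _ _).symm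
        _ ≤ _ := by
            rw [Finset.card_empty, pow_zero, mul_one]
            gcongr
            linarith
    · refine (integral_norm_fluctOver_insert_le hW hC₀ hθ hv hz hE hX.le hY.le hδ hp0 hk hSA hS
        (l := n + 1) (by linarith) (by linarith) ha).trans ?_
      have h1 := hpow S.card (by omega)
      have e : 2 ^ S.card * (2 * ((n : ℝ) + 1) * (2 * X) * (((n : ℝ) + 1) * Y) ^ S.card) =
          4 * (n + 1) * X * (y / 2) ^ S.card := by
        rw [hy, show 4 * ((n : ℝ) + 1) * Y / 2 = 2 * ((n + 1) * Y) by ring, mul_pow 2]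
        ring
      rw [e]
      have h2 : (X * (y / 2) ^ S.card) ^ p ≤ (4 * (n + 1) * X * (y / 2) ^ S.card) ^ p := by
        gcongr
        nlinarith
      calc (2 ^ (S.card + 1)) ^ p * ((4 * (n + 1) * X * (y / 2) ^ S.card) ^ p +
            (2 ^ S.card) ^ p * (√δ * √V))
          ≤ (2 ^ (S.card + 1)) ^ p * ((4 * (n + 1) * X * (y / 2) ^ S.card) ^ p +
            (4 * (n + 1) * X * (y / 2) ^ S.card) ^ p) := by
            gcongr
            exact h1.trans h2
        _ = 2 ^ 1 * ((2 ^ (S.card + 1)) ^ p * (4 * (n + 1) * X * (y / 2) ^ S.card) ^ p) := by ring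
        _ ≤ 2 ^ p * ((2 ^ (S.card + 1)) ^ p * (4 * (n + 1) * X * (y / 2) ^ S.card) ^ p) := by
            gcongr <;> [norm_num; omega]
        _ = (16 * (n + 1) * X * y ^ S.card) ^ p := by
            rw [← mul_pow, ← mul_pow, div_pow]
            congr 1
            field_simp
            ring

end Averaging

/-! ### Asymptotics -/

section Asymptotics

open DeformedWigner Filter

theorem momentBound_le_pow {C₀ x : ℝ} (hC₀ : 0 ≤ C₀) (hx2 : 2 ≤ x)
    (hxκ : 1 + expMomentBound C₀ ≤ x) {k : ℕ} (hk : (k : ℝ) ≤ x ^ 2) :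
    momentBound C₀ k ≤ x ^ (3 * k + 1) := by
  have hκ := expMomentBound_pos hC₀
  have hx0 : 0 < x := by linarith
  have h1 : (k.factorial : ℝ) ≤ (x ^ 2) ^ k :=
    le_trans (by exact_mod_cast Nat.factorial_le_pow k) (pow_le_pow_left₀ (by positivity) hk k)
  have h2 : (1 : ℝ) ≤ x ^ (3 * k) := one_le_pow₀ (by linarith)
  calc momentBound C₀ k ≤ 1 + x ^ k * (x ^ 2) ^ k * expMomentBound C₀ := by
        unfold momentBound; gcongr
    _ = 1 + x ^ (3 * k) * expMomentBound C₀ := by rw [← mul_pow]; ring_nf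
    _ ≤ x ^ (3 * k) * (1 + expMomentBound C₀) := by nlinarith
    _ ≤ x ^ (3 * k) * x := by gcongr
    _ = _ := (pow_succ _ _).symm

/-- Crude power counting in `N`: `2 / Im z ≤ N^{2+ε}`, `|λ| + |z| ≤ N^{1+ε}`, and `k ≤ 5θp` makes
the entry moments at most `N^{16θp}`. Only linearity of the exponent in `p` matters. -/
theorem rowMomentBound_le {C₀ θ lam ε : ℝ} (hC₀ : 0 ≤ C₀) (hθ : 1 < θ) (hlam : 0 < lam)
    (hε : 0 < ε) {N p : ℕ} (hN2 : 2 ≤ N) (hNθ : 5 * θ ≤ N) (hNκ : 1 + expMomentBound C₀ ≤ N)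
    (hNlam : 4 + 2 * lam ≤ N) (hp1 : 1 ≤ p) (hpN : (p : ℝ) ≤ N) {z : ℂ} (hz : 0 < z.im)
    (hre : |z.re| ≤ 3 + lam) (him : (N : ℝ) ^ (-(1 / 2) - ε) ≤ z.im)
    (him' : z.im ≤ (N : ℝ) ^ ε) :
    rowMomentBound C₀ lam z N (2 * p) ⌈θ * (2 * (2 * p) : ℕ)⌉₊ ≤
      (N : ℝ) ^ ((13 + 6 * ε + 16 * θ) * p) := by
  set x : ℝ := (N : ℝ) with hx
  have hx2 : 2 ≤ x := by rw [hx]; exact_mod_cast hN2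
  have hx0 : 0 < x := by linarith
  have hx1 : 1 ≤ x := by linarith
  have hp1' : (1 : ℝ) ≤ p := by exact_mod_cast hp1
  set k := ⌈θ * (2 * (2 * p) : ℕ)⌉₊ with hk
  have hkle : (k : ℝ) ≤ 5 * θ * p := by
    have := (Nat.ceil_lt_add_one (a := θ * (2 * (2 * p) : ℕ)) (by positivity)).le
    push_cast at this
    rw [hk]
    push_cast
    nlinarith
  have hkx : (k : ℝ) ≤ x ^ 2 := by nlinarith
  have hη : 2 / z.im ≤ x ^ (2 + ε) := by
    have h1 : 0 < x ^ (-(1 / 2) - ε) := by positivity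
    calc 2 / z.im ≤ x / x ^ (-(1 / 2) - ε) := by gcongr
      _ = x ^ (1 - (-(1 / 2) - ε)) := by rw [Real.rpow_sub hx0 1, Real.rpow_one]
      _ ≤ x ^ (2 + ε) := Real.rpow_le_rpow_of_exponent_le hx1 (by linarith)
  have hzn : |lam| + ‖z‖ ≤ x ^ (1 + ε) := by
    have h1 : ‖z‖ ≤ |z.re| + |z.im| := Complex.norm_le_abs_re_add_abs_im z
    rw [abs_of_pos hz] at h1
    rw [abs_of_pos hlam]
    have h2 : 1 ≤ x ^ ε := Real.one_le_rpow hx1 hε.le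
    calc lam + ‖z‖ ≤ (4 + 2 * lam) * x ^ ε := by nlinarith
      _ ≤ x * x ^ ε := by gcongr
      _ = _ := by rw [Real.rpow_add hx0, Real.rpow_one]
  have hm : momentBound C₀ k ≤ x ^ (16 * θ * p) := by
    refine (momentBound_le_pow hC₀ hx2 hNκ hkx).trans ?_
    rw [← Real.rpow_natCast]
    refine Real.rpow_le_rpow_of_exponent_le hx1 ?_
    push_cast
    nlinarith
  have hm0 : 0 ≤ momentBound C₀ k := zero_le_one.trans (one_le_momentBound hC₀ k)
  have e1 : ∀ u : ℝ, (x ^ u) ^ (2 * p) = x ^ (2 * u * p) := fun u => by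
    rw [← Real.rpow_natCast, ← Real.rpow_mul hx0.le]; push_cast; ring_nf
  have e2 : x ^ (2 * p) = x ^ (2 * p : ℝ) := by rw [← Real.rpow_natCast]; push_cast; rfl
  have e3 : ((x ^ (1 + ε)) ^ 2) ^ (2 * p) = x ^ (4 * (1 + ε) * p) := by
    rw [← pow_mul, ← Real.rpow_natCast, ← Real.rpow_mul hx0.le]; push_cast; ring_nf
  calc rowMomentBound C₀ lam z N (2 * p) k
      ≤ (x ^ (2 + ε)) ^ (2 * p) * (x ^ (2 * p) * (x ^ (2 * p) * x ^ (16 * θ * p) +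
          ((x ^ (1 + ε)) ^ 2) ^ (2 * p))) := by
        unfold rowMomentBound
        gcongr
    _ ≤ x ^ (2 * (2 + ε) * p) * (x ^ (2 * p : ℝ) *
          (x ^ ((6 + 16 * θ + 4 * ε) * p) + x ^ ((6 + 16 * θ + 4 * ε) * p))) := by
        rw [e1, e2, e3, ← Real.rpow_add hx0]
        gcongr ?_ * (?_ * (?_ + ?_))
        · exact Real.rpow_le_rpow_of_exponent_le hx1 (by nlinarith)
        · exact Real.rpow_le_rpow_of_exponent_le hx1 (by nlinarith)
    _ = 2 * x ^ ((12 + 6 * ε + 16 * θ) * p) := by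
        rw [← two_mul, mul_left_comm (x ^ (2 * p : ℝ)), mul_left_comm _ (2 : ℝ),
          ← Real.rpow_add hx0, ← Real.rpow_add hx0]
        ring_nf
    _ ≤ x ^ (p : ℝ) * x ^ ((12 + 6 * ε + 16 * θ) * p) := by
        gcongr
        exact hx2.trans (by simpa using Real.rpow_le_rpow_of_exponent_le hx1 hp1')
    _ = _ := by rw [← Real.rpow_add hx0]; ring_nf

/-- Source of the restriction on `p`: `p ≤ (log N)^{ξ-3/2}` gives `p log N √(log N) ≤ (log N)^ξ`.
The spare `√(log N)` beats `D + 2n + 2`, which for the chosen depth is of order `log log N`. -/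
theorem bad_event_contribution_le {x ν ξ D V : ℝ} {p n : ℕ} (hx2 : 2 ≤ x)
    (hL : 1 ≤ Real.log x) (hD : 0 ≤ D) (hp : (p : ℝ) ≤ Real.log x ^ (ξ - 3 / 2))
    (hV : V ≤ x ^ (D * p)) (hn : D + 2 * n + 2 ≤ ν / 2 * √(Real.log x)) :
    (2 ^ (n + 1)) ^ p * (√(Real.exp (-ν * Real.log x ^ ξ)) * √V) ≤
      (x ^ (-(1 + n : ℝ))) ^ p := by
  have hx0 : 0 < x := by linarith
  set L := Real.log x with hLdef
  have hL0 : 0 < L := by linarith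
  have hVs : √V ≤ x ^ (D * p) := by
    have h1 : 1 ≤ x ^ (D * p) := Real.one_le_rpow (by linarith) (by positivity)
    exact Real.sqrt_le_iff.2 ⟨by positivity, by nlinarith⟩
  have h2 : ((2 : ℝ) ^ (n + 1)) ^ p ≤ x ^ ((n + 1 : ℝ) * p) := by
    calc ((2 : ℝ) ^ (n + 1)) ^ p ≤ (x ^ (n + 1)) ^ p := by gcongr
      _ = _ := by
        rw [← pow_mul, ← Real.rpow_natCast]; push_cast; rfl
  have hpL : p * L * √L ≤ L ^ ξ := by
    calc p * L * √L ≤ L ^ (ξ - 3 / 2) * L * √L := by gcongr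
      _ = L ^ (ξ - 3 / 2 + 1 + 1 / 2) := by
        rw [Real.rpow_add hL0, Real.rpow_add hL0, Real.rpow_one, Real.sqrt_eq_rpow]
      _ = L ^ ξ := by ring_nf
  rw [← Real.exp_half, ← Real.rpow_natCast (x ^ _) p, ← Real.rpow_mul hx0.le]
  calc _ ≤ x ^ ((n + 1 : ℝ) * p) * (Real.exp (-ν * L ^ ξ / 2) * x ^ (D * p)) := by gcongr
    _ = Real.exp (L * ((n + 1 : ℝ) * p) + (-ν * L ^ ξ / 2 + L * (D * p))) := by
        rw [Real.rpow_def_of_pos hx0, Real.rpow_def_of_pos hx0, ← Real.exp_add, ← Real.exp_add]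
    _ ≤ Real.exp (L * (-(1 + n : ℝ) * p)) := by
        apply Real.exp_le_exp.2
        have h3 : (D + 2 * n + 2) * (p * L) ≤ ν / 2 * √L * (p * L) := by gcongr
        have hs : 0 ≤ √L := Real.sqrt_nonneg L
        have hν : 0 ≤ ν := by
          have : 0 ≤ ν / 2 * √L := le_trans (by positivity) hn
          have hs' : 0 < √L := Real.sqrt_pos.2 hL0
          nlinarith
        have h4 : ν / 2 * (p * L * √L) ≤ ν / 2 * L ^ ξ := by gcongr
        nlinarith
    _ = _ := by rw [Real.rpow_def_of_pos hx0]

theorem tendsto_log_natCast : Tendsto (fun N : ℕ => Real.log N) atTop atTop :=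
  Real.tendsto_log_atTop.comp tendsto_natCast_atTop_atTop

theorem eventually_mul_sq_log_add_le (c₁ c₂ : ℝ) {τ : ℝ} (hτ : 0 < τ) :
    ∀ᶠ N : ℕ in atTop, c₁ * Real.log (Real.log N) ^ 2 + c₂ ≤ τ * Real.log N := by
  have h : ∀ᶠ L : ℝ in atTop, c₁ * Real.log L ^ 2 + c₂ ≤ τ * L := by
    have hc : 0 < τ / 2 / (|c₁| + 1) := by positivity
    filter_upwards [(Asymptotics.isLittleO_iff.1 (Real.isLittleO_pow_log_id_atTop (n := 2))) hc,
      eventually_ge_atTop (2 * c₂ / τ), eventually_ge_atTop 0] with L h1 h2 h3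
    rw [Real.norm_of_nonneg (sq_nonneg _), id, Real.norm_of_nonneg h3] at h1
    have h4 : c₁ * Real.log L ^ 2 ≤ τ / 2 * L := by
      calc c₁ * Real.log L ^ 2 ≤ (|c₁| + 1) * (τ / 2 / (|c₁| + 1) * L) :=
            mul_le_mul ((le_abs_self _).trans (by linarith)) h1 (sq_nonneg _) (by positivity)
        _ = _ := by field_simp
    rw [div_le_iff₀ hτ] at h2
    linarith
  exact tendsto_log_natCast.eventually h

theorem eventually_mul_log_add_le_sqrt (c₁ c₂ : ℝ) {τ : ℝ} (hτ : 0 < τ) :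
    ∀ᶠ N : ℕ in atTop, c₁ * Real.log (Real.log N) + c₂ ≤ τ * √(Real.log N) := by
  have h : ∀ᶠ L : ℝ in atTop, c₁ * Real.log L + c₂ ≤ τ * √L := by
    have hc : 0 < τ / 2 / (|c₁| + 1) := by positivity
    filter_upwards [(Asymptotics.isLittleO_iff.1 (isLittleO_log_rpow_atTop (r := 1 / 2) (by norm_num))) hc,
      Real.tendsto_sqrt_atTop.eventually_ge_atTop (2 * c₂ / τ), eventually_ge_atTop 1]
      with L h1 h2 h3
    rw [Real.norm_of_nonneg (Real.log_nonneg h3), ← Real.sqrt_eq_rpow,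
      Real.norm_of_nonneg (Real.sqrt_nonneg _)] at h1
    have h4 : c₁ * Real.log L ≤ τ / 2 * √L := by
      calc c₁ * Real.log L ≤ (|c₁| + 1) * (τ / 2 / (|c₁| + 1) * √L) :=
            mul_le_mul ((le_abs_self _).trans (by linarith)) h1 (Real.log_nonneg h3)
              (by positivity)
        _ = _ := by field_simp
    rw [div_le_iff₀ hτ] at h2
    linarith
  exact tendsto_log_natCast.eventually h

/-- The target is a `p`-th power, so it suffices to compare bases. -/
theorem rpow_bound_eq_pow {C c φ c₀ ξ x β ε : ℝ} (hC : 0 ≤ C) (hφ : 0 ≤ φ) (hx : 0 < x) (p : ℕ) :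
    (C * p) ^ (c * p) * φ ^ (c₀ * p * ξ) * x ^ (-(p : ℝ) / 2 - p * β / 2) * x ^ (3 * p * ε) =
      ((C * p) ^ c * φ ^ (c₀ * ξ) * x ^ (-(1 / 2) - β / 2) * x ^ (3 * ε)) ^ p := by
  rw [mul_pow, mul_pow, mul_pow, ← Real.rpow_natCast, ← Real.rpow_natCast (φ ^ (c₀ * ξ)),
    ← Real.rpow_natCast (x ^ (-(1 / 2) - β / 2)), ← Real.rpow_natCast (x ^ (3 * ε)),
    ← Real.rpow_mul (by positivity), ← Real.rpow_mul hφ, ← Real.rpow_mul hx.le,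
    ← Real.rpow_mul hx.le]
  ring_nf

/-- The loss is `y^{-2^{-n}} ≤ x^{2^{-n}} = exp (log x / 2^n) ≤ e`. -/
theorem gain_le_three_mul {x y : ℝ} {n : ℕ} (hx : 1 ≤ x) (hy : 0 < y) (hxy : x⁻¹ ≤ y)
    (hn : Real.log x ≤ 2 ^ n) : gain y n ≤ 3 * y := by
  have hx0 : 0 < x := by linarith
  have h1 : y⁻¹ ≤ x := inv_le_of_inv_le₀ hx0 hxy
  have h2 : y⁻¹ ^ ((1 / 2 : ℝ) ^ n) ≤ 3 := by
    calc y⁻¹ ^ ((1 / 2 : ℝ) ^ n) ≤ x ^ ((1 / 2 : ℝ) ^ n) :=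
          Real.rpow_le_rpow (by positivity) h1 (by positivity)
      _ = Real.exp (Real.log x * (1 / 2) ^ n) := Real.rpow_def_of_pos hx0 _
      _ ≤ Real.exp 1 := by
          apply Real.exp_le_exp.2
          rw [one_div, inv_pow, ← div_eq_mul_inv]
          exact (div_le_one (by positivity)).2 hn
      _ ≤ 3 := by have := Real.exp_one_lt_d9; linarith
  rw [gain_eq hy, mul_comm]
  gcongr

end Asymptotics

/-! ### The bound for large matrices -/

section Large

open DeformedWigner Filter

theorem eventXi_control {N : ℕ} {Ω : Type*} [MeasurableSpace Ω] {P : Measure Ω}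
    {W : Ω → Matrix (Fin N) (Fin N) ℂ} {b lam ε K cΞ : ℝ} {n₀ : ℕ} {v : Fin N → ℝ} {z : ℂ}
    (hN : 0 < N) :
    Control P W lam v z (indexA n₀ N) {ω | EventXi b lam ε n₀ K cΞ P W v z (W ω)}
      (phi K N ^ (cΞ * xi N) * (N : ℝ) ^ (-(1 / 2) + 2 * ε))
      (phi K N ^ (cΞ * xi N) * (N : ℝ) ^ (-(frakB b) / 2) * (N : ℝ) ^ ε) where
  fraction_le ω hω := hω.fraction_bound
  fraction_div_le ω hω a ha a' ha' haa' := by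
    refine (hω.fraction_div_bound a ha a' ha' haa').trans (le_of_eq ?_)
    rw [Real.rpow_add (by exact_mod_cast hN), mul_assoc]
  fluct_le ω hω := hω.fluct_bound

/-- The requirements on `N`, collected. -/
structure IsLarge (b lam ε K cΞ ν θ C₀ : ℝ) (N : ℕ) : Prop where
  two_le : 2 ≤ N
  theta_le : 5 * θ ≤ N
  expMoment_le : 1 + expMomentBound C₀ ≤ N
  lam_le : 4 + 2 * lam ≤ N
  one_le_log_log : 1 ≤ Real.log (Real.log N)
  sq_log_log_le : 10 * Real.log (Real.log N) ^ 2 ≤ Real.log N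
  depth_le : (13 + 6 * ε + 16 * θ) + 2 * (2 * Real.log (Real.log N) + 1) + 2 ≤
    ν / 2 * √(Real.log N)
  small : ε < frakB b / 2 →
    (21 + 10 * K * cΞ) * Real.log (Real.log N) ^ 2 + Real.log 9216 ≤
      (frakB b / 2 - ε) * Real.log N

/-- With `l = log log N`, powers of `φ_N` with exponent proportional to `ξ` are `exp (O(l²))`. Hence
they are `N^{o(1)}`, and a strictly positive power of `N` absorbs them. -/
theorem eventually_isLarge {b lam ε K cΞ ν θ C₀ : ℝ} (hν : 0 < ν) :
    ∀ᶠ N : ℕ in atTop, IsLarge b lam ε K cΞ ν θ C₀ N := by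
  have hcast : ∀ c : ℝ, ∀ᶠ N : ℕ in atTop, c ≤ (N : ℝ) := fun c =>
    tendsto_natCast_atTop_atTop.eventually_ge_atTop c
  have hsmall : ∀ᶠ N : ℕ in atTop, ε < frakB b / 2 →
      (21 + 10 * K * cΞ) * Real.log (Real.log N) ^ 2 + Real.log 9216 ≤
        (frakB b / 2 - ε) * Real.log N := by
    by_cases h : ε < frakB b / 2
    · filter_upwards [eventually_mul_sq_log_add_le (21 + 10 * K * cΞ) (Real.log 9216)
        (sub_pos.2 h)] with N hN _ using hN
    · exact .of_forall fun N h' => absurd h' h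
  filter_upwards [eventually_ge_atTop 2, hcast (5 * θ), hcast (1 + expMomentBound C₀),
    hcast (4 + 2 * lam),
    (Real.tendsto_log_atTop.comp tendsto_log_natCast).eventually_ge_atTop 1,
    eventually_mul_sq_log_add_le 10 0 one_pos,
    eventually_mul_log_add_le_sqrt 4 ((13 + 6 * ε + 16 * θ) + 4) (half_pos hν), hsmall]
    with N h1 h2 h3 h4 h5 h6 h7 h8
  exact ⟨h1, h2, h3, h4, h5, by linarith, by linarith, h8⟩

variable {b lam ε K cΞ ν θ C₀ : ℝ} {N : ℕ}

theorem frakB_nonneg_le_half (hb : 1 < b) : 0 ≤ frakB b ∧ frakB b ≤ 1 / 2 := by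
  unfold frakB
  constructor
  · rw [sub_nonneg, div_le_div_iff₀ (by linarith) (by norm_num)]; linarith
  · have : 0 ≤ 1 / (b + 1) := by positivity
    linarith

theorem exp_one_le_log (hN : IsLarge b lam ε K cΞ ν θ C₀ N) : Real.exp 1 ≤ Real.log N := by
  have hx : (1 : ℝ) < N := by exact_mod_cast hN.two_le
  rw [← Real.exp_log (Real.log_pos hx)]
  exact Real.exp_le_exp.2 hN.one_le_log_log

theorem phi_rpow_eq (hN : IsLarge b lam ε K cΞ ν θ C₀ N) (u : ℝ) :
    phi K N ^ (u * xi N) = Real.exp (10 * K * u * Real.log (Real.log N) ^ 2) := by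
  have hL : 0 < Real.log N := (Real.exp_pos 1).trans_le (exp_one_le_log hN)
  unfold phi xi
  rw [← Real.rpow_mul hL.le, Real.rpow_def_of_pos hL]
  ring_nf

theorem one_le_phi_rpow (hN : IsLarge b lam ε K cΞ ν θ C₀ N) (hK : 1 ≤ K) {u : ℝ} (hu : 0 ≤ u) :
    1 ≤ phi K N ^ (u * xi N) := by
  rw [phi_rpow_eq hN]
  exact Real.one_le_exp (by positivity)

theorem natCast_le_exp_of_le_log_rpow (hN : IsLarge b lam ε K cΞ ν θ C₀ N) {p : ℕ}
    (hp : (p : ℝ) ≤ Real.log N ^ (xi N - 3 / 2)) :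
    (p : ℝ) ≤ Real.exp (10 * Real.log (Real.log N) ^ 2) ∧ (p : ℝ) ≤ N := by
  have hL : 0 < Real.log N := (Real.exp_pos 1).trans_le (exp_one_le_log hN)
  have hx0 : (0 : ℝ) < N := by have := hN.two_le; positivity
  have h1 := hN.one_le_log_log
  have h : (p : ℝ) ≤ Real.exp (10 * Real.log (Real.log N) ^ 2) := by
    refine hp.trans ?_
    rw [Real.rpow_def_of_pos hL, xi]
    apply Real.exp_le_exp.2
    nlinarith
  refine ⟨h, h.trans ?_⟩
  conv_rhs => rw [← Real.exp_log hx0]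
  exact Real.exp_le_exp.2 hN.sq_log_log_le

/-- The contribution of the bad event is negligible. -/
theorem bad_event_le_of_isLarge (hN : IsLarge b lam ε K cΞ ν θ C₀ N) (hC₀ : 0 < C₀)
    (hθ : 1 < θ) (hlam : 0 < lam) (hε : 0 < ε) (hb : 1 < b) {z : ℂ} (hz : z ∈ domainD b lam ε N)
    {p : ℕ} (hp1 : 1 ≤ p) (hp : (p : ℝ) ≤ Real.log N ^ (xi N - 3 / 2)) {n : ℕ}
    (hn : (n : ℝ) ≤ 2 * Real.log (Real.log N) + 1) {X y : ℝ} (hX : (N : ℝ)⁻¹ ≤ X)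
    (hy : (N : ℝ)⁻¹ ≤ y) :
    (2 ^ (n + 1)) ^ p * (√(Real.exp (-ν * Real.log N ^ xi N)) *
      √(rowMomentBound C₀ lam z N (2 * p) ⌈θ * (2 * (2 * p) : ℕ)⌉₊)) ≤ (X * y ^ n) ^ p := by
  obtain ⟨hz0, hre1, hre2, him1, him2⟩ := hz
  have hx2 : (2 : ℝ) ≤ N := by exact_mod_cast hN.two_le
  have hx0 : (0 : ℝ) < N := by linarith
  have hL1 : 1 ≤ Real.log N := le_trans (Real.one_le_exp zero_le_one) (exp_one_le_log hN)
  have hV := rowMomentBound_le hC₀.le hθ hlam hε hN.two_le hN.theta_le hN.expMoment_le hN.lam_le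
    hp1 (natCast_le_exp_of_le_log_rpow hN hp).2 hz0 (abs_le.2 ⟨by linarith, hre2⟩) him1
    (him2.trans (Real.rpow_le_rpow_of_exponent_le (by linarith) (by
      have : 0 < 1 / (b + 1) := by positivity
      linarith)))
  refine (bad_event_contribution_le hx2 hL1 (by positivity) hp hV ?_).trans ?_
  · have := hN.depth_le
    linarith
  · have e : (N : ℝ) ^ (-(1 + n : ℝ)) = (N : ℝ)⁻¹ * (N : ℝ)⁻¹ ^ n := by
      rw [Real.rpow_neg hx0.le, Real.rpow_add hx0, Real.rpow_one, Real.rpow_natCast, mul_inv,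
        inv_pow]
    have hX0 : 0 ≤ X := le_trans (by positivity) hX
    rw [e]
    gcongr

theorem inv_le_mul_rpow {Λ x u : ℝ} (hΛ : 1 ≤ Λ) (hx : 1 ≤ x) (hu : -1 ≤ u) : x⁻¹ ≤ Λ * x ^ u := by
  have hx0 : 0 < x := by linarith
  calc x⁻¹ = 1 * x ^ (-1 : ℝ) := by rw [Real.rpow_neg_one, one_mul]
    _ ≤ Λ * x ^ u := by
      gcongr

/-- Smallness of `(48p)² y` in logarithmic form: `9216 = 48² · 4`, while `p²`, `n + 1` and the
powers of `φ_N` and `N` supply the four exponents. -/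
theorem mul_exp_le_one {p m l c q : ℝ} (hp0 : 0 ≤ p) (hm0 : 0 ≤ m)
    (hp : p ≤ Real.exp (10 * l ^ 2)) (hm : m ≤ Real.exp l)
    (h : Real.log 9216 + (20 * l ^ 2 + (l + (c * l ^ 2 + q))) ≤ 0) :
    9216 * (p ^ 2 * (m * (Real.exp (c * l ^ 2) * Real.exp q))) ≤ 1 := by
  have h2 : p ^ 2 ≤ Real.exp (20 * l ^ 2) := by
    calc p ^ 2 ≤ Real.exp (10 * l ^ 2) ^ 2 := by gcongr
      _ = Real.exp (20 * l ^ 2) := by rw [← Real.exp_nat_mul]; push_cast; ring_nf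
  have h3 := Real.exp_le_one_iff.2 h
  rw [Real.exp_add, Real.exp_add, Real.exp_add, Real.exp_add,
    Real.exp_log (by norm_num : (0 : ℝ) < 9216)] at h3
  exact le_trans (by gcongr) h3

theorem smallness_exponent_nonpos {l c t L h : ℝ} (hl : 1 ≤ l)
    (hs : (21 + c) * l ^ 2 + h ≤ t * L) :
    h + (20 * l ^ 2 + (l + (c * l ^ 2 + L * -t))) ≤ 0 := by
  nlinarith

theorem sq_log_le_phi_rpow (hN : IsLarge b lam ε K cΞ ν θ C₀ N) (hK : 1 ≤ K) :
    Real.log N ^ 2 ≤ phi K N ^ (1 * xi N) := by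
  have hL : 0 < Real.log N := (Real.exp_pos 1).trans_le (exp_one_le_log hN)
  have h1 := hN.one_le_log_log
  rw [phi_rpow_eq hN]
  conv_lhs => rw [← Real.exp_log hL, ← Real.exp_nat_mul]
  apply Real.exp_le_exp.2
  push_cast
  nlinarith [mul_le_mul_of_nonneg_right hK (sq_nonneg (Real.log (Real.log N)))]

theorem phi_rpow_split (hN : IsLarge b lam ε K cΞ ν θ C₀ N) :
    phi K N ^ ((1 + 2 * cΞ) * xi N) =
      phi K N ^ (1 * xi N) * (phi K N ^ (cΞ * xi N) * phi K N ^ (cΞ * xi N)) := by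
  rw [phi_rpow_eq hN, phi_rpow_eq hN, phi_rpow_eq hN, ← Real.exp_add, ← Real.exp_add]
  ring_nf

variable {Ω : Type*} [MeasurableSpace Ω] {P : Measure Ω} [IsProbabilityMeasure P]
  {W : Ω → Matrix (Fin N) (Fin N) ℂ} {v : Fin N → ℝ} {z : ℂ} {A : Finset (Fin N)} {E : Set Ω}

/-- When `𝔟/2 ≤ ε`, one has `-1/2 + 2ε ≤ -1/2 - 𝔟/2 + 3ε`, so `X` alone is below the target. -/
theorem integral_norm_mean_fluct_le_of_isLarge_of_ge (hN : IsLarge b lam ε K cΞ ν θ C₀ N)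
    (hW : IsWigner P C₀ θ W) (hC₀ : 0 < C₀) (hθ : 1 < θ) (hlam : 0 < lam) (hε : 0 < ε)
    (hb : 1 < b) (hK : 1 ≤ K) (hcΞ : 0 < cΞ) (hεb : frakB b / 2 ≤ ε)
    (hv : ∀ i, v i ∈ Set.Icc (-1 : ℝ) 1) (hz : z ∈ domainD b lam ε N)
    (hE : Control P W lam v z A E (phi K N ^ (cΞ * xi N) * (N : ℝ) ^ (-(1 / 2) + 2 * ε))
      (phi K N ^ (cΞ * xi N) * (N : ℝ) ^ (-(frakB b) / 2) * (N : ℝ) ^ ε))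
    (hδ : P.real Eᶜ ≤ Real.exp (-ν * Real.log N ^ xi N)) (s : ℕ)
    (hp : ((2 * s + 2 : ℕ) : ℝ) ≤ Real.log N ^ (xi N - 3 / 2)) :
    ∫ ω, ‖1 / (N : ℂ) * ∑ i ∈ A, fluct P W lam v z i (W ω)‖ ^ (2 * s + 2) ∂P ≤
      ((400 * (2 * s + 2 : ℕ)) ^ (2 : ℝ) * phi K N ^ ((1 + 2 * cΞ) * xi N) *
        (N : ℝ) ^ (-(1 / 2) - frakB b / 2) * (N : ℝ) ^ (3 * ε)) ^ (2 * s + 2) := by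
  have hx1 : (1 : ℝ) ≤ N := by exact_mod_cast hN.two_le.trans' (by norm_num)
  have hx0 : (0 : ℝ) < N := by linarith
  have hΛ := one_le_phi_rpow hN hK hcΞ.le
  have hφ := one_le_phi_rpow hN hK (zero_le_one (α := ℝ))
  rw [phi_rpow_split hN]
  set Λ := phi K N ^ (cΞ * xi N)
  set Φ := phi K N ^ (1 * xi N)
  set X := Λ * (N : ℝ) ^ (-(1 / 2) + 2 * ε) with hX
  have hXi : (N : ℝ)⁻¹ ≤ X := inv_le_mul_rpow hΛ hx1 (by linarith)
  have hbad := bad_event_le_of_isLarge hN hC₀ hθ hlam hε hb hz (by omega) hp (n := 0)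
    (by have := hN.one_le_log_log; push_cast; linarith) hXi hXi
  rw [zero_add, pow_one, pow_zero, mul_one] at hbad
  refine (integral_norm_mean_fluct_le_of_trivial hW hC₀.le (by linarith) hv hz.1 hE
    (by positivity) hδ (by omega) (Nat.le_ceil _) hbad).trans ?_
  gcongr ?_ ^ _
  have h1 : (N : ℝ) ^ (-(1 / 2) + 2 * ε) ≤
      (N : ℝ) ^ (-(1 / 2) - frakB b / 2) * (N : ℝ) ^ (3 * ε) := by
    rw [← Real.rpow_add hx0]
    exact Real.rpow_le_rpow_of_exponent_le hx1 (by linarith)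
  have h2 : (2 : ℝ) ≤ (400 * (2 * s + 2 : ℕ)) ^ (2 : ℝ) := by
    rw [Real.rpow_two]
    push_cast
    nlinarith [(Nat.cast_nonneg s : (0 : ℝ) ≤ s)]
  calc 2 * X = 2 * (1 * (1 * Λ)) * (N : ℝ) ^ (-(1 / 2) + 2 * ε) := by rw [hX]; ring
    _ ≤ (400 * (2 * s + 2 : ℕ)) ^ (2 : ℝ) * (Φ * (Λ * Λ)) *
        ((N : ℝ) ^ (-(1 / 2) - frakB b / 2) * (N : ℝ) ^ (3 * ε)) := by gcongr
    _ = _ := by ring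

theorem integral_norm_mean_fluct_le_of_isLarge_of_lt (hN : IsLarge b lam ε K cΞ ν θ C₀ N)
    (hW : IsWigner P C₀ θ W) (hC₀ : 0 < C₀) (hθ : 1 < θ) (hlam : 0 < lam) (hε : 0 < ε)
    (hb : 1 < b) (hK : 1 ≤ K) (hcΞ : 0 < cΞ) (hεb : ε < frakB b / 2)
    (hv : ∀ i, v i ∈ Set.Icc (-1 : ℝ) 1) (hz : z ∈ domainD b lam ε N)
    (hE : Control P W lam v z A E (phi K N ^ (cΞ * xi N) * (N : ℝ) ^ (-(1 / 2) + 2 * ε))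
      (phi K N ^ (cΞ * xi N) * (N : ℝ) ^ (-(frakB b) / 2) * (N : ℝ) ^ ε))
    (hδ : P.real Eᶜ ≤ Real.exp (-ν * Real.log N ^ xi N)) (s : ℕ)
    (hp : ((2 * s + 2 : ℕ) : ℝ) ≤ Real.log N ^ (xi N - 3 / 2)) :
    ∫ ω, ‖1 / (N : ℂ) * ∑ i ∈ A, fluct P W lam v z i (W ω)‖ ^ (2 * s + 2) ∂P ≤
      ((400 * (2 * s + 2 : ℕ)) ^ (2 : ℝ) * phi K N ^ ((1 + 2 * cΞ) * xi N) *
        (N : ℝ) ^ (-(1 / 2) - frakB b / 2) * (N : ℝ) ^ (3 * ε)) ^ (2 * s + 2) := by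
  have hx1 : (1 : ℝ) ≤ N := by exact_mod_cast hN.two_le.trans' (by norm_num)
  have hx0 : (0 : ℝ) < N := by linarith
  have hL0 : 0 < Real.log N := (Real.exp_pos 1).trans_le (exp_one_le_log hN)
  obtain ⟨hβ0, hβ1⟩ := frakB_nonneg_le_half hb
  set l := Real.log (Real.log N) with hl
  have hl1 : 1 ≤ l := hN.one_le_log_log
  have hlL : 10 * l ^ 2 ≤ Real.log N := hN.sq_log_log_le
  have hΛ := one_le_phi_rpow hN hK hcΞ.le
  have hΛe := phi_rpow_eq hN cΞ
  have hΦ := sq_log_le_phi_rpow hN hK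
  rw [phi_rpow_split hN]
  set Λ := phi K N ^ (cΞ * xi N)
  set Φ := phi K N ^ (1 * xi N)
  set X := Λ * (N : ℝ) ^ (-(1 / 2) + 2 * ε) with hX
  have hXi : (N : ℝ)⁻¹ ≤ X := inv_le_mul_rpow hΛ hx1 (by linarith)
  have hX0 : 0 < X := by positivity
  have hYe : Λ * (N : ℝ) ^ (-(frakB b) / 2) * (N : ℝ) ^ ε =
      Λ * (N : ℝ) ^ (-(frakB b / 2 - ε)) := by
    rw [mul_assoc, ← Real.rpow_add hx0]; ring_nf
  rw [hYe] at hE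
  set τ := frakB b / 2 - ε with hτ
  set Y := Λ * (N : ℝ) ^ (-τ) with hY
  have hY0 : 0 < Y := by positivity
  have hNY : (N : ℝ) ^ (-(1 / 2) : ℝ) ≤ Y := by
    calc (N : ℝ) ^ (-(1 / 2) : ℝ) = 1 * (N : ℝ) ^ (-(1 / 2) : ℝ) := (one_mul _).symm
      _ ≤ Λ * (N : ℝ) ^ (-τ) := by
        gcongr
        linarith
  have hYi : (N : ℝ)⁻¹ ≤ Y := inv_le_mul_rpow hΛ hx1 (by linarith)
  -- Deep enough that `2^n ≥ log N`, since `log 2 ≥ 1/2`, yet shallow enough that `n + 1 ≤ log N`.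
  set n := ⌈2 * l⌉₊ with hn
  have hn1 : 2 * l ≤ n := Nat.le_ceil _
  have hn2 : (n : ℝ) ≤ 2 * l + 1 := (Nat.ceil_lt_add_one (by linarith)).le
  have hnL : (n : ℝ) + 1 ≤ Real.log N := by
    have : l * 1 ≤ l * l := by gcongr
    rw [sq] at hlL
    linarith
  have hpow : Real.log N ≤ 2 ^ n := by
    have h2 : (1 / 2 : ℝ) ≤ Real.log 2 := by have := Real.log_two_gt_d9; linarith
    calc Real.log N = Real.exp l := (Real.exp_log hL0).symm
      _ ≤ Real.exp (Real.log 2 * n) := by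
          have : 1 / 2 * (2 * l) ≤ Real.log 2 * n := by gcongr
          exact Real.exp_le_exp.2 (by linarith)
      _ = 2 ^ n := by rw [mul_comm, Real.exp_nat_mul, Real.exp_log two_pos]
  set y := 4 * (n + 1) * Y with hy
  have hn0 : (0 : ℝ) ≤ n := Nat.cast_nonneg n
  have hYy : 2 * Y ≤ y := by
    have : 0 ≤ n * Y := by positivity
    rw [hy]
    linarith
  have hy0 : 0 < y := by linarith
  set p : ℝ := 2 * s + 2 with hpdef
  have hpc : ((2 * s + 2 : ℕ) : ℝ) = p := by push_cast; rfl
  have hp2 : 2 ≤ p := by have : (0 : ℝ) ≤ s := Nat.cast_nonneg s; linarith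
  have hpe : p ≤ Real.exp (10 * l ^ 2) := hpc ▸ (natCast_le_exp_of_le_log_rpow hN hp).1
  have hsmall : (48 * p) ^ 2 * y ≤ 1 := by
    have h1 : 9216 * (p ^ 2 * ((n + 1) *
        (Real.exp (10 * K * cΞ * l ^ 2) * Real.exp (Real.log N * -τ)))) ≤ 1 := by
      refine mul_exp_le_one (by linarith) (by linarith) hpe ?_
        (smallness_exponent_nonpos hl1 (hN.small hεb))
      rw [hl, Real.exp_log hL0]
      exact hnL
    rw [hy, hY, hΛe, Real.rpow_def_of_pos hx0]
    linarith
  have hy1 : y ≤ 1 := by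
    have h1 : 1 ≤ (48 * p) ^ 2 := one_le_pow₀ (by linarith)
    exact (le_mul_of_one_le_left hy0.le h1).trans hsmall
  have hsy : 48 * p * √y ≤ 1 := by
    refine (sq_le_one_iff₀ (by positivity)).1 ?_
    rw [mul_pow, Real.sq_sqrt hy0.le]
    exact hsmall
  have hNy : 1 / (N : ℝ) ≤ y ^ 2 := by
    have h1 : 1 / (N : ℝ) = ((N : ℝ) ^ (-(1 / 2) : ℝ)) ^ 2 := by
      rw [← Real.rpow_natCast, ← Real.rpow_mul hx0.le]
      norm_num [Real.rpow_neg_one]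
    rw [h1]
    gcongr
    linarith
  have hbad := bad_event_le_of_isLarge hN hC₀ hθ hlam hε hb hz (by omega) hp hn2 hXi
    (y := y / 2) (by linarith)
  refine (integral_norm_mean_fluct_le hW hC₀.le (by linarith) hv hz.1 hE hX0 hY0 hδ s n
    (Nat.le_ceil _) hy hy1 hNy hsy hbad).trans ?_
  have hgain0 := (gain_pos hy0 n).le
  have hgain : gain y n ≤ 3 * y := gain_le_three_mul hx1 hy0 (by linarith) hpow
  gcongr ?_ ^ _
  rw [hpc, Real.rpow_two]
  -- The exponents `-1/2 + 2ε` and `-𝔟/2 + ε` add up exactly to the target; this is the origin of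
  -- `3ε`.
  have hXY : X * Y = Λ * Λ * ((N : ℝ) ^ (-(1 / 2) - frakB b / 2) * (N : ℝ) ^ (3 * ε)) := by
    have : (N : ℝ) ^ (-(1 / 2) - frakB b / 2) * (N : ℝ) ^ (3 * ε) =
        (N : ℝ) ^ (-(1 / 2) + 2 * ε) * (N : ℝ) ^ (-τ) := by
      rw [← Real.rpow_add hx0, ← Real.rpow_add hx0, hτ]; ring_nf
    rw [this, hX, hY]; ring
  calc (24 * p) ^ 2 * (16 * (n + 1) * X) * gain y n
      ≤ (24 * p) ^ 2 * (16 * (n + 1) * X) * (3 * y) := by gcongr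
    _ = 110592 * p ^ 2 * (n + 1) ^ 2 * (X * Y) := by rw [hy]; ring
    _ ≤ 160000 * p ^ 2 * Real.log N ^ 2 * (X * Y) := by gcongr; norm_num
    _ ≤ 160000 * p ^ 2 * Φ * (X * Y) := by gcongr
    _ = _ := by rw [hXY]; ring

end Large

end FluctuationAveraging

end

/-! ### Choice of constants and conclusion. -/

theorem lemma6p6
    (a b : ℝ) (ha : -1 < a) (hb : 1 < b)
    (d : ℝ → ℝ) (hd : ContDiffOn ℝ 1 d (Set.Icc (-1) 1)) (hd0 : ∀ x ∈ Set.Icc (-1 : ℝ) 1, 0 < d x)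
    (hcent : ∫ x, x ∂(DeformedWigner.jacobiMeasure a b d) = 0)
    (lam : ℝ) (hlam : DeformedWigner.lambdaPlus (DeformedWigner.jacobiMeasure a b d) < lam)
    (C₀ θ : ℝ) (hC₀ : 0 < C₀) (hθ : 1 < θ)
    (n₀ : ℕ) (hn₀ : 10 < n₀)
    (ε : ℝ) (hε : 0 < ε) (hε' : ε < (10 + (b + 1) / (b - 1)) * DeformedWigner.frakB b)
    (K : ℝ) (hK : 1 ≤ K)
    (𝔠 CV : ℝ) (h𝔠 : 𝔠 < 1) (hCV : 0 < CV)
    (cΞ ν : ℝ) (hcΞ : 0 < cΞ) (hν : 0 < ν) :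
    ∃ C c c₀ : ℝ, 0 < C ∧ 0 < c ∧ 0 < c₀ ∧ ∃ N₀ : ℕ, ∀ N : ℕ, N₀ ≤ N →
      ∀ (Ω : Type*) [MeasurableSpace Ω] (P : MeasureTheory.Measure Ω)
        [MeasureTheory.IsProbabilityMeasure P] (W : Ω → Matrix (Fin N) (Fin N) ℂ),
      DeformedWigner.IsWigner P C₀ θ W →
      ∀ v : Fin N → ℝ,
      DeformedWigner.OmegaV (DeformedWigner.jacobiMeasure a b d) b lam ε n₀ 𝔠 CV v →
      ∀ z ∈ DeformedWigner.domainD' (DeformedWigner.jacobiMeasure a b d) b lam ε n₀ v,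
      P.real {ω | ¬ DeformedWigner.EventXi b lam ε n₀ K cΞ P W v z (W ω)}
        ≤ Real.exp (-ν * Real.log N ^ DeformedWigner.xi N) →
      ∀ p r : ℕ, 0 < r → p = 2 * r →
      (p : ℝ) ≤ Real.log N ^ (DeformedWigner.xi N - 3 / 2) →
      MeasureTheory.Integrable (fun ω => ‖1 / (N : ℂ) * ∑ i ∈ DeformedWigner.indexA n₀ N,
        DeformedWigner.fluct P W lam v z i (W ω)‖ ^ p) P ∧
      ∫ ω, ‖1 / (N : ℂ) * ∑ i ∈ DeformedWigner.indexA n₀ N,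
        DeformedWigner.fluct P W lam v z i (W ω)‖ ^ p ∂P
        ≤ (C * p) ^ (c * p) * DeformedWigner.phi K N ^ (c₀ * p * DeformedWigner.xi N) *
          (N : ℝ) ^ (-(p : ℝ) / 2 - p * DeformedWigner.frakB b / 2) *
          (N : ℝ) ^ (3 * p * ε) := by
  have hlam0 : 0 < lam := (Real.sqrt_nonneg _).trans_lt hlam
  obtain ⟨hβ0, hβ1⟩ := FluctuationAveraging.frakB_nonneg_le_half hb
  -- The recursion leaves `110592 p² (n+1)² X Y`, and `110592 ≤ 400²`. Two powers `φ^{cΞ ξ}` come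
  -- from `X` and `Y`, and one `φ^ξ` absorbs `(n+1)² ≤ (log N)²`.
  refine ⟨400, 2, 1 + 2 * cΞ, by norm_num, by norm_num, by positivity, ?_⟩
  obtain ⟨N₀, hN₀⟩ := Filter.eventually_atTop.1
    (FluctuationAveraging.eventually_isLarge (b := b) (lam := lam) (ε := ε) (K := K) (cΞ := cΞ)
      (θ := θ) (C₀ := C₀) hν)
  refine ⟨N₀, fun N hN Ω _ P _ W hW v hv z hz hprob p r hr hpr hp => ?_⟩
  have hL := hN₀ N hN
  have hx0 : (0 : ℝ) < N := by have := hL.two_le; positivity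
  have hθ0 : 0 < θ := by linarith
  refine ⟨FluctuationAveraging.integrable_norm_mean_fluct_pow hW hC₀.le hθ0 hv.mem_support hz.1.1
    _ p, ?_⟩
  obtain ⟨s, rfl⟩ : ∃ s, p = 2 * s + 2 := ⟨r - 1, by omega⟩
  have hE := FluctuationAveraging.eventXi_control (P := P) (W := W) (b := b) (lam := lam) (ε := ε)
    (K := K) (cΞ := cΞ) (n₀ := n₀) (v := v) (z := z) (by exact_mod_cast hx0)
  rw [FluctuationAveraging.rpow_bound_eq_pow (φ := DeformedWigner.phi K N)
    (by norm_num) (Real.rpow_nonneg (Real.log_natCast_nonneg N) K) hx0]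
  -- The threshold at which `N^{-𝔟/2+ε}` stops being a negative power of `N`.
  rcases lt_or_ge ε (DeformedWigner.frakB b / 2) with hlt | hge
  · exact FluctuationAveraging.integral_norm_mean_fluct_le_of_isLarge_of_lt hL hW hC₀ hθ hlam0 hε hb
      hK hcΞ hlt hv.mem_support hz.1 hE hprob s hp
  · exact FluctuationAveraging.integral_norm_mean_fluct_le_of_isLarge_of_ge hL hW hC₀ hθ hlam0 hε hb
      hK hcΞ hge hv.mem_support hz.1 hE hprob s hp
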